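/- Let $P\subset\mathbb H^n$ be a bounded $n$-dimensional convex polytope that is right-angled (all its dihedral angles are $\pi/2$), and let $W$ be the group generated by the reflections $s_{F'}$ across the facets (codimension-one faces) $F'$ of $P$. A characteristic function for $P$ is an epimorphism $\lambda$ from $W$ onto an $n$-dimensional $\mathbb Z_2$-vector space such that, whenever $n$ distinct facets $F_1,\dots,F_n$ meet at a vertex, $\lambda(s_{F_1}),\dots,\lambda(s_{F_n})$ form a basis; the small cover of $P$ associated to $\lambda$ is $M_\lambda=\mathbb H^n/\Gamma_\lambda$, where $\Gamma_\lambda=\ker\lambda$, with its quotient metric. Let $\lambda:W\to(\mathbb Z_2)^n$ be a characteristic function and let $F$ be a (nonempty) face of $P$, of dimension $k$ (so $0\le k\le n$; $F=P$ is allowed). Let $\mathbb H_F\subset\mathbb H^n$ be the hyperbolic subspace spanned by $F$, let $M_F$ be the image of $\mathbb H_F$ in $M_\lambda$, and let $V_F=\lambda(\operatorname{Stab}_W(F))\subset(\mathbb Z_2)^n$. Then: 1. Two points of $\mathbb H_F$ have the same image in $M_\lambda$ if and only if they lie in one orbit of $\Gamma_\lambda\cap\operatorname{Stab}(\mathbb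 H_F)$; that is, $M_F=\mathbb H_F/(\Gamma_\lambda\cap\operatorname{Stab}(\mathbb H_F))$. 2. $M_F$ is a $k$-dimensional totally geodesic submanifold of $M_\lambda$: every point of $M_F$ has a metric ball $B$ around it in $M_\lambda$ such that the pair $(B,\,B\cap M_F)$ is isometric to $(B',\,B'\cap S)$ for a ball $B'$ in $\mathbb H^n$ and a $k$-dimensional hyperbolic subspace $S\subset\mathbb H^n$. 3. $M_F$ is a small cover of $F$. Precisely: $V_F$ has codimension $k$ in $(\mathbb Z_2)^n$, and there is an isometry $\varphi$ of $\mathbb H^k$ onto $\mathbb H_F$ for which $Q=\varphi^{-1}(F)$ is a right-angled bounded $k$-dimensional polytope in $\mathbb H^k$. For each facet $G$ of $Q$ there is exactly one facet $F'$ of $P$ with $\varphi(G)=F'\cap F$, and then $s_{F'}\circ\varphi=\varphi\circ s_G$. Let $W_Q$ be the reflection group of $Q$. There is a characteristic function $\overline\lambda:W_Q\to(\mathbb Z_2)^n/V_F$ for $Q$, induced by $\lambda$ in the sense that $\overline\lambda(u)=\lambda(w)+V_F$ whenever $u\in W_Q$, $w\in W$ and $w\circ\varphi=\varphi\circ u$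 (so $\overline\lambda(s_G)=\lambda(s_{F'})+V_F$ for $G$, $F'$ as above). An isometry $u$ of $\mathbb H^k$ lies in $\ker\overline\lambda$ if and only if $\gamma\circ\varphi=\varphi\circ u$ for some $\gamma\in\Gamma_\lambda$. Finally, $\varphi$ induces a map $M_{\overline\lambda}\to M_\lambda$ that is a topological embedding with image $M_F$ and is locally distance-preserving (every point of $M_{\overline\lambda}$ has a ball around it on which the map preserves distances). -/

import Mathlib

namespace SmallCovers

/-! ### Hyperbolic space: the hyperboloid model -/

/-- The vector space `ℝ^{n,1}`: `n` space coordinates and one time coordinate. -/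
abbrev LSpace (n : ℕ) : Type := EuclideanSpace ℝ (Fin n) × ℝ

/-- The Lorentz form `x₁y₁ + ⋯ + xₙyₙ - x₀y₀`. -/
noncomputable def lorentz {n : ℕ} (x y : LSpace n) : ℝ := inner ℝ x.1 y.1 - x.2 * y.2

/-- Hyperbolic space `ℍⁿ`: the upper sheet of the hyperboloid `⟨x, x⟩ = -1`. -/
@[ext]
structure Hyp (n : ℕ) : Type where
  /-- The underlying vector. -/
  val : LSpace n
  lorentz_self : lorentz val val = -1
  time_pos : 0 < val.2

instance {n : ℕ} : CoeOut (Hyp n) (LSpace n) := ⟨Hyp.val⟩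

section lorentz_facts

variable {n : ℕ}

lemma lorentz_comm (x y : LSpace n) : lorentz x y = lorentz y x := by
  unfold lorentz; rw [real_inner_comm]; ring

lemma lorentz_add_left (x y z : LSpace n) : lorentz (x + y) z = lorentz x z + lorentz y z := by
  unfold lorentz; simp only [Prod.fst_add, Prod.snd_add, inner_add_left]; ring

lemma lorentz_sub_left (x y z : LSpace n) : lorentz (x - y) z = lorentz x z - lorentz y z := by
  unfold lorentz; simp only [Prod.fst_sub, Prod.snd_sub, inner_sub_left]; ring

lemma lorentz_smul_left (c : ℝ) (x y : LSpace n) : lorentz (c • x) y = c * lorentz x y := by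
  unfold lorentz; simp only [Prod.smul_fst, Prod.smul_snd, inner_smul_left, smul_eq_mul]
  simp; ring

lemma lorentz_add_right (x y z : LSpace n) : lorentz x (y + z) = lorentz x y + lorentz x z := by
  rw [lorentz_comm, lorentz_add_left, lorentz_comm y, lorentz_comm z]

lemma lorentz_sub_right (x y z : LSpace n) : lorentz x (y - z) = lorentz x y - lorentz x z := by
  rw [lorentz_comm, lorentz_sub_left, lorentz_comm y, lorentz_comm z]

lemma lorentz_smul_right (c : ℝ) (x y : LSpace n) : lorentz x (c • y) = c * lorentz x y := by
  rw [lorentz_comm, lorentz_smul_left, lorentz_comm y]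

lemma Hyp.sq_eq (x : Hyp n) : (x : LSpace n).2 ^ 2 = 1 + ‖(x : LSpace n).1‖ ^ 2 := by
  have h := x.lorentz_self
  unfold lorentz at h
  rw [real_inner_self_eq_norm_sq] at h
  nlinarith

lemma Hyp.norm_lt (x : Hyp n) : ‖(x : LSpace n).1‖ < (x : LSpace n).2 := by
  have := x.sq_eq
  have h0 := x.time_pos
  exact lt_of_pow_lt_pow_left₀ 2 h0.le (by linarith)

/-- The orthogonal complement of a point of `ℍⁿ` is positive semidefinite. -/
lemma lorentz_nonneg_of_orthogonal (y : Hyp n) (u : LSpace n) (h : lorentz u y = 0) :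
    0 ≤ lorentz u u := by
  have h1 := y.norm_lt
  have h0 := y.time_pos
  have h2 := abs_real_inner_le_norm u.1 (y : LSpace n).1
  unfold lorentz at h ⊢
  rw [real_inner_self_eq_norm_sq]
  have h3 : inner ℝ u.1 (y : LSpace n).1 = u.2 * (y : LSpace n).2 := by linarith
  rw [h3, abs_mul, abs_of_pos h0] at h2
  have h4 : |u.2| * (y : LSpace n).2 ≤ ‖u.1‖ * (y : LSpace n).2 :=
    h2.trans (mul_le_mul_of_nonneg_left h1.le (norm_nonneg _))
  have h5 : |u.2| ≤ ‖u.1‖ := le_of_mul_le_mul_right h4 h0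
  have h6 : |u.2| ^ 2 ≤ ‖u.1‖ ^ 2 := pow_le_pow_left₀ (abs_nonneg _) h5 2
  rw [sq_abs] at h6
  nlinarith

lemma eq_zero_of_orthogonal (y : Hyp n) (u : LSpace n) (h : lorentz u y = 0)
    (h' : lorentz u u = 0) : u = 0 := by
  have h1 := y.norm_lt
  have h0 := y.time_pos
  have h2 := abs_real_inner_le_norm u.1 (y : LSpace n).1
  unfold lorentz at h h'
  rw [real_inner_self_eq_norm_sq] at h'
  have h3 : inner ℝ u.1 (y : LSpace n).1 = u.2 * (y : LSpace n).2 := by linarith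
  rw [h3, abs_mul, abs_of_pos h0] at h2
  have h4 : |u.2| = ‖u.1‖ := by
    have : |u.2| ^ 2 = ‖u.1‖ ^ 2 := by rw [sq_abs]; linarith
    exact (pow_left_inj₀ (abs_nonneg _) (norm_nonneg _) two_ne_zero).1 this
  rw [h4] at h2
  have h5 : ‖u.1‖ = 0 := by
    by_contra hne
    have hpos : 0 < ‖u.1‖ := lt_of_le_of_ne (norm_nonneg _) (Ne.symm hne)
    have := mul_lt_mul_of_pos_left h1 hpos
    linarith
  rw [h5] at h4
  exact Prod.ext (norm_eq_zero.1 h5) (abs_eq_zero.1 h4)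

lemma lorentz_sq_le (y : Hyp n) (u v : LSpace n) (hu : lorentz u y = 0) (hv : lorentz v y = 0) :
    lorentz u v ^ 2 ≤ lorentz u u * lorentz v v := by
  have key : ∀ t : ℝ, 0 ≤ lorentz v v * (t * t) + (2 * lorentz u v) * t + lorentz u u := by
    intro t
    have h := lorentz_nonneg_of_orthogonal y (u + t • v)
      (by rw [lorentz_add_left, lorentz_smul_left, hu, hv]; ring)
    simp only [lorentz_add_left, lorentz_add_right, lorentz_smul_left, lorentz_smul_right] at h
    rw [lorentz_comm v u] at h
    linarith
  have h := discrim_le_zero key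
  unfold discrim at h
  linarith

lemma one_le_neg_lorentz (x y : Hyp n) : 1 ≤ -lorentz (x : LSpace n) y := by
  have hx := x.lorentz_self
  have hy := y.lorentz_self
  have h1 := x.norm_lt
  have h2 := y.norm_lt
  have h3 := real_inner_le_norm (x : LSpace n).1 (y : LSpace n).1
  have hpos : 0 < -lorentz (x : LSpace n) y := by
    unfold lorentz
    have := mul_lt_mul'' h1 h2 (norm_nonneg _) (norm_nonneg _)
    linarith
  have h := lorentz_nonneg_of_orthogonal y
    ((x : LSpace n) + (lorentz (x : LSpace n) y) • (y : LSpace n))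
    (by rw [lorentz_add_left, lorentz_smul_left, hy]; ring)
  simp only [lorentz_add_left, lorentz_add_right, lorentz_smul_left, lorentz_smul_right] at h
  rw [lorentz_comm (y : LSpace n) x, hx, hy] at h
  nlinarith

end lorentz_facts

/-- The hyperbolic metric: `cosh d(x, y) = -⟨x, y⟩`. -/
noncomputable instance (n : ℕ) : MetricSpace (Hyp n) where
  dist x y := Real.arcosh (-lorentz (x : LSpace n) y)
  dist_self x := by
    show Real.arcosh (-lorentz (x : LSpace n) x) = 0
    rw [x.lorentz_self]; simp
  dist_comm x y := by
    show Real.arcosh _ = Real.arcosh _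
    rw [lorentz_comm]
  dist_triangle x y z := by
    show Real.arcosh (-lorentz (x : LSpace n) z) ≤
      Real.arcosh (-lorentz (x : LSpace n) y) + Real.arcosh (-lorentz (y : LSpace n) z)
    have hp := one_le_neg_lorentz x y
    have hq := one_le_neg_lorentz y z
    have hr := one_le_neg_lorentz x z
    have hx := x.lorentz_self
    have hy := y.lorentz_self
    have hz := z.lorentz_self
    have h := lorentz_sq_le y
      ((x : LSpace n) + (lorentz (x : LSpace n) y) • (y : LSpace n))
      ((z : LSpace n) + (lorentz (y : LSpace n) z) • (y : LSpace n))
      (by rw [lorentz_add_left, lorentz_smul_left, hy]; ring)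
      (by rw [lorentz_add_left, lorentz_smul_left, hy, lorentz_comm (z : LSpace n) y]; ring)
    simp only [lorentz_add_left, lorentz_add_right, lorentz_smul_left, lorentz_smul_right] at h
    rw [lorentz_comm (y : LSpace n) x, lorentz_comm (z : LSpace n) y, hx, hy, hz] at h
    have hA := Real.arcosh_nonneg hp
    have hB := Real.arcosh_nonneg hq
    rw [← Real.arcosh_cosh (add_nonneg hA hB), Real.arcosh_le_arcosh (by linarith)
      (Real.cosh_pos _), Real.cosh_add, Real.cosh_arcosh hp, Real.cosh_arcosh hq,
      Real.sinh_arcosh hp, Real.sinh_arcosh hq]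
    set p := lorentz (x : LSpace n) y
    set q := lorentz (y : LSpace n) z
    set r := lorentz (x : LSpace n) z
    rw [← Real.sqrt_mul (by nlinarith)]
    have : -r - p * q ≤ √(((-p) ^ 2 - 1) * ((-q) ^ 2 - 1)) := by
      apply Real.le_sqrt_of_sq_le
      nlinarith
    linarith
  eq_of_dist_eq_zero := by
    intro x y h
    have h1 : -lorentz (x : LSpace n) y = 1 :=
      (Real.arcosh_eq_zero_iff (one_le_neg_lorentz x y)).1 h
    have hx := x.lorentz_self
    have hy := y.lorentz_self
    have h2 := eq_zero_of_orthogonal y ((x : LSpace n) - y)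
      (by rw [lorentz_sub_left, hy]; linarith)
      (by simp only [lorentz_sub_left, lorentz_sub_right]
          rw [hx, hy, lorentz_comm (y : LSpace n) x]; linarith)
    exact Hyp.ext (sub_eq_zero.1 h2)

/-! ### Hyperplanes, half-spaces, reflections, subspaces -/

/-- The closed half-space with outward unit normal `e` (used when `⟨e, e⟩ = 1`). -/
def halfSpace {n : ℕ} (e : LSpace n) : Set (Hyp n) := {x | lorentz (x : LSpace n) e ≤ 0}

/-- The hyperplane with unit normal `e` (used when `⟨e, e⟩ = 1`). -/
def hyperplane {n : ℕ} (e : LSpace n) : Set (Hyp n) := {x | lorentz (x : LSpace n) e = 0}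

/-- The linear map `x ↦ x - 2⟨x, e⟩e`. -/
noncomputable def reflVec {n : ℕ} (e x : LSpace n) : LSpace n := x - (2 * lorentz x e) • e

lemma lorentz_reflVec {n : ℕ} (e : LSpace n) (he : lorentz e e = 1) (x y : LSpace n) :
    lorentz (reflVec e x) (reflVec e y) = lorentz x y := by
  unfold reflVec
  simp only [lorentz_sub_left, lorentz_sub_right, lorentz_smul_left, lorentz_smul_right]
  rw [lorentz_comm e y, he]; ring

lemma reflVec_reflVec {n : ℕ} (e : LSpace n) (he : lorentz e e = 1) (x : LSpace n) :
    reflVec e (reflVec e x) = x := by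
  unfold reflVec
  simp only [lorentz_sub_left, lorentz_smul_left]
  rw [he]
  module

lemma reflVec_mem {n : ℕ} (e : LSpace n) (he : lorentz e e = 1) (x : Hyp n) :
    lorentz (reflVec e x) (reflVec e x) = -1 ∧ 0 < (reflVec e (x : LSpace n)).2 := by
  have h1 : lorentz (reflVec e x) (reflVec e x) = -1 := by rw [lorentz_reflVec e he, x.lorentz_self]
  refine ⟨h1, ?_⟩
  have h2 : lorentz (x : LSpace n) (reflVec e x) ≤ -1 := by
    unfold reflVec
    rw [lorentz_sub_right, lorentz_smul_right, x.lorentz_self]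
    nlinarith [sq_nonneg (lorentz (x : LSpace n) e)]
  generalize reflVec e (x : LSpace n) = y at h1 h2
  by_contra hneg
  push Not at hneg
  have h3 := x.norm_lt
  have h4 : ‖y.1‖ ≤ -y.2 := by
    unfold lorentz at h1
    rw [real_inner_self_eq_norm_sq] at h1
    exact le_of_sq_le_sq (by nlinarith) (by linarith)
  have h5 := neg_le_of_abs_le (abs_real_inner_le_norm (x : LSpace n).1 y.1)
  have h6 := mul_le_mul h3.le h4 (norm_nonneg _) x.time_pos.le
  unfold lorentz at h2
  linarith

/-- The reflection of `ℍⁿ` across the hyperplane with unit normal `e`. -/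
noncomputable def reflection {n : ℕ} (e : LSpace n) (he : lorentz e e = 1) : Hyp n ≃ᵢ Hyp n where
  toFun x := ⟨reflVec e x, (reflVec_mem e he x).1, (reflVec_mem e he x).2⟩
  invFun x := ⟨reflVec e x, (reflVec_mem e he x).1, (reflVec_mem e he x).2⟩
  left_inv x := Hyp.ext (reflVec_reflVec e he x)
  right_inv x := Hyp.ext (reflVec_reflVec e he x)
  isometry_toFun := by
    refine Isometry.of_dist_eq fun x y => ?_
    show Real.arcosh (-lorentz (reflVec e x) (reflVec e y)) = Real.arcosh (-lorentz (x : LSpace n) y)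
    rw [lorentz_reflVec e he]

/-- The linear span of a subset of `ℍⁿ` in `ℝ^{n,1}`. -/
def linSpan {n : ℕ} (S : Set (Hyp n)) : Submodule ℝ (LSpace n) :=
  Submodule.span ℝ ((fun x : Hyp n => (x : LSpace n)) '' S)

/-- The hyperbolic subspace `ℍ_S` of `ℍⁿ` spanned by `S`. -/
def hypSpan {n : ℕ} (S : Set (Hyp n)) : Set (Hyp n) := {x : Hyp n | (x : LSpace n) ∈ linSpan S}

/-- `S` is nonempty and the hyperbolic subspace it spans has dimension `d`. -/
def HasDim {n : ℕ} (S : Set (Hyp n)) (d : ℕ) : Prop :=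
  S.Nonempty ∧ Module.finrank ℝ (linSpan S) = d + 1

/-- `S` is a `d`-dimensional hyperbolic subspace of `ℍⁿ`: a nonempty intersection of `ℍⁿ` with a
linear subspace of dimension `d + 1`. -/
def IsHypSubspace {n : ℕ} (d : ℕ) (S : Set (Hyp n)) : Prop :=
  S.Nonempty ∧ ∃ U : Submodule ℝ (LSpace n),
    Module.finrank ℝ U = d + 1 ∧ S = {x : Hyp n | (x : LSpace n) ∈ U}

/-! ### Polytopes -/

/-- A (bounded, `n`-dimensional) convex polytope in `ℍⁿ`: a bounded intersection of finitely many
closed half-spaces, with nonempty interior. -/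
def IsPolytope {n : ℕ} (P : Set (Hyp n)) : Prop :=
  (∃ N : Finset (LSpace n), (∀ e ∈ N, lorentz e e = 1) ∧ P = {x : Hyp n | ∀ e ∈ N, x ∈ halfSpace e}) ∧
    Bornology.IsBounded P ∧ (interior P).Nonempty

/-- The (nonempty) faces of `P`: `P` itself, and the nonempty intersections of `P` with
supporting hyperplanes. -/
def IsFace {n : ℕ} (P F : Set (Hyp n)) : Prop :=
  F.Nonempty ∧ (F = P ∨ ∃ e : LSpace n, lorentz e e = 1 ∧ P ⊆ halfSpace e ∧ F = P ∩ hyperplane e)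

/-- `e` is the outward unit normal of a facet of `P`, that is, `P ∩ e^⊥` is a face of
codimension one. -/
def IsFacetNormal {n : ℕ} (P : Set (Hyp n)) (e : LSpace n) : Prop :=
  lorentz e e = 1 ∧ P ⊆ halfSpace e ∧ ∃ d, d + 1 = n ∧ HasDim (P ∩ hyperplane e) d

/-- The facets of a polytope `P`, each one given by its outward unit normal (an `n`-dimensional
polytope determines the outward unit normal of each of its facets). -/
def Facet {n : ℕ} (P : Set (Hyp n)) : Type := {e : LSpace n // IsFacetNormal P e}

namespace Facet

variable {n : ℕ} {P : Set (Hyp n)}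

/-- The outward unit normal of a facet. -/
def normal (f : Facet P) : LSpace n := f.1

/-- The facet as a subset of `ℍⁿ`. -/
def toSet (f : Facet P) : Set (Hyp n) := P ∩ hyperplane f.normal

end Facet

/-- A right-angled polytope: all dihedral angles are `π/2`, that is, whenever two distinct facets
meet in a face of codimension two, their normals are orthogonal. -/
def IsRightAngledPolytope {n : ℕ} (P : Set (Hyp n)) : Prop :=
  IsPolytope P ∧ ∀ f g : Facet P, f ≠ g → (∃ d, d + 2 = n ∧ HasDim (f.toSet ∩ g.toSet) d) →
    lorentz f.normal g.normal = 0

/-! ### The reflection group and characteristic functions -/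

/-- The group `W` generated by the reflections across the facets of `P`. -/
noncomputable def reflGroup {n : ℕ} (P : Set (Hyp n)) : Subgroup (Hyp n ≃ᵢ Hyp n) :=
  Subgroup.closure (Set.range fun f : Facet P => reflection f.normal f.2.1)

/-- The reflection `s_f` across the facet `f`, as an element of `W`. -/
noncomputable def facetRefl {n : ℕ} {P : Set (Hyp n)} (f : Facet P) : reflGroup P :=
  ⟨reflection f.normal f.2.1, Subgroup.subset_closure ⟨f, rfl⟩⟩

/-- A characteristic function `W → A`, where `A` is a vector space over `ℤ/2` (an `n`-dimensional
one, as `P` has vertices): an epimorphism such that, whenever `f₁, …, fₙ` are distinct facets that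
all meet at a vertex, the images of their reflections form a basis of `A`. -/
def IsCharacteristic {n : ℕ} {P : Set (Hyp n)} {A : Type*} [AddCommGroup A] [Module (ZMod 2) A]
    (lam : reflGroup P →* Multiplicative A) : Prop :=
  Function.Surjective lam ∧
    ∀ f : Fin n → Facet P, Function.Injective f →
      (∃ v : Hyp n, IsFace P {v} ∧ ∀ i, v ∈ (f i).toSet) →
      LinearIndependent (ZMod 2) (fun i => Multiplicative.toAdd (lam (facetRefl (f i)))) ∧
        Submodule.span (ZMod 2)
          (Set.range fun i => Multiplicative.toAdd (lam (facetRefl (f i)))) = ⊤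

/-- The subspace `V_F = λ(Stab F)`, where `Stab F` is the stabilizer of `F` in `W`. -/
noncomputable def faceSubspace {n : ℕ} {P : Set (Hyp n)} {A : Type*} [AddCommGroup A] [Module (ZMod 2) A]
    (lam : reflGroup P →* Multiplicative A) (F : Set (Hyp n)) : Submodule (ZMod 2) A where
  carrier := {v | ∃ w : reflGroup P, (w : Hyp n ≃ᵢ Hyp n) '' F = F ∧
    Multiplicative.toAdd (lam w) = v}
  zero_mem' := ⟨1, by simp [IsometryEquiv.coe_one], by simp⟩
  add_mem' := by
    rintro _ _ ⟨w, hw, rfl⟩ ⟨w', hw', rfl⟩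
    refine ⟨w * w', ?_, by simp⟩
    rw [Subgroup.coe_mul, IsometryEquiv.coe_mul, Set.image_comp, hw', hw]
  smul_mem' := by
    rintro c _ ⟨w, hw, rfl⟩
    obtain rfl | rfl := (by decide : ∀ c : ZMod 2, c = 0 ∨ c = 1) c
    · exact ⟨1, by simp [IsometryEquiv.coe_one], by simp⟩
    · exact ⟨w, hw, by simp⟩

/-- The group `Γ_λ = ker λ`, as a group of isometries of `ℍⁿ`. -/
noncomputable def deckGroup {n : ℕ} {P : Set (Hyp n)} {A : Type*} [AddCommGroup A]
    (lam : reflGroup P →* Multiplicative A) : Subgroup (Hyp n ≃ᵢ Hyp n) :=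
  lam.ker.map (reflGroup P).subtype

/-! ### Quotients of hyperbolic space -/

/-- The orbit equivalence relation of a group of isometries. -/
def orbitSetoid {n : ℕ} (Γ : Subgroup (Hyp n ≃ᵢ Hyp n)) : Setoid (Hyp n) where
  r x y := ∃ g ∈ Γ, g x = y
  iseqv :=
    { refl := fun _ => ⟨1, Γ.one_mem, rfl⟩
      symm := by
        rintro x _ ⟨g, hg, rfl⟩
        exact ⟨g⁻¹, Γ.inv_mem hg, g.symm_apply_apply x⟩
      trans := by
        rintro x _ _ ⟨g, hg, rfl⟩ ⟨h, hh, rfl⟩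
        exact ⟨h * g, Γ.mul_mem hh hg, rfl⟩ }

/-- The quotient `ℍⁿ/Γ`. -/
def HypQuotient {n : ℕ} (Γ : Subgroup (Hyp n ≃ᵢ Hyp n)) : Type := Quotient (orbitSetoid Γ)

/-- The projection `ℍⁿ → ℍⁿ/Γ`. -/
def proj {n : ℕ} (Γ : Subgroup (Hyp n ≃ᵢ Hyp n)) (x : Hyp n) : HypQuotient Γ :=
  Quotient.mk (orbitSetoid Γ) x

/-- The set of the distances between representatives of `p` and of `q`. -/
def repDists {n : ℕ} {Γ : Subgroup (Hyp n ≃ᵢ Hyp n)} (p q : HypQuotient Γ) : Set ℝ :=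
  {r | ∃ x y : Hyp n, proj Γ x = p ∧ proj Γ y = q ∧ dist x y = r}

lemma repDists_nonempty {n : ℕ} {Γ : Subgroup (Hyp n ≃ᵢ Hyp n)} (p q : HypQuotient Γ) :
    (repDists p q).Nonempty := by
  obtain ⟨x, hx⟩ := Quotient.exists_rep p
  obtain ⟨y, hy⟩ := Quotient.exists_rep q
  exact ⟨dist x y, x, y, hx, hy, rfl⟩

lemma repDists_bddBelow {n : ℕ} {Γ : Subgroup (Hyp n ≃ᵢ Hyp n)} (p q : HypQuotient Γ) :
    BddBelow (repDists p q) := by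
  refine ⟨0, ?_⟩
  rintro _ ⟨x, y, -, -, rfl⟩
  exact dist_nonneg

/-- The quotient metric on `ℍⁿ/Γ`: the infimum of the distances between representatives. If `Γ`
acts freely and properly discontinuously, it is the distance function of the hyperbolic manifold
`ℍⁿ/Γ`, and it induces the quotient topology. -/
noncomputable instance {n : ℕ} (Γ : Subgroup (Hyp n ≃ᵢ Hyp n)) :
    PseudoMetricSpace (HypQuotient Γ) where
  dist p q := sInf (repDists p q)
  dist_self p := by
    obtain ⟨x, hx⟩ := Quotient.exists_rep p
    refine le_antisymm (csInf_le (repDists_bddBelow p p) ⟨x, x, hx, hx, dist_self x⟩)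
      (Real.sInf_nonneg ?_)
    rintro _ ⟨x, y, -, -, rfl⟩
    exact dist_nonneg
  dist_comm p q := by
    show sInf _ = sInf _
    congr 1
    ext r
    exact ⟨fun ⟨x, y, hx, hy, h⟩ => ⟨y, x, hy, hx, by rw [dist_comm, h]⟩,
      fun ⟨x, y, hx, hy, h⟩ => ⟨y, x, hy, hx, by rw [dist_comm, h]⟩⟩
  dist_triangle p q s := by
    show sInf (repDists p s) ≤ sInf (repDists p q) + sInf (repDists q s)
    refine le_of_forall_pos_le_add fun ε hε => ?_
    obtain ⟨_, ⟨x, y, hx, hy, rfl⟩, h1⟩ :=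
      Real.lt_sInf_add_pos (repDists_nonempty p q) (half_pos hε)
    obtain ⟨_, ⟨y', z, hy', hz, rfl⟩, h2⟩ :=
      Real.lt_sInf_add_pos (repDists_nonempty q s) (half_pos hε)
    obtain ⟨g, hg, rfl⟩ : ∃ g ∈ Γ, g y' = y := Quotient.exact (hy'.trans hy.symm)
    have hz' : proj Γ (g z) = s := (Quotient.sound ⟨g, hg, rfl⟩ : proj Γ z = _).symm.trans hz
    have h3 : sInf (repDists p s) ≤ dist x (g z) :=
      csInf_le (repDists_bddBelow p s) ⟨x, g z, hx, hz', rfl⟩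
    have h4 := dist_triangle x (g y') (g z)
    rw [g.dist_eq] at h4
    linarith

/-- The small cover `M_λ = ℍⁿ/Γ_λ` of `P` associated to `λ`. -/
abbrev SmallCover {n : ℕ} {P : Set (Hyp n)} {A : Type*} [AddCommGroup A]
    (lam : reflGroup P →* Multiplicative A) : Type := HypQuotient (deckGroup lam)

/-- The image `M_F` of the hyperbolic subspace `ℍ_F` in the small cover `M_λ`. -/
def faceImage {n : ℕ} {P : Set (Hyp n)} {A : Type*} [AddCommGroup A]
    (lam : reflGroup P →* Multiplicative A) (F : Set (Hyp n)) : Set (SmallCover lam) :=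
  proj (deckGroup lam) '' hypSpan F

/-- `N` is a `k`-dimensional totally geodesic (embedded) submanifold of the hyperbolic
`n`-manifold `M`: around each point of `N`, the pair `(M, N)` is isometric to the pair
`(ℍⁿ, k-dimensional hyperbolic subspace)`. -/
def IsTotallyGeodesicSubmanifold (n k : ℕ) {M : Type*} [PseudoMetricSpace M] (N : Set M) : Prop :=
  ∀ p ∈ N, ∃ ε > 0, ∃ (x : Hyp n) (f : Hyp n → M) (S : Set (Hyp n)),
    IsHypSubspace k S ∧ f x = p ∧ f '' Metric.ball x ε = Metric.ball p ε ∧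
      (∀ y ∈ Metric.ball x ε, ∀ z ∈ Metric.ball x ε, dist (f y) (f z) = dist y z) ∧
      ∀ y ∈ Metric.ball x ε, f y ∈ N ↔ y ∈ S

end SmallCovers

open SmallCovers

namespace SmallCovers

/-! ### The Lorentz form and future vectors -/

section future

variable {n : ℕ}

/-! The geometric core is that the walls of two facets of `P` are orthogonal or disjoint
(`IsRightAngledPolytope.dichotomy`), although the definition only constrains facets that meet in
codimension two. Inside the wall of a facet `s`, the irredundant walls cutting out `s` meet it in
codimension two, so they are orthogonal to `s`, and orthogonal projection to `s` preserves the cone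
over `P`. If two walls were neither orthogonal nor disjoint, alternating projections between them
would converge and carry the facet `t` into `s ∩ t`; then `s ∩ t` spans a subspace of codimension
two, and `s`, `t` are orthogonal after all.

Tits' argument on word length (`side`, `strict`) now makes `P` a strict fundamental domain: if `w p
= q` with `p, q ∈ P`, then `p = q` and `w` is a product of reflections across facets through `p`.
Compactness of `P` and connectedness of `ℍⁿ` show that the translates cover. The facets through a
point of `P` are among those through some vertex, so `λ` is injective on point stabilizers; hence
`Γ_λ` acts freely and discretely, and the projection is isometric on small balls.

For a face `F`, the subspace `ℍ_F` is the intersection of the walls of the facets containing `F`. A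
facet that meets `F` without containing it is orthogonal to all of these, so its reflection
preserves `ℍ_F` and restricts to the reflection across a facet of `F`. The key lemma is
`exists_restriction`: any `w ∈ W` carrying one point of `ℍ_F` into `ℍ_F` restricts to an element of
`W_Q`. Indeed, once lifts of elements of `W_Q` have moved both points into `F`, strictness leaves a
product of reflections across facets through a point of `F`, each of which is trivial on `ℍ_F` or
restricts to a facet reflection of `F`. This gives part 1, and the same argument near a point shows
that other translates of `ℍ_F` stay away, so `M_F` is embedded. Two lifts of `u ∈ W_Q` differ by an
element fixing `F` pointwise, whose value lies in `V_F`, so `λ` descends to `W_Q`. Conversely every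
value in `V_F` is attained by an element trivial on `ℍ_F`, which identifies the kernel of the
descended map with the restrictions of `Γ_λ`. -/

lemma lorentz_neg_left (x y : LSpace n) : lorentz (-x) y = -lorentz x y := by
  simpa using lorentz_smul_left (-1) x y

/-- The Lorentz form as a bilinear form. -/
noncomputable def lorentzForm (n : ℕ) : LSpace n →ₗ[ℝ] LSpace n →ₗ[ℝ] ℝ :=
  LinearMap.mk₂ ℝ lorentz lorentz_add_left lorentz_smul_left lorentz_add_right lorentz_smul_right

@[simp] lemma lorentzForm_apply (x y : LSpace n) : lorentzForm n x y = lorentz x y := rfl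

lemma lorentz_zero_left (y : LSpace n) : lorentz 0 y = 0 := by
  simpa using lorentz_smul_left 0 0 y

lemma lorentz_zero_right (y : LSpace n) : lorentz y 0 = 0 := by
  rw [lorentz_comm, lorentz_zero_left]

lemma lorentz_sum_left {ι : Type*} (s : Finset ι) (f : ι → LSpace n) (y : LSpace n) :
    lorentz (∑ i ∈ s, f i) y = ∑ i ∈ s, lorentz (f i) y := by
  exact map_sum ((lorentzForm n).flip y) f s

lemma lorentz_sum_right {ι : Type*} (s : Finset ι) (f : ι → LSpace n) (y : LSpace n) :
    lorentz y (∑ i ∈ s, f i) = ∑ i ∈ s, lorentz y (f i) := by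
  rw [lorentz_comm, lorentz_sum_left]
  exact Finset.sum_congr rfl fun i _ => lorentz_comm _ _

lemma continuous_lorentz : Continuous fun p : LSpace n × LSpace n => lorentz p.1 p.2 := by
  unfold lorentz; fun_prop

/-- The vectors orthogonal to all the vectors of a family. -/
def orthSpace {ι : Type*} (a : ι → LSpace n) : Submodule ℝ (LSpace n) where
  carrier := {v | ∀ i, lorentz v (a i) = 0}
  zero_mem' i := lorentz_zero_left _
  add_mem' hv hw i := by rw [lorentz_add_left, hv i, hw i, add_zero]
  smul_mem' c v hv i := by rw [lorentz_smul_left, hv i, mul_zero]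

lemma mem_orthSpace {ι : Type*} {a : ι → LSpace n} {v : LSpace n} :
    v ∈ orthSpace a ↔ ∀ i, lorentz v (a i) = 0 := Iff.rfl

lemma finrank_lspace (n : ℕ) : Module.finrank ℝ (LSpace n) = n + 1 := by
  simp [LSpace, Module.finrank_prod]

/-- The dimension of the orthogonal space of a family with surjective evaluation map. -/
lemma finrank_orthSpace {ι : Type*} [Fintype ι] (a : ι → LSpace n)
    (h : ∀ b : ι → ℝ, ∃ v, ∀ i, lorentz v (a i) = b i) :
    Module.finrank ℝ (orthSpace a) + Fintype.card ι = n + 1 := by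
  let f : LSpace n →ₗ[ℝ] (ι → ℝ) := LinearMap.pi fun i => (lorentzForm n).flip (a i)
  have hk : orthSpace a = LinearMap.ker f := by
    ext v
    simp [f, mem_orthSpace, funext_iff]
  have hr : LinearMap.range f = ⊤ := by
    rw [LinearMap.range_eq_top]
    intro b
    obtain ⟨v, hv⟩ := h b
    exact ⟨v, funext hv⟩
  have := LinearMap.finrank_range_add_finrank_ker f
  rw [hr, ← hk, finrank_top, Module.finrank_fintype_fun_eq_card, finrank_lspace] at this
  omega

lemma finrank_orthSpace_of_orthonormal {ι : Type*} [Fintype ι] (a : ι → LSpace n)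
    (h1 : ∀ i, lorentz (a i) (a i) = 1) (h0 : ∀ i j, i ≠ j → lorentz (a i) (a j) = 0) :
    Module.finrank ℝ (orthSpace a) + Fintype.card ι = n + 1 := by
  classical
  refine finrank_orthSpace a fun b => ⟨∑ i, b i • a i, fun j => ?_⟩
  rw [lorentz_sum_left, Finset.sum_eq_single j]
  · rw [lorentz_smul_left, h1, mul_one]
  · intro i _ hij
    rw [lorentz_smul_left, h0 i j hij, mul_zero]
  · simp

/-- A vector in the interior of the future light cone. -/
def IsFuture (v : LSpace n) : Prop := lorentz v v < 0 ∧ 0 < v.2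

lemma IsFuture.exists_smul {v : LSpace n} (h : IsFuture v) :
    ∃ c : ℝ, 0 < c ∧ ∃ x : Hyp n, c • x.val = v := by
  obtain ⟨h1, h2⟩ := h
  have hs : 0 < √(-lorentz v v) := Real.sqrt_pos.2 (by linarith)
  refine ⟨√(-lorentz v v), hs, ⟨(√(-lorentz v v))⁻¹ • v, ?_, ?_⟩, ?_⟩
  · rw [lorentz_smul_left, lorentz_smul_right, ← mul_assoc, ← mul_inv,
      Real.mul_self_sqrt (by linarith), inv_neg, neg_mul, inv_mul_cancel₀ h1.ne]
  · simp only [Prod.smul_snd, smul_eq_mul]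
    positivity
  · simp only
    rw [smul_smul, mul_inv_cancel₀ hs.ne', one_smul]

/-- Reverse Cauchy–Schwarz: a timelike vector in the past half of the light cone has nonnegative
product with every point of the upper sheet. -/
lemma isFuture_of_lorentz_neg (x : Hyp n) {v : LSpace n} (hv : lorentz v v < 0)
    (h : lorentz v x.val < 0) : IsFuture v := by
  refine ⟨hv, ?_⟩
  by_contra hneg
  push Not at hneg
  have h3 := x.norm_lt
  have h4 : ‖v.1‖ ≤ -v.2 := by
    unfold lorentz at hv
    rw [real_inner_self_eq_norm_sq] at hv
    exact le_of_sq_le_sq (by nlinarith) (by linarith)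
  have h5 := neg_le_of_abs_le (abs_real_inner_le_norm v.1 x.val.1)
  have h6 := mul_le_mul h4 h3.le (norm_nonneg _) (by linarith)
  unfold lorentz at h
  linarith

lemma Hyp.isFuture (x : Hyp n) : IsFuture x.val := ⟨by rw [x.lorentz_self]; norm_num, x.time_pos⟩

lemma lorentz_le_neg_one (x y : Hyp n) : lorentz x.val y.val ≤ -1 := by
  linarith [one_le_neg_lorentz x y]

/-- The future cone is convex. The positive factor `c` does not affect signs of products with
normals, so vectors of the form `c • z` serve below as points of segments. -/
lemma exists_smul_eq_add (x y : Hyp n) {a b : ℝ} (ha : 0 ≤ a) (hb : 0 ≤ b) (hab : 0 < a + b) :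
    ∃ c : ℝ, 0 < c ∧ ∃ z : Hyp n, c • z.val = a • x.val + b • y.val := by
  have h := lorentz_le_neg_one x y
  refine (isFuture_of_lorentz_neg x ?_ ?_).exists_smul
  · simp only [lorentz_add_left, lorentz_add_right, lorentz_smul_left, lorentz_smul_right,
      x.lorentz_self, y.lorentz_self, lorentz_comm y.val x.val]
    nlinarith [mul_nonneg ha hb, mul_pos hab hab]
  · simp only [lorentz_add_left, lorentz_smul_left, x.lorentz_self, lorentz_comm y.val x.val]
    nlinarith

lemma Hyp.eq_of_smul_eq {x y : Hyp n} {c : ℝ} (h : c • x.val = y.val) : x = y := by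
  have h1 := y.lorentz_self
  have h2 : 0 < y.val.2 := y.time_pos
  rw [← h] at h1 h2
  rw [lorentz_smul_left, lorentz_smul_right, x.lorentz_self] at h1
  simp only [Prod.smul_snd, smul_eq_mul] at h2
  have hc : 0 < c := pos_of_mul_pos_left h2 x.time_pos.le
  have : c = 1 := by nlinarith
  rw [this, one_smul] at h
  exact Hyp.ext h

/-- Points on the segment from `x` to `y` cross the hyperplane `a^⊥`. -/
lemma exists_crossing (x y : Hyp n) (a : LSpace n) (hx : lorentz x.val a < 0)
    (hy : 0 < lorentz y.val a) :
    ∃ c : ℝ, 0 < c ∧ ∃ z : Hyp n,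
      c • z.val = lorentz y.val a • x.val + (-lorentz x.val a) • y.val ∧ lorentz z.val a = 0 := by
  obtain ⟨c, hc, z, hz⟩ := exists_smul_eq_add x y hy.le (neg_pos.2 hx).le (by linarith)
  refine ⟨c, hc, z, hz, ?_⟩
  have h : c * lorentz z.val a = 0 := by
    rw [← lorentz_smul_left, hz, lorentz_add_left, lorentz_smul_left, lorentz_smul_left]
    ring
  exact (mul_eq_zero.1 h).resolve_left hc.ne'

/-- A causal vector which is orthogonal to a point of `ℍⁿ` vanishes. -/
lemma eq_zero_of_causal {v : LSpace n} (hv : lorentz v v ≤ 0) (x : Hyp n)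
    (h : lorentz x.val v = 0) : v = 0 := by
  rw [lorentz_comm] at h
  exact eq_zero_of_orthogonal x v h (le_antisymm hv (lorentz_nonneg_of_orthogonal x v h))

/-- A causal vector has the same sign on all of `ℍⁿ`. -/
lemma lorentz_neg_of_causal {v : LSpace n} (hv : lorentz v v ≤ 0) (x y : Hyp n)
    (hx : lorentz x.val v < 0) : lorentz y.val v < 0 := by
  by_contra hy
  push Not at hy
  have key : ∃ z : Hyp n, lorentz z.val v = 0 := by
    rcases hy.eq_or_lt with h | h
    · exact ⟨y, h.symm⟩
    · obtain ⟨-, -, z, -, hz⟩ := exists_crossing x y v hx h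
      exact ⟨z, hz⟩
  obtain ⟨z, hz⟩ := key
  rw [eq_zero_of_causal hv z hz, lorentz_zero_right] at hx
  exact lt_irrefl _ hx

open Filter Topology in
/-- Moving a little in the direction of `v` preserves strict inequalities. -/
lemma exists_hyp_near {ι : Type*} (z : Hyp n) (v : LSpace n) (N : Finset ι) (a : ι → LSpace n)
    (h : ∀ i ∈ N, lorentz z.val (a i) < 0) :
    ∃ ε : ℝ, 0 < ε ∧ ∃ c : ℝ, 0 < c ∧ ∃ x : Hyp n, c • x.val = z.val + ε • v ∧
      ∀ i ∈ N, lorentz x.val (a i) < 0 := by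
  have hc : ∀ w : LSpace n, Continuous fun ε : ℝ => lorentz (z.val + ε • v) w := fun w =>
    continuous_lorentz.comp (by fun_prop : Continuous fun ε : ℝ => (z.val + ε • v, w))
  have hc' : Continuous fun ε : ℝ => lorentz (z.val + ε • v) (z.val + ε • v) :=
    continuous_lorentz.comp
      (by fun_prop : Continuous fun ε : ℝ => (z.val + ε • v, z.val + ε • v))
  have h1 : ∀ᶠ ε in 𝓝 (0 : ℝ), lorentz (z.val + ε • v) (z.val + ε • v) < 0 :=
    hc'.continuousAt.eventually_lt continuousAt_const (by simp [z.lorentz_self])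
  have h2 : ∀ᶠ ε in 𝓝 (0 : ℝ), lorentz (z.val + ε • v) z.val < 0 :=
    (hc _).continuousAt.eventually_lt continuousAt_const (by simp [z.lorentz_self])
  have h3 : ∀ᶠ ε in 𝓝 (0 : ℝ), ∀ i ∈ N, lorentz (z.val + ε • v) (a i) < 0 := by
    rw [Filter.eventually_all_finset]
    intro i hi
    exact (hc _).continuousAt.eventually_lt continuousAt_const (by simpa using h i hi)
  obtain ⟨ε, ⟨⟨h1, h2⟩, h3⟩, hε⟩ := ((((h1.and h2).and h3).filter_mono
    (nhdsWithin_le_nhds (s := Set.Ioi 0))).and self_mem_nhdsWithin).exists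
  obtain ⟨c, hc, x, hx⟩ := (isFuture_of_lorentz_neg z h1 h2).exists_smul
  refine ⟨ε, hε, c, hc, x, hx, fun i hi => ?_⟩
  have := h3 i hi
  rw [← hx, lorentz_smul_left] at this
  exact neg_of_mul_neg_right this hc.le

end future

/-! ### The topology of hyperbolic space -/

section topology

variable {n : ℕ}

lemma Hyp.dist_eq (x y : Hyp n) : dist x y = Real.arcosh (-lorentz x.val y.val) := rfl

lemma Hyp.cosh_dist (x y : Hyp n) : Real.cosh (dist x y) = -lorentz x.val y.val := by
  rw [Hyp.dist_eq, Real.cosh_arcosh (one_le_neg_lorentz x y)]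

/-- On the orthogonal space of `x` the Euclidean norm is controlled by the Lorentz form. -/
lemma norm_le_of_orthogonal (x : Hyp n) (w : LSpace n) (h : lorentz w x.val = 0) {r : ℝ}
    (hr : 0 ≤ r) (hw : lorentz w w ≤ r ^ 2) : ‖w‖ ≤ x.val.2 * r := by
  have hx := x.sq_eq
  have h0 := x.time_pos
  have h2 := abs_real_inner_le_norm w.1 x.val.1
  unfold lorentz at h hw
  rw [real_inner_self_eq_norm_sq] at hw
  have h3 : inner ℝ w.1 x.val.1 = w.2 * x.val.2 := by linarith
  rw [h3] at h2
  have h4 : (w.2 * x.val.2) ^ 2 ≤ (‖w.1‖ * ‖x.val.1‖) ^ 2 := by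
    rw [← sq_abs]
    exact pow_le_pow_left₀ (abs_nonneg _) h2 2
  -- Cauchy–Schwarz in `h4` with `‖x.1‖² = x.2² - 1` gives `‖w.1‖² ≤ x.2² (‖w.1‖² - w.2²)`, and the
  -- bracket is the Lorentz square of `w`.
  have h5 : ‖w.1‖ ^ 2 ≤ (x.val.2 * r) ^ 2 := by
    nlinarith [mul_le_mul_of_nonneg_left hw (sq_nonneg x.val.2)]
  have h6 : ‖w.1‖ ≤ x.val.2 * r := le_of_sq_le_sq h5 (by positivity)
  have h7 : |w.2| ^ 2 ≤ ‖w.1‖ ^ 2 := by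
    rw [sq_abs]
    by_contra hlt
    push Not at hlt
    nlinarith [sq_nonneg ‖x.val.1‖, mul_le_mul_of_nonneg_right hlt.le (sq_nonneg ‖x.val.1‖)]
  have h8 : |w.2| ≤ ‖w.1‖ := le_of_sq_le_sq h7 (norm_nonneg _)
  exact max_le h6 (by simpa using h8.trans h6)

/-- The Euclidean distance is controlled by the hyperbolic distance. -/
lemma norm_sub_le (x y : Hyp n) :
    ‖y.val - x.val‖ ≤ (Real.cosh (dist x y) - 1) * ‖x.val‖ + x.val.2 * Real.sinh (dist x y) := by
  have hC := Hyp.cosh_dist x y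
  set C := Real.cosh (dist x y)
  have h1 : 1 ≤ C := Real.one_le_cosh _
  have hs : Real.sinh (dist x y) ^ 2 = C ^ 2 - 1 := by
    have := Real.cosh_sq (dist x y); linarith
  have hl : lorentz y.val x.val = -C := by rw [lorentz_comm]; linarith
  -- `y - C x` is the component of `y` orthogonal to `x`; its Lorentz square is `C² - 1 = sinh²`.
  have h2 := norm_le_of_orthogonal x (y.val - C • x.val)
    (by rw [lorentz_sub_left, lorentz_smul_left, x.lorentz_self, hl]; ring)
    (Real.sinh_nonneg_iff.2 dist_nonneg)
    (by simp only [lorentz_sub_left, lorentz_sub_right, lorentz_smul_left, lorentz_smul_right,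
          x.lorentz_self, y.lorentz_self, lorentz_comm x.val y.val, hl]
        nlinarith)
  calc ‖y.val - x.val‖ = ‖(C - 1) • x.val + (y.val - C • x.val)‖ := by congr 1; module
    _ ≤ ‖(C - 1) • x.val‖ + ‖y.val - C • x.val‖ := norm_add_le _ _
    _ ≤ _ := by
      rw [norm_smul, Real.norm_of_nonneg (by linarith)]
      linarith

open Filter Topology

lemma continuous_val : Continuous (Hyp.val : Hyp n → LSpace n) := by
  rw [continuous_iff_continuousAt]
  intro x
  rw [ContinuousAt, tendsto_iff_norm_sub_tendsto_zero]
  have h : Tendsto (fun y : Hyp n => (Real.cosh (dist x y) - 1) * ‖x.val‖ +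
      x.val.2 * Real.sinh (dist x y)) (𝓝 x) (𝓝 0) := by
    have : Continuous fun y : Hyp n => (Real.cosh (dist x y) - 1) * ‖x.val‖ +
      x.val.2 * Real.sinh (dist x y) := by
      have hc := Real.continuous_cosh
      have hs := Real.continuous_sinh
      fun_prop
    simpa using this.tendsto x
  exact squeeze_zero (fun _ => norm_nonneg _) (norm_sub_le x) h

lemma continuous_lorentz_right (a : LSpace n) : Continuous fun x : Hyp n => lorentz x.val a :=
  continuous_lorentz.comp (continuous_val.prodMk continuous_const)

/-- For the converse of continuity: the distance to `x` is `arcosh` of a Euclidean-continuous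
function with values in `[1, ∞)`, and `arcosh` is continuous at `1` within that interval. -/
lemma isInducing_val : IsInducing (Hyp.val : Hyp n → LSpace n) := by
  rw [isInducing_iff_nhds]
  intro x
  refine le_antisymm (continuous_val.tendsto x).le_comap ?_
  rw [← tendsto_id']
  rw [tendsto_iff_dist_tendsto_zero]
  have h1 : Tendsto (fun y : Hyp n => -lorentz y.val x.val) (comap Hyp.val (𝓝 x.val)) (𝓝 1) := by
    have : Continuous fun v : LSpace n => -lorentz v x.val :=
      (continuous_lorentz.comp (by fun_prop : Continuous fun v : LSpace n => (v, x.val))).neg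
    have h := (this.tendsto x.val).comp tendsto_comap (f := Hyp.val)
    simpa [x.lorentz_self, Function.comp_def] using h
  have h2 : Tendsto Real.arcosh (𝓝[Set.Ici 1] 1) (𝓝 0) := by
    have := Real.continuousOn_arcosh 1 (by simp)
    simpa [ContinuousWithinAt] using this
  exact h2.comp (tendsto_nhdsWithin_iff.2
    ⟨h1, Eventually.of_forall fun y => one_le_neg_lorentz y x⟩)

lemma isClosedEmbedding_val : IsClosedEmbedding (Hyp.val : Hyp n → LSpace n) := by
  refine ⟨⟨isInducing_val, fun x y h => Hyp.ext h⟩, ?_⟩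
  have h : Set.range (Hyp.val : Hyp n → LSpace n) = {v | lorentz v v = -1} ∩ {v | 0 ≤ v.2} := by
    ext v
    constructor
    · rintro ⟨x, rfl⟩
      exact ⟨x.lorentz_self, x.time_pos.le⟩
    · rintro ⟨h1, h2⟩
      -- The closed condition on time suffices: at time zero the form would be nonnegative.
      refine ⟨⟨v, h1, lt_of_le_of_ne h2 fun h0 => ?_⟩, rfl⟩
      have h1' : lorentz v v = -1 := h1
      unfold lorentz at h1'
      rw [real_inner_self_eq_norm_sq, ← h0] at h1'
      nlinarith [sq_nonneg ‖v.1‖]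
  rw [h]
  refine IsClosed.inter (isClosed_eq ?_ continuous_const) (isClosed_le continuous_const
    continuous_snd)
  exact continuous_lorentz.comp (by fun_prop : Continuous fun v : LSpace n => (v, v))

lemma isBounded_image_val {S : Set (Hyp n)} (hS : Bornology.IsBounded S) :
    Bornology.IsBounded (Hyp.val '' S) := by
  rcases S.eq_empty_or_nonempty with rfl | ⟨x, hx⟩
  · simp
  obtain ⟨r, hr⟩ := hS.subset_closedBall x
  refine (Metric.isBounded_closedBall (x := x.val)
    (r := (Real.cosh r - 1) * ‖x.val‖ + x.val.2 * Real.sinh r)).subset ?_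
  rintro _ ⟨y, hy, rfl⟩
  have hd : dist x y ≤ r := by rw [dist_comm]; exact hr hy
  have hc : Real.cosh (dist x y) ≤ Real.cosh r := by
    rw [Real.cosh_le_cosh, abs_of_nonneg dist_nonneg]
    exact hd.trans (le_abs_self _)
  have hs : Real.sinh (dist x y) ≤ Real.sinh r := Real.sinh_le_sinh.2 hd
  rw [Metric.mem_closedBall, dist_eq_norm]
  refine (norm_sub_le x y).trans (add_le_add ?_ ?_)
  · exact mul_le_mul_of_nonneg_right (by linarith) (norm_nonneg _)
  · exact mul_le_mul_of_nonneg_left hs x.time_pos.le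

/-- Closed bounded subsets of `ℍⁿ` are compact. -/
lemma isCompact_of_isClosed_isBounded {S : Set (Hyp n)} (hc : IsClosed S)
    (hb : Bornology.IsBounded S) : IsCompact S := by
  rw [isClosedEmbedding_val.isEmbedding.isCompact_iff]
  exact Metric.isCompact_of_isClosed_isBounded (isClosedEmbedding_val.isClosedMap S hc)
    (isBounded_image_val hb)

/-- The hyperboloid sheet is a graph over `ℝⁿ`. Connectedness is what turns the clopen union of the
translates of `P` into all of `ℍⁿ`. -/
instance : PreconnectedSpace (Hyp n) := by
  have hmem : ∀ u : EuclideanSpace ℝ (Fin n), lorentz (u, √(1 + ‖u‖ ^ 2)) (u, √(1 + ‖u‖ ^ 2)) = -1 ∧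
      0 < √(1 + ‖u‖ ^ 2) := by
    intro u
    have : 0 < 1 + ‖u‖ ^ 2 := by positivity
    refine ⟨?_, Real.sqrt_pos.2 this⟩
    unfold lorentz
    simp only
    rw [real_inner_self_eq_norm_sq, Real.mul_self_sqrt this.le]
    ring
  let f : EuclideanSpace ℝ (Fin n) → Hyp n := fun u => ⟨(u, √(1 + ‖u‖ ^ 2)), (hmem u).1, (hmem u).2⟩
  have hf : Continuous f := by
    rw [isInducing_val.continuous_iff]
    change Continuous fun u : EuclideanSpace ℝ (Fin n) => (u, √(1 + ‖u‖ ^ 2))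
    fun_prop
  have hs : Function.Surjective f := by
    intro x
    refine ⟨x.val.1, Hyp.ext (Prod.ext rfl ?_)⟩
    change √(1 + ‖x.val.1‖ ^ 2) = x.val.2
    rw [← x.sq_eq, Real.sqrt_sq x.time_pos.le]
  exact hs.denseRange.preconnectedSpace hf

/-- The geodesic through `x` in the direction of the unit tangent vector `u`. -/
noncomputable def geodesic (x : Hyp n) (u : LSpace n) (hu : lorentz u u = 1)
    (hx : lorentz x.val u = 0) (t : ℝ) : Hyp n where
  val := Real.cosh t • x.val + Real.sinh t • u
  lorentz_self := by
    simp only [lorentz_add_left, lorentz_add_right, lorentz_smul_left, lorentz_smul_right,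
      x.lorentz_self, hu, lorentz_comm u x.val, hx]
    nlinarith [Real.cosh_sq t]
  time_pos := by
    refine (isFuture_of_lorentz_neg x ?_ ?_).2
    · simp only [lorentz_add_left, lorentz_add_right, lorentz_smul_left, lorentz_smul_right,
        x.lorentz_self, hu, lorentz_comm u x.val, hx]
      nlinarith [Real.cosh_sq t]
    · simp only [lorentz_add_left, lorentz_smul_left, x.lorentz_self, lorentz_comm u x.val, hx]
      linarith [Real.cosh_pos t]

lemma dist_geodesic (x : Hyp n) (u : LSpace n) (hu : lorentz u u = 1)
    (hx : lorentz x.val u = 0) (t : ℝ) : dist x (geodesic x u hu hx t) = |t| := by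
  have h : Real.cosh (dist x (geodesic x u hu hx t)) = Real.cosh |t| := by
    rw [Hyp.cosh_dist, Real.cosh_abs]
    change -lorentz x.val (Real.cosh t • x.val + Real.sinh t • u) = _
    rw [lorentz_add_right, lorentz_smul_right, lorentz_smul_right, x.lorentz_self, hx]
    ring
  exact Real.cosh_strictMonoOn.injOn dist_nonneg (abs_nonneg t) h

end topology

/-! ### Facets of polytopes -/

section polytopes

variable {n : ℕ}

/-- Ensures that the natural-number subtractions `n - 1` and `n - 2` below are not truncated. -/
lemma finrank_ne_zero_of_mem {U : Submodule ℝ (LSpace n)} (x : Hyp n) (hx : x.val ∈ U) :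
    Module.finrank ℝ U ≠ 0 := by
  intro h
  rw [Submodule.finrank_eq_zero] at h
  rw [h, Submodule.mem_bot] at hx
  have := x.lorentz_self
  rw [hx, lorentz_zero_left] at this
  norm_num at this

lemma mem_linSpan {S : Set (Hyp n)} {x : Hyp n} (hx : x ∈ S) : x.val ∈ linSpan S :=
  Submodule.subset_span ⟨x, hx, rfl⟩

lemma linSpan_le {S : Set (Hyp n)} {U : Submodule ℝ (LSpace n)} (h : ∀ x ∈ S, x.val ∈ U) :
    linSpan S ≤ U := by
  refine Submodule.span_le.2 ?_
  rintro _ ⟨x, hx, rfl⟩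
  exact h x hx

/-- A set containing all points of a subspace which are near a given one spans the subspace. -/
lemma le_linSpan {ι : Type*} {U : Submodule ℝ (LSpace n)} (z : Hyp n) (hz : z.val ∈ U)
    (N : Finset ι) (a : ι → LSpace n) (h : ∀ i ∈ N, lorentz z.val (a i) < 0) {F : Set (Hyp n)}
    (hF : ∀ x : Hyp n, x.val ∈ U → (∀ i ∈ N, lorentz x.val (a i) < 0) → x ∈ F) :
    U ≤ linSpan F := by
  intro v hv
  obtain ⟨ε, hε, c, hc, x, hx, hxa⟩ := exists_hyp_near z v N a h
  have hxU : x.val ∈ U := by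
    have : c • x.val ∈ U := by
      rw [hx]
      exact U.add_mem hz (U.smul_mem _ hv)
    exact (U.smul_mem_iff hc.ne').1 this
  have h1 : ε • v ∈ linSpan F := by
    have : ε • v = c • x.val - z.val := by rw [hx]; abel
    rw [this]
    exact Submodule.sub_mem _ (Submodule.smul_mem _ _ (mem_linSpan (hF x hxU hxa)))
      (mem_linSpan (hF z hz h))
  exact ((linSpan F).smul_mem_iff hε.ne').1 h1

/-- An irredundant subfamily of a finite family of linear inequalities on `ℍⁿ ∩ U`. -/
lemma exists_irredundant {ι : Type*} (U : Submodule ℝ (LSpace n)) (N : Finset ι)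
    (a : ι → LSpace n) (o : Hyp n) (hoU : o.val ∈ U) (ho : ∀ i ∈ N, lorentz o.val (a i) < 0) :
    ∃ N' ⊆ N, (∀ x : Hyp n, x.val ∈ U → (∀ i ∈ N', lorentz x.val (a i) ≤ 0) →
      ∀ i ∈ N, lorentz x.val (a i) ≤ 0) ∧
      ∀ i ∈ N', ∃ z : Hyp n, z.val ∈ U ∧ lorentz z.val (a i) = 0 ∧
        ∀ j ∈ N', j ≠ i → lorentz z.val (a j) < 0 := by
  classical
  obtain ⟨N', hN', hmin⟩ := exists_minimal_le_of_wellFoundedLT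
    (fun N' : Finset ι => ∀ x : Hyp n, x.val ∈ U → (∀ i ∈ N', lorentz x.val (a i) ≤ 0) →
      ∀ i ∈ N, lorentz x.val (a i) ≤ 0) N (fun _ _ h => h)
  refine ⟨N', hN', hmin.1, fun i hi => ?_⟩
  have hnot : ¬ ∀ x : Hyp n, x.val ∈ U → (∀ j ∈ N'.erase i, lorentz x.val (a j) ≤ 0) →
      ∀ j ∈ N, lorentz x.val (a j) ≤ 0 := by
    intro h
    exact Finset.notMem_erase i N' (hmin.2 h (Finset.erase_subset _ _) hi)
  push Not at hnot
  obtain ⟨y, hyU, hy, j, hj, hyj⟩ := hnot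
  have hyi : 0 < lorentz y.val (a i) := by
    by_contra hle
    push Not at hle
    refine absurd (hmin.1 y hyU (fun l hl => ?_) j hj) (not_le.2 hyj)
    by_cases hli : l = i
    · rwa [hli]
    · exact hy l (Finset.mem_erase.2 ⟨hli, hl⟩)
  -- By minimality, dropping `i` admits a point `y` beyond the wall of `i`. The segment from `o` to
  -- `y` meets this wall at `z`, where the other inequalities are still strict because they are
  -- strict at `o`.
  obtain ⟨c, hc, z, hz, hzi⟩ := exists_crossing o y (a i) (ho i (hN' hi)) hyi
  refine ⟨z, (U.smul_mem_iff hc.ne').1 ?_, hzi, fun l hl hli => ?_⟩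
  · rw [hz]
    exact U.add_mem (U.smul_mem _ hoU) (U.smul_mem _ hyU)
  · have h1 : c * lorentz z.val (a l) < 0 := by
      rw [← lorentz_smul_left, hz, lorentz_add_left, lorentz_smul_left, lorentz_smul_left]
      have h2 := mul_neg_of_pos_of_neg hyi (ho l (hN' hl))
      have h3 := mul_nonpos_of_nonneg_of_nonpos (neg_pos.2 (ho i (hN' hi))).le
        (hy l (Finset.mem_erase.2 ⟨hli, hl⟩))
      linarith
    exact neg_of_mul_neg_right h1 hc.le

/-- A relative interior point of a convex set with respect to finitely many inequalities. -/
lemma exists_relInt {ι : Type*} (N : Finset ι) (a : ι → LSpace n) {F : Set (Hyp n)}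
    (hne : F.Nonempty)
    (hconv : ∀ x ∈ F, ∀ y ∈ F, ∀ z : Hyp n, ∀ c : ℝ, 0 < c → c • z.val = x.val + y.val → z ∈ F)
    (hle : ∀ x ∈ F, ∀ i ∈ N, lorentz x.val (a i) ≤ 0)
    (hlt : ∀ i ∈ N, ∃ x ∈ F, lorentz x.val (a i) < 0) :
    ∃ p ∈ F, ∀ i ∈ N, lorentz p.val (a i) < 0 := by
  classical
  induction N using Finset.induction_on with
  | empty => exact hne.imp fun p hp => ⟨hp, by simp⟩
  | insert i N hi ih =>
    obtain ⟨p, hp, hpN⟩ := ih (fun x hx j hj => hle x hx j (Finset.mem_insert_of_mem hj))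
      (fun j hj => hlt j (Finset.mem_insert_of_mem hj))
    obtain ⟨q, hq, hqi⟩ := hlt i (Finset.mem_insert_self _ _)
    obtain ⟨c, hc, z, hz⟩ := exists_smul_eq_add p q zero_le_one zero_le_one (by norm_num)
    rw [one_smul, one_smul] at hz
    refine ⟨z, hconv p hp q hq z c hc hz, fun j hj => ?_⟩
    have h1 : c * lorentz z.val (a j) < 0 := by
      rw [← lorentz_smul_left, hz, lorentz_add_left]
      have h2 := hle p hp j hj
      have h3 := hle q hq j hj
      rcases Finset.mem_insert.1 hj with rfl | hj
      · linarith
      · linarith [hpN j hj]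
    exact neg_of_mul_neg_right h1 hc.le

lemma finrank_orthSpace_unit (e : LSpace n) (he : lorentz e e = 1) :
    Module.finrank ℝ (orthSpace fun _ : Unit => e) = n := by
  have := finrank_orthSpace_of_orthonormal (fun _ : Unit => e) (fun _ => he)
    (fun i j h => absurd rfl h)
  simpa using this

lemma linSpan_facet {P : Set (Hyp n)} {e : LSpace n} (h : IsFacetNormal P e) :
    linSpan (P ∩ hyperplane e) = orthSpace fun _ : Unit => e := by
  obtain ⟨he, -, d, hd, -, hdim⟩ := h
  refine Submodule.eq_of_le_of_finrank_eq (linSpan_le fun x hx _ => hx.2) ?_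
  rw [hdim, hd, finrank_orthSpace_unit e he]

/-- One point of the wall at which the other inequalities are strict is enough: all nearby points of
the wall then lie in `P`, and they span the wall. -/
lemma isFacetNormal_of_mem {P : Set (Hyp n)} {e : LSpace n} (he : lorentz e e = 1)
    (hP : P ⊆ halfSpace e) {ι : Type*} (N : Finset ι) (a : ι → LSpace n) (z : Hyp n)
    (hz : lorentz z.val e = 0) (hza : ∀ i ∈ N, lorentz z.val (a i) < 0)
    (hN : ∀ x : Hyp n, lorentz x.val e = 0 → (∀ i ∈ N, lorentz x.val (a i) < 0) → x ∈ P) :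
    IsFacetNormal P e := by
  have hspan : linSpan (P ∩ hyperplane e) = orthSpace fun _ : Unit => e :=
    le_antisymm (linSpan_le fun x hx _ => hx.2)
      (le_linSpan z (mem_orthSpace.2 fun _ => hz) N a hza fun x hx h => ⟨hN x (hx ()) h, hx ()⟩)
  have hzm : z.val ∈ orthSpace fun _ : Unit => e := fun _ => hz
  have hr := finrank_orthSpace_unit e he
  have h0 := finrank_ne_zero_of_mem z hzm
  refine ⟨he, hP, n - 1, by omega, ⟨z, hN z hz hza, hz⟩, ?_⟩
  rw [hspan, hr]
  omega

/-- Any facet normal occurs in any description by half-spaces. -/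
lemma IsFacetNormal.mem_of_eq {P : Set (Hyp n)} {e : LSpace n} (h : IsFacetNormal P e)
    {ι : Type*} (N : Finset ι) (a : ι → LSpace n) (ha : ∀ i ∈ N, lorentz (a i) (a i) = 1)
    (hP : ∀ x : Hyp n, x ∈ P ↔ ∀ i ∈ N, lorentz x.val (a i) ≤ 0) (o : Hyp n)
    (ho : ∀ i ∈ N, lorentz o.val (a i) < 0) : ∃ i ∈ N, e = a i := by
  have hspan := linSpan_facet h
  obtain ⟨he, hPe, d, hd, ⟨x₀, hx₀⟩, -⟩ := h
  -- Some inequality must be an equality on the whole facet: otherwise a relative interior point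
  -- satisfies all of them strictly, and a small move along `e` stays in `P` but leaves the
  -- half-space of `e`.
  have key : ∃ i ∈ N, ∀ x ∈ P ∩ hyperplane e, lorentz x.val (a i) = 0 := by
    by_contra hno
    push Not at hno
    obtain ⟨p, hp, hpa⟩ := exists_relInt N a ⟨x₀, hx₀⟩ (fun x hx y hy z c hc hz => by
        have hl : ∀ b, c * lorentz z.val b = lorentz x.val b + lorentz y.val b := fun b => by
          rw [← lorentz_smul_left, hz, lorentz_add_left]
        refine ⟨(hP z).2 fun i hi => ?_, ?_⟩
        · have h1 := hl (a i)
          have h2 := (hP x).1 hx.1 i hi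
          have h3 := (hP y).1 hy.1 i hi
          by_contra hcon
          push Not at hcon
          nlinarith [mul_pos hc hcon]
        · have h1 := hl e
          have h2 : lorentz x.val e = 0 := hx.2
          have h3 : lorentz y.val e = 0 := hy.2
          rw [h2, h3, add_zero] at h1
          exact (mul_eq_zero.1 h1).resolve_left hc.ne')
      (fun x hx => (hP x).1 hx.1)
      (fun i hi => (hno i hi).imp fun x hx => ⟨hx.1, lt_of_le_of_ne ((hP x).1 hx.1.1 i hi) hx.2⟩)
    obtain ⟨ε, hε, c, hc, x, hx, hxa⟩ := exists_hyp_near p e N a hpa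
    have h1 : lorentz x.val e ≤ 0 := hPe ((hP x).2 fun i hi => (hxa i hi).le)
    have h2 : c * lorentz x.val e = ε := by
      have hpe : lorentz p.val e = 0 := hp.2
      rw [← lorentz_smul_left, hx, lorentz_add_left, lorentz_smul_left, he, hpe]
      ring
    nlinarith
  obtain ⟨i, hi, hia⟩ := key
  refine ⟨i, hi, ?_⟩
  set b := a i with hb
  have hbb := ha i hi
  have h1 : linSpan (P ∩ hyperplane e) ≤ orthSpace fun _ : Unit => b :=
    linSpan_le fun x hx _ => hia x hx
  -- The component `b - c • e` lies in `e^⊥`, the span of the facet, where `b` vanishes. So it is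
  -- orthogonal to `b`, which gives `c² = 1` and makes it a null vector orthogonal to `x₀`, hence
  -- zero. The interior point `o` then excludes `c = -1`.
  set c := lorentz b e with hc
  have h2 : b - c • e ∈ linSpan (P ∩ hyperplane e) := by
    rw [hspan]
    intro _
    rw [lorentz_sub_left, lorentz_smul_left, he]
    ring
  have h3 : c ^ 2 = 1 := by
    have := h1 h2 ()
    rw [lorentz_sub_left, lorentz_smul_left, hbb, lorentz_comm e b] at this
    linarith
  have h4 : b - c • e = 0 := by
    refine eq_zero_of_causal ?_ x₀ ?_
    · simp only [lorentz_sub_left, lorentz_sub_right, lorentz_smul_left, lorentz_smul_right,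
        he, lorentz_comm e b]
      nlinarith
    · have h5 : lorentz x₀.val e = 0 := hx₀.2
      rw [lorentz_sub_right, lorentz_smul_right, hia x₀ hx₀, h5]
      ring
  have h5 : b = c • e := sub_eq_zero.1 h4
  have hoe : lorentz o.val e ≤ 0 := hPe ((hP o).2 fun j hj => (ho j hj).le)
  have hob := ho i hi
  rw [← hb, h5, lorentz_smul_right] at hob
  have h6 : c = 1 := by
    have h7 : (c - 1) * (c + 1) = 0 := by linarith
    rcases mul_eq_zero.1 h7 with h | h
    · linarith
    · have : c = -1 := by linarith
      rw [this] at hob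
      linarith
  rw [h5, h6, one_smul]

lemma Facet.self {P : Set (Hyp n)} (f : Facet P) : lorentz f.normal f.normal = 1 := f.2.1

lemma Facet.ext {P : Set (Hyp n)} {f g : Facet P} (h : f.normal = g.normal) : f = g :=
  Subtype.ext h

/-- Strict interior points of a polytope. -/
lemma lorentz_neg_of_mem_interior {P : Set (Hyp n)} {o : Hyp n} (ho : o ∈ interior P)
    {e : LSpace n} (he : lorentz e e = 1) (hP : P ⊆ halfSpace e) : lorentz o.val e < 0 := by
  refine lt_of_le_of_ne (hP (interior_subset ho)) fun h0 => ?_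
  obtain ⟨ε, hε, hb⟩ := Metric.isOpen_iff.1 isOpen_interior o ho
  have h1 : geodesic o e he h0 (ε / 2) ∈ P := by
    refine interior_subset (hb ?_)
    rw [Metric.mem_ball, dist_comm, dist_geodesic, abs_of_pos (half_pos hε)]
    exact half_lt_self hε
  have h2 : lorentz (Real.cosh (ε / 2) • o.val + Real.sinh (ε / 2) • e) e ≤ 0 := hP h1
  rw [lorentz_add_left, lorentz_smul_left, lorentz_smul_left, he, h0] at h2
  have := Real.sinh_pos_iff.2 (half_pos hε)
  linarith

/-- A polytope has finitely many facets, it is the intersection of their half-spaces, and each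
facet contains a point that lies on no other facet. -/
lemma IsPolytope.facets {P : Set (Hyp n)} (hP : IsPolytope P) :
    Finite (Facet P) ∧ (∀ x, x ∈ P ↔ ∀ f : Facet P, lorentz x.val f.normal ≤ 0) ∧
      (∃ o : Hyp n, ∀ f : Facet P, lorentz o.val f.normal < 0) ∧
      ∀ f : Facet P, ∃ z : Hyp n, lorentz z.val f.normal = 0 ∧
        ∀ g : Facet P, g ≠ f → lorentz z.val g.normal < 0 := by
  classical
  obtain ⟨⟨N, hN, hPN⟩, -, o, ho⟩ := hP
  have hoN : ∀ e ∈ N, lorentz o.val e < 0 := fun e he =>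
    lorentz_neg_of_mem_interior ho (hN e he) fun x hx => by rw [hPN] at hx; exact hx e he
  obtain ⟨N', hN', hred, hirr⟩ := exists_irredundant ⊤ N id o trivial hoN
  have hP' : ∀ x : Hyp n, x ∈ P ↔ ∀ e ∈ N', lorentz x.val e ≤ 0 := fun x => by
    rw [hPN]
    exact ⟨fun h e he => h e (hN' he), fun h => hred x trivial h⟩
  -- The facet normals are exactly the elements of the irredundant family: `hmem` is one inclusion,
  -- `hfac` the other.
  have hmem : ∀ f : Facet P, f.normal ∈ N' := fun f => by
    obtain ⟨i, hi, h⟩ := f.2.mem_of_eq N' id (fun e he => hN e (hN' he)) hP' o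
      (fun e he => hoN e (hN' he))
    change f.1 ∈ N'
    rwa [h]
  have hfac : ∀ e ∈ N', IsFacetNormal P e := fun e he => by
    obtain ⟨z, -, hz, hzN⟩ := hirr e he
    refine isFacetNormal_of_mem (hN e (hN' he)) (fun x hx => (hP' x).1 hx e he) (N'.erase e) id z
      hz (fun j hj => hzN j (Finset.mem_of_mem_erase hj) (Finset.ne_of_mem_erase hj))
      fun x hx h => (hP' x).2 fun j hj => ?_
    by_cases hje : j = e
    · rw [hje, hx]
    · exact (h j (Finset.mem_erase.2 ⟨hje, hj⟩)).le
  refine ⟨?_, fun x => ?_, ⟨o, fun f => hoN _ (hN' (hmem f))⟩, fun f => ?_⟩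
  · exact Finite.of_injective (fun f : Facet P => (⟨f.normal, hmem f⟩ : N'))
      fun f g h => Facet.ext (Subtype.mk.inj h)
  · rw [hP']
    exact ⟨fun h f => h _ (hmem f), fun h e he => h ⟨e, hfac e he⟩⟩
  · obtain ⟨z, -, hz, hzN⟩ := hirr f.normal (hmem f)
    exact ⟨z, hz, fun g hg => hzN _ (hmem g) fun h => hg (Facet.ext h)⟩

end polytopes

/-! ### Right-angled polytopes -/

section rightAngled

variable {n : ℕ} {P : Set (Hyp n)}

lemma IsRightAngledPolytope.finite (hP : IsRightAngledPolytope P) : Finite (Facet P) :=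
  hP.1.facets.1

lemma IsRightAngledPolytope.mem_iff (hP : IsRightAngledPolytope P) {x : Hyp n} :
    x ∈ P ↔ ∀ f : Facet P, lorentz x.val f.normal ≤ 0 := hP.1.facets.2.1 x

lemma IsRightAngledPolytope.exists_interior (hP : IsRightAngledPolytope P) :
    ∃ o : Hyp n, ∀ f : Facet P, lorentz o.val f.normal < 0 := hP.1.facets.2.2.1

lemma IsRightAngledPolytope.exists_facet_point (hP : IsRightAngledPolytope P) (f : Facet P) :
    ∃ z : Hyp n, lorentz z.val f.normal = 0 ∧
      ∀ g : Facet P, g ≠ f → lorentz z.val g.normal < 0 := hP.1.facets.2.2.2 f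

/-- If the hyperplanes of two facets meet, the Lorentz product of their normals is less than `1`
in absolute value. -/
lemma IsRightAngledPolytope.abs_lorentz_lt (hP : IsRightAngledPolytope P) {f g : Facet P}
    (hfg : f ≠ g) {z : Hyp n} (hf : lorentz z.val f.normal = 0) (hg : lorentz z.val g.normal = 0) :
    -1 < lorentz f.normal g.normal ∧ lorentz f.normal g.normal < 1 := by
  have hff := f.self
  have hgg := g.self
  have hgf := lorentz_comm g.normal f.normal
  constructor
  · by_contra hle
    push Not at hle
    -- A causal vector orthogonal to the point `z` vanishes; but opposite normals cannot both be
    -- negative at an interior point.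
    have h0 : f.normal + g.normal = 0 := by
      refine eq_zero_of_causal ?_ z ?_
      · simp only [lorentz_add_left, lorentz_add_right]
        linarith
      · rw [lorentz_add_right, hf, hg, add_zero]
    obtain ⟨o, ho⟩ := hP.exists_interior
    have h1 : lorentz o.val (f.normal + g.normal) = 0 := by rw [h0, lorentz_zero_right]
    rw [lorentz_add_right] at h1
    linarith [ho f, ho g]
  · by_contra hle
    push Not at hle
    have h0 : f.normal - g.normal = 0 := by
      refine eq_zero_of_causal ?_ z ?_
      · simp only [lorentz_sub_left, lorentz_sub_right]
        linarith
      · rw [lorentz_sub_right, hf, hg, sub_zero]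
    exact hfg (Facet.ext (sub_eq_zero.1 h0))

lemma finrank_orthSpace_pair (a b : LSpace n) (ha : lorentz a a = 1) (hb : lorentz b b = 1)
    (hab : lorentz a b ^ 2 < 1) :
    Module.finrank ℝ (orthSpace ![a, b]) + 2 = n + 1 := by
  set c := lorentz a b
  have hd : 1 - c ^ 2 ≠ 0 := by linarith
  have hba : lorentz b a = c := lorentz_comm b a
  -- The coefficients solve the linear system with Gram matrix `(1, c; c, 1)`, whose determinant is
  -- `1 - c²`.
  have := finrank_orthSpace ![a, b] fun r =>
    ⟨((r 0 - c * r 1) / (1 - c ^ 2)) • a + ((r 1 - c * r 0) / (1 - c ^ 2)) • b, by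
      intro i
      fin_cases i
      · simp only [lorentz_add_left, lorentz_smul_left, Fin.zero_eta, Matrix.cons_val_zero, ha, hba]
        field_simp
        ring
      · simp only [lorentz_add_left, lorentz_smul_left, Fin.mk_one, Matrix.cons_val_one]
        change _ * c + _ * lorentz b b = _
        rw [hb]
        field_simp
        ring⟩
  simpa using this

lemma mem_orthSpace_pair {a b v : LSpace n} :
    v ∈ orthSpace ![a, b] ↔ lorentz v a = 0 ∧ lorentz v b = 0 := by
  simp [mem_orthSpace, Fin.forall_fin_two]

/-- If the intersection of two facets spans the intersection of their hyperplanes, the facets are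
orthogonal. -/
lemma IsRightAngledPolytope.lorentz_eq_zero_of_span (hP : IsRightAngledPolytope P) {f g : Facet P}
    (hfg : f ≠ g) {z : Hyp n} (hz : z ∈ f.toSet ∩ g.toSet)
    (hspan : orthSpace ![f.normal, g.normal] ≤ linSpan (f.toSet ∩ g.toSet)) :
    lorentz f.normal g.normal = 0 := by
  have hspan' : linSpan (f.toSet ∩ g.toSet) = orthSpace ![f.normal, g.normal] :=
    le_antisymm (linSpan_le fun x hx => mem_orthSpace_pair.2 ⟨hx.1.2, hx.2.2⟩) hspan
  obtain ⟨h1, h2⟩ := hP.abs_lorentz_lt hfg hz.1.2 hz.2.2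
  have hr := finrank_orthSpace_pair f.normal g.normal f.self g.self (by nlinarith)
  have h0 := finrank_ne_zero_of_mem z (mem_orthSpace_pair.2 ⟨hz.1.2, hz.2.2⟩)
  -- Here `n ≥ 2`, since the orthogonal space has dimension `n - 1` and contains `z`.
  refine hP.2 f g hfg ⟨n - 2, by omega, ⟨z, hz⟩, ?_⟩
  rw [hspan']
  omega

lemma lorentz_projection_self_neg (x : Hyp n) (e : LSpace n) (he : lorentz e e = 1) :
    IsFuture (x.val - lorentz x.val e • e) := by
  refine isFuture_of_lorentz_neg x ?_ ?_
  · simp only [lorentz_sub_left, lorentz_sub_right, lorentz_smul_left, lorentz_smul_right,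
      x.lorentz_self, he, lorentz_comm e x.val]
    nlinarith [sq_nonneg (lorentz x.val e)]
  · simp only [lorentz_sub_left, lorentz_smul_left, x.lorentz_self, lorentz_comm e x.val]
    nlinarith [sq_nonneg (lorentz x.val e)]

/-- The orthogonal projection to the hyperplane of a facet maps the polytope into itself. -/
lemma IsRightAngledPolytope.projection_mem (hP : IsRightAngledPolytope P) (s : Facet P) {x : Hyp n}
    (hx : x ∈ P) (r : Facet P) :
    lorentz (x.val - lorentz x.val s.normal • s.normal) r.normal ≤ 0 := by
  classical
  have := hP.finite
  have := Fintype.ofFinite (Facet P)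
  obtain ⟨o, hos, ho⟩ := hP.exists_facet_point s
  set U := orthSpace fun _ : Unit => s.normal with hU
  -- An irredundant wall of `s` inside `s^⊥` meets `s` in a set spanning codimension two, so `horth`
  -- can use right-angledness.
  obtain ⟨N', hN', hred, hirr⟩ := exists_irredundant U (Finset.univ.erase s) Facet.normal o
    (mem_orthSpace.2 fun _ => hos) fun i hi => ho i (Finset.ne_of_mem_erase hi)
  have hmem : ∀ y : Hyp n, y.val ∈ U → (∀ i ∈ N', lorentz y.val i.normal ≤ 0) → y ∈ P := by
    intro y hyU hy
    refine hP.mem_iff.2 fun i => ?_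
    by_cases his : i = s
    · rw [his, hyU ()]
    · exact hred y hyU hy i (Finset.mem_erase.2 ⟨his, Finset.mem_univ i⟩)
  have horth : ∀ i ∈ N', lorentz s.normal i.normal = 0 := by
    intro i hi
    obtain ⟨z, hzU, hzi, hz⟩ := hirr i hi
    have hsi : s ≠ i := (Finset.ne_of_mem_erase (hN' hi)).symm
    have hF : ∀ y : Hyp n, y.val ∈ orthSpace ![s.normal, i.normal] →
        (∀ j ∈ N'.erase i, lorentz y.val j.normal < 0) → y ∈ s.toSet ∩ i.toSet := by
      intro y hy hj
      rw [mem_orthSpace_pair] at hy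
      have hyP : y ∈ P := hmem y (mem_orthSpace.2 fun _ => hy.1) fun j hjN => by
        by_cases hji : j = i
        · rw [hji, hy.2]
        · exact (hj j (Finset.mem_erase.2 ⟨hji, hjN⟩)).le
      exact ⟨⟨hyP, hy.1⟩, hyP, hy.2⟩
    have hzV : z.val ∈ orthSpace ![s.normal, i.normal] := mem_orthSpace_pair.2 ⟨hzU (), hzi⟩
    have hzN : ∀ j ∈ N'.erase i, lorentz z.val j.normal < 0 := fun j hj =>
      hz j (Finset.mem_of_mem_erase hj) (Finset.ne_of_mem_erase hj)
    exact hP.lorentz_eq_zero_of_span hsi (hF z hzV hzN) (le_linSpan z hzV _ _ hzN hF)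
  obtain ⟨c, hc, y, hy⟩ := (lorentz_projection_self_neg x s.normal s.self).exists_smul
  have hyr : ∀ b, c * lorentz y.val b = lorentz x.val b - lorentz x.val s.normal * lorentz s.normal b :=
    fun b => by rw [← lorentz_smul_left, hy, lorentz_sub_left, lorentz_smul_left]
  -- Subtracting a multiple of `s.normal` leaves the irredundant inequalities untouched, and within
  -- `s^⊥` these imply all others.
  have hyP : y ∈ P := by
    refine hmem y (fun _ => ?_) fun i hi => ?_
    · have := hyr s.normal
      rw [s.self, mul_one, sub_self] at this
      exact (mul_eq_zero.1 this).resolve_left hc.ne'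
    · have h1 := hyr i.normal
      rw [horth i hi, mul_zero, sub_zero] at h1
      have h2 := hP.mem_iff.1 hx i
      by_contra hcon
      push Not at hcon
      nlinarith [mul_pos hc hcon]
  rw [← hy, lorentz_smul_left]
  exact mul_nonpos_of_nonneg_of_nonpos hc.le (hP.mem_iff.1 hyP r)

open Filter Topology in
/-- Alternating projections: a point of a facet `t` moves, inside the cone over the polytope, to
the intersection of the hyperplanes of `s` and `t`. -/
lemma IsRightAngledPolytope.alternating_projection (hP : IsRightAngledPolytope P) (s t : Facet P)
    (h : lorentz s.normal t.normal ^ 2 < 1) {x : Hyp n} (hx : x ∈ t.toSet) (r : Facet P) :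
    lorentz (x.val - (lorentz x.val s.normal / (1 - lorentz s.normal t.normal ^ 2)) •
      (s.normal - lorentz s.normal t.normal • t.normal)) r.normal ≤ 0 := by
  set c := lorentz s.normal t.normal with hc
  set a := lorentz x.val s.normal with ha
  have hts : lorentz t.normal s.normal = c := lorentz_comm _ _
  have hd : 0 < 1 - c ^ 2 := by linarith
  have hxt : lorentz x.val t.normal = 0 := hx.2
  -- projecting vectors of the cone
  have hproj : ∀ (v : LSpace n), IsFuture v → (∀ r : Facet P, lorentz v r.normal ≤ 0) →
      ∀ q : Facet P, IsFuture (v - lorentz v q.normal • q.normal) ∧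
        ∀ r : Facet P, lorentz (v - lorentz v q.normal • q.normal) r.normal ≤ 0 := by
    intro v hv hvP q
    obtain ⟨d, hd, y, rfl⟩ := hv.exists_smul
    have hy : y ∈ P := hP.mem_iff.2 fun r => by
      have := hvP r
      rw [lorentz_smul_left] at this
      exact nonpos_of_mul_nonpos_right this hd
    have heq : d • y.val - lorentz (d • y.val) q.normal • q.normal =
        d • (y.val - lorentz y.val q.normal • q.normal) := by
      rw [lorentz_smul_left]; module
    rw [heq]
    obtain ⟨h1, h2⟩ := lorentz_projection_self_neg y q.normal q.self
    refine ⟨⟨?_, ?_⟩, fun r => ?_⟩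
    · rw [lorentz_smul_left, lorentz_smul_right]
      exact mul_neg_of_pos_of_neg hd (mul_neg_of_pos_of_neg hd h1)
    · simpa using mul_pos hd h2
    · rw [lorentz_smul_left]
      exact mul_nonpos_of_nonneg_of_nonpos hd.le (hP.projection_mem q hy r)
  -- One round projects to `s` and then to `t`, and multiplies the product with `s.normal` by `c²`.
  -- After `m` rounds the coefficient is the geometric sum of `a c^(2j)` over `j < m`.
  have hstep : ∀ m : ℕ,
      IsFuture (x.val - (a * (1 - (c ^ 2) ^ m) / (1 - c ^ 2)) • (s.normal - c • t.normal)) ∧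
      ∀ r : Facet P, lorentz
        (x.val - (a * (1 - (c ^ 2) ^ m) / (1 - c ^ 2)) • (s.normal - c • t.normal)) r.normal ≤ 0 := by
    intro m
    induction m with
    | zero => simpa using ⟨x.isFuture, hP.mem_iff.1 hx.1⟩
    | succ m ih =>
      set v := x.val - (a * (1 - (c ^ 2) ^ m) / (1 - c ^ 2)) • (s.normal - c • t.normal) with hv
      obtain ⟨h1, h2⟩ := hproj v ih.1 ih.2 s
      obtain ⟨h3, h4⟩ := hproj _ h1 h2 t
      have hvs : lorentz v s.normal = a * (c ^ 2) ^ m := by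
        rw [hv]
        simp only [lorentz_sub_left, lorentz_smul_left, s.self, hts, ← ha]
        field_simp
        ring
      have hvt : lorentz v t.normal = 0 := by
        rw [hv]
        simp only [lorentz_sub_left, lorentz_smul_left, t.self, ← hc, hxt]
        ring
      have heq : v - lorentz v s.normal • s.normal -
          lorentz (v - lorentz v s.normal • s.normal) t.normal • t.normal =
          x.val - (a * (1 - (c ^ 2) ^ (m + 1)) / (1 - c ^ 2)) • (s.normal - c • t.normal) := by
        have h5 : a * (1 - (c ^ 2) ^ (m + 1)) / (1 - c ^ 2) =
            a * (1 - (c ^ 2) ^ m) / (1 - c ^ 2) + a * (c ^ 2) ^ m := by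
          field_simp
          ring
        have h6 : lorentz (v - (a * (c ^ 2) ^ m) • s.normal) t.normal = -(a * (c ^ 2) ^ m * c) := by
          rw [lorentz_sub_left, lorentz_smul_left, hvt, ← hc, zero_sub]
        rw [hvs, h6, h5, hv]
        module
      rw [← heq]
      exact ⟨h3, h4⟩
  have hlim : Tendsto (fun m : ℕ => lorentz
      (x.val - (a * (1 - (c ^ 2) ^ m) / (1 - c ^ 2)) • (s.normal - c • t.normal)) r.normal) atTop
      (𝓝 (lorentz (x.val - (a / (1 - c ^ 2)) • (s.normal - c • t.normal)) r.normal)) := by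
    have h1 := tendsto_pow_atTop_nhds_zero_of_lt_one (sq_nonneg c) h
    have h2 : Continuous fun q : ℝ => lorentz
        (x.val - (a * (1 - q) / (1 - c ^ 2)) • (s.normal - c • t.normal)) r.normal := by
      simp only [lorentz_sub_left, lorentz_smul_left]
      fun_prop
    have h3 := (h2.tendsto 0).comp h1
    simpa [Function.comp_def] using h3
  exact le_of_tendsto' hlim fun m => (hstep m).2 r

/-- The hyperplanes of two facets are orthogonal or disjoint in `ℍⁿ`. -/
lemma IsRightAngledPolytope.dichotomy (hP : IsRightAngledPolytope P) {s t : Facet P} (hst : s ≠ t) :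
    lorentz s.normal t.normal = 0 ∨ lorentz s.normal t.normal ≤ -1 := by
  classical
  have := hP.finite
  have := Fintype.ofFinite (Facet P)
  by_contra hcon
  push Not at hcon
  obtain ⟨hc0, hc1⟩ := hcon
  obtain ⟨z, hzt, hz⟩ := hP.exists_facet_point t
  have hzP : z ∈ P := hP.mem_iff.2 fun g => by
    by_cases hg : g = t
    · rw [hg, hzt]
    · exact (hz g hg).le
  -- Project `z` to `s`: the result has product `-⟨z, s⟩ c` with `t`, which must be nonpositive,
  -- while `⟨z, s⟩ < 0`.
  have hle : lorentz s.normal t.normal ≤ 0 := by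
    have h1 := hP.projection_mem s hzP t
    rw [lorentz_sub_left, lorentz_smul_left, hzt] at h1
    have h2 := hz s hst
    by_contra hpos
    push Not at hpos
    nlinarith [mul_neg_of_neg_of_pos h2 hpos]
  have hsq : lorentz s.normal t.normal ^ 2 < 1 := by nlinarith
  have halt := fun x hx r => hP.alternating_projection s t hsq (x := x) hx r
  set c := lorentz s.normal t.normal with hc
  have hd : 0 < 1 - c ^ 2 := by linarith
  have hts : lorentz t.normal s.normal = c := lorentz_comm _ _
  -- The limit of the alternating projections is orthogonal to both normals and future timelike, so
  -- it rescales to a point of `s ∩ t`.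
  have hpt : ∀ x ∈ t.toSet, ∃ d : ℝ, 0 < d ∧ ∃ y ∈ s.toSet ∩ t.toSet, d • y.val =
      x.val - (lorentz x.val s.normal / (1 - c ^ 2)) • (s.normal - c • t.normal) := by
    intro x hx
    have hxt : lorentz x.val t.normal = 0 := hx.2
    set a := lorentz x.val s.normal with ha
    have hfut : IsFuture (x.val - (a / (1 - c ^ 2)) • (s.normal - c • t.normal)) := by
      have h1 : a / (1 - c ^ 2) * (1 - c ^ 2) = a := div_mul_cancel₀ _ hd.ne'
      have h2 : 0 ≤ a * (a / (1 - c ^ 2)) := by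
        rw [← mul_div_assoc]; exact div_nonneg (mul_self_nonneg a) hd.le
      have h3 : lorentz (x.val - (a / (1 - c ^ 2)) • (s.normal - c • t.normal)) x.val =
          -1 - a * (a / (1 - c ^ 2)) := by
        simp only [lorentz_sub_left, lorentz_smul_left, x.lorentz_self, lorentz_comm s.normal x.val,
          lorentz_comm t.normal x.val, hxt, ← ha]
        ring
      refine isFuture_of_lorentz_neg x ?_ (by rw [h3]; linarith)
      have h4 : lorentz (x.val - (a / (1 - c ^ 2)) • (s.normal - c • t.normal))
          (x.val - (a / (1 - c ^ 2)) • (s.normal - c • t.normal)) = -1 - a * (a / (1 - c ^ 2)) := by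
        rw [lorentz_sub_right, h3]
        simp only [lorentz_sub_left, lorentz_smul_left, lorentz_sub_right, lorentz_smul_right,
          hxt, ← ha, s.self, t.self, hts, ← hc]
        linear_combination (-(a / (1 - c ^ 2))) * (-h1)
      rw [h4]
      linarith
    obtain ⟨d, hd', y, hy⟩ := hfut.exists_smul
    have hyl : ∀ b, d * lorentz y.val b = lorentz x.val b -
        a / (1 - c ^ 2) * (lorentz s.normal b - c * lorentz t.normal b) := fun b => by
      rw [← lorentz_smul_left, hy]
      simp only [lorentz_sub_left, lorentz_smul_left]
    have hyP : y ∈ P := hP.mem_iff.2 fun r => by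
      have := halt x hx r
      rw [← ha, ← hy, lorentz_smul_left] at this
      exact nonpos_of_mul_nonpos_right this hd'
    have hys : lorentz y.val s.normal = 0 := by
      have h1 := hyl s.normal
      rw [s.self, hts, ← ha] at h1
      have h2 : d * lorentz y.val s.normal = 0 := by rw [h1]; field_simp; ring
      exact (mul_eq_zero.1 h2).resolve_left hd'.ne'
    have hyt : lorentz y.val t.normal = 0 := by
      have h1 := hyl t.normal
      rw [t.self, hxt, ← hc] at h1
      have h2 : d * lorentz y.val t.normal = 0 := by rw [h1]; ring
      exact (mul_eq_zero.1 h2).resolve_left hd'.ne'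
    exact ⟨d, hd', y, ⟨⟨hyP, hys⟩, hyP, hyt⟩, hy⟩
  obtain ⟨-, -, y₀, hy₀, -⟩ := hpt z ⟨hzP, hzt⟩
  refine hc0 (hP.lorentz_eq_zero_of_span hst hy₀ fun v hv => ?_)
  rw [mem_orthSpace_pair] at hv
  -- The limit map is linear. It carries the span of `t`, which is all of `t^⊥`, into the span of `s
  -- ∩ t`, and it fixes every vector orthogonal to `s`; so `s ∩ t` spans `s^⊥ ∩ t^⊥`.
  let w : LSpace n →ₗ[ℝ] LSpace n := LinearMap.id -
    ((lorentzForm n).flip s.normal).smulRight ((1 - c ^ 2)⁻¹ • (s.normal - c • t.normal))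
  have hw : ∀ u, w u = u - (lorentz u s.normal / (1 - c ^ 2)) • (s.normal - c • t.normal) := by
    intro u
    simp [w, div_eq_mul_inv, smul_smul]
  have h1 : linSpan t.toSet ≤ (linSpan (s.toSet ∩ t.toSet)).comap w := by
    refine linSpan_le fun x hx => ?_
    obtain ⟨d, -, y, hy, hyx⟩ := hpt x hx
    rw [Submodule.mem_comap, hw, ← hyx]
    exact Submodule.smul_mem _ _ (mem_linSpan hy)
  have h2 : v ∈ linSpan t.toSet := by
    change v ∈ linSpan (P ∩ hyperplane t.1)
    rw [linSpan_facet t.2]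
    exact fun _ => hv.2
  have h3 := h1 h2
  rw [Submodule.mem_comap, hw, hv.1, zero_div, zero_smul, sub_zero] at h3
  exact h3

/-- Facets with a common point are orthogonal. -/
lemma IsRightAngledPolytope.orthogonal (hP : IsRightAngledPolytope P) {f g : Facet P}
    (hfg : f ≠ g) {z : Hyp n} (hf : lorentz z.val f.normal = 0) (hg : lorentz z.val g.normal = 0) :
    lorentz f.normal g.normal = 0 :=
  (hP.dichotomy hfg).resolve_right (not_le.2 (hP.abs_lorentz_lt hfg hf hg).1)

/-- If the hyperplanes of `s` and `t` are disjoint, the complement of the half-space of `t` lies in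
the half-space of `s`. -/
lemma IsRightAngledPolytope.halfSpace_of_le_neg_one (hP : IsRightAngledPolytope P) {s t : Facet P}
    (h : lorentz s.normal t.normal ≤ -1) {x : Hyp n} (hx : 0 ≤ lorentz x.val t.normal) :
    lorentz x.val s.normal ≤ 0 := by
  obtain ⟨o, ho⟩ := hP.exists_interior
  -- The sum of the normals is causal and negative at an interior point, hence negative on all of
  -- `ℍⁿ`.
  have h1 : lorentz x.val (s.normal + t.normal) < 0 := by
    refine lorentz_neg_of_causal ?_ o x ?_
    · simp only [lorentz_add_left, lorentz_add_right, s.self, t.self, lorentz_comm t.normal s.normal]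
      linarith
    · rw [lorentz_add_right]
      linarith [ho s, ho t]
  rw [lorentz_add_right] at h1
  linarith

end rightAngled

/-! ### The reflection group: the polytope is a strict fundamental domain -/

section group

variable {n : ℕ} {P : Set (Hyp n)}

lemma lorentz_facetRefl (f : Facet P) (x : Hyp n) (b : LSpace n) :
    lorentz ((facetRefl f).1 x).val b =
      lorentz x.val b - 2 * lorentz x.val f.normal * lorentz f.normal b := by
  change lorentz (x.val - (2 * lorentz x.val f.normal) • f.normal) b = _
  rw [lorentz_sub_left, lorentz_smul_left]

lemma lorentz_facetRefl_self (f : Facet P) (x : Hyp n) :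
    lorentz ((facetRefl f).1 x).val f.normal = -lorentz x.val f.normal := by
  rw [lorentz_facetRefl, f.self]; ring

lemma lorentz_facetRefl_of_orthogonal {f g : Facet P} (h : lorentz f.normal g.normal = 0)
    (x : Hyp n) : lorentz ((facetRefl f).1 x).val g.normal = lorentz x.val g.normal := by
  rw [lorentz_facetRefl, h]; ring

lemma facetRefl_eq_self {f : Facet P} {x : Hyp n} (h : lorentz x.val f.normal = 0) :
    (facetRefl f).1 x = x := by
  refine Hyp.ext ?_
  change x.val - (2 * lorentz x.val f.normal) • f.normal = x.val
  rw [h, mul_zero, zero_smul, sub_zero]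

lemma facetRefl_mul_self (f : Facet P) : facetRefl f * facetRefl f = 1 := by
  refine Subtype.ext (IsometryEquiv.ext fun x => Hyp.ext ?_)
  exact reflVec_reflVec f.normal f.2.1 x.val

lemma facetRefl_mul_facetRefl_mul (f : Facet P) (w : reflGroup P) :
    facetRefl f * (facetRefl f * w) = w := by
  rw [← mul_assoc, facetRefl_mul_self, one_mul]

lemma facetRefl_inv (f : Facet P) : (facetRefl f)⁻¹ = facetRefl f :=
  inv_eq_of_mul_eq_one_left (facetRefl_mul_self f)

lemma facetRefl_comm {f g : Facet P} (h : lorentz f.normal g.normal = 0) :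
    facetRefl f * facetRefl g = facetRefl g * facetRefl f := by
  refine Subtype.ext (IsometryEquiv.ext fun x => Hyp.ext ?_)
  change reflVec f.normal (reflVec g.normal x.val) = reflVec g.normal (reflVec f.normal x.val)
  have h' : lorentz g.normal f.normal = 0 := by rw [lorentz_comm, h]
  simp only [reflVec, lorentz_sub_left, lorentz_smul_left, h, h']
  module

/-- The subgroup generated by the reflections across the facets in `T`. -/
noncomputable def reflSubgroup (T : Set (Facet P)) : Subgroup (reflGroup P) :=
  Subgroup.closure (facetRefl '' T)

lemma facetRefl_mem {T : Set (Facet P)} {f : Facet P} (hf : f ∈ T) :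
    facetRefl f ∈ reflSubgroup T := Subgroup.subset_closure ⟨f, hf, rfl⟩

/-- The generators are involutions, so no separate step for inverses is needed. -/
lemma reflSubgroup_induction {T : Set (Facet P)} {p : reflGroup P → Prop} (h1 : p 1)
    (hs : ∀ f ∈ T, ∀ w, p w → p (facetRefl f * w)) {w : reflGroup P} (hw : w ∈ reflSubgroup T) :
    p w := by
  induction hw using Subgroup.closure_induction_left with
  | one => exact h1
  | mul_left x hx y hy ih =>
    obtain ⟨f, hf, rfl⟩ := hx
    exact hs f hf y ih
  | inv_mul_cancel x hx y hy ih =>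
    obtain ⟨f, hf, rfl⟩ := hx
    rw [facetRefl_inv]
    exact hs f hf y ih

lemma reflSubgroup_univ : reflSubgroup (Set.univ : Set (Facet P)) = ⊤ := by
  refine Eq.trans ?_ (Subgroup.closure_closure_coe_preimage
    (k := Set.range fun f : Facet P => reflection f.normal f.2.1))
  change Subgroup.closure (facetRefl '' _) = Subgroup.closure _
  congr 1
  ext w
  constructor
  · rintro ⟨f, -, rfl⟩
    exact ⟨f, rfl⟩
  · rintro ⟨f, hf⟩
    exact ⟨f, trivial, Subtype.ext hf⟩

lemma reflGroup_induction {p : reflGroup P → Prop} (h1 : p 1)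
    (hs : ∀ f w, p w → p (facetRefl f * w)) (w : reflGroup P) : p w :=
  reflSubgroup_induction (T := Set.univ) h1 (fun f _ w => hs f w)
    (by rw [reflSubgroup_univ]; trivial)

lemma exists_word (w : reflGroup P) : ∃ l : List (Facet P), (l.map facetRefl).prod = w := by
  induction w using reflGroup_induction with
  | h1 => exact ⟨[], rfl⟩
  | hs f w ih =>
    obtain ⟨l, rfl⟩ := ih
    exact ⟨f :: l, by simp⟩

/-- The word length with respect to the facet reflections. -/
noncomputable def wordLength (w : reflGroup P) : ℕ :=
  sInf {m | ∃ l : List (Facet P), l.length = m ∧ (l.map facetRefl).prod = w}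

lemma exists_reduced_word (w : reflGroup P) :
    ∃ l : List (Facet P), l.length = wordLength w ∧ (l.map facetRefl).prod = w := by
  obtain ⟨l, hl⟩ := exists_word w
  -- By `exists_word` the set is nonempty, so the infimum is a genuine minimum and not the default
  -- `0`.
  exact Nat.sInf_mem (s := {m | ∃ l : List (Facet P), l.length = m ∧ (l.map facetRefl).prod = w})
    ⟨_, l, rfl, hl⟩

lemma wordLength_le (l : List (Facet P)) : wordLength (l.map facetRefl).prod ≤ l.length :=
  Nat.sInf_le ⟨l, rfl, rfl⟩

lemma wordLength_mul_le (f : Facet P) (w : reflGroup P) :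
    wordLength (facetRefl f * w) ≤ wordLength w + 1 := by
  obtain ⟨l, hl, rfl⟩ := exists_reduced_word w
  have := wordLength_le (f :: l)
  simpa [hl] using this

/-- Splits off the first letter of a shortest word; this drives the inductions on length. -/
lemma exists_eq_facetRefl_mul {w : reflGroup P} (hw : w ≠ 1) :
    ∃ f w', w = facetRefl f * w' ∧ wordLength w = wordLength w' + 1 := by
  obtain ⟨l, hl, rfl⟩ := exists_reduced_word w
  cases l with
  | nil => exact absurd rfl hw
  | cons f l =>
    refine ⟨f, (l.map facetRefl).prod, by simp, ?_⟩
    have h1 := wordLength_le l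
    have h2 := wordLength_mul_le f (l.map facetRefl).prod
    have h3 : ((f :: l).map facetRefl).prod = facetRefl f * (l.map facetRefl).prod := by simp
    rw [List.length_cons, h3] at hl
    rw [h3]
    omega

/-- Tits' argument: each translate of the polytope lies on one side of the hyperplane of each
facet, and the side is detected by the word length. -/
lemma IsRightAngledPolytope.side (hP : IsRightAngledPolytope P) (w : reflGroup P) (s : Facet P) :
    (∀ x ∈ P, lorentz (w.1 x).val s.normal ≤ 0) ∨
      ((∀ x ∈ P, 0 ≤ lorentz (w.1 x).val s.normal) ∧
        wordLength (facetRefl s * w) < wordLength w) := by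
  induction hm : wordLength w using Nat.strong_induction_on generalizing w s with
  | _ m ih =>
  by_cases hw : w = 1
  · subst hw
    exact Or.inl fun x hx => hP.mem_iff.1 hx s
  obtain ⟨t, w', rfl, hl⟩ := exists_eq_facetRefl_mul hw
  have hval : ∀ x, (facetRefl t * w').1 x = (facetRefl t).1 (w'.1 x) := fun x => rfl
  by_cases hts : t = s
  · subst hts
    -- Reflecting in `t` exchanges the two sides; were `w' P` already beyond `t`, the word `t w'`
    -- would not be reduced.
    rcases ih _ (by omega) w' t rfl with h | ⟨-, h⟩
    · refine Or.inr ⟨fun x hx => ?_, ?_⟩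
      · rw [hval, lorentz_facetRefl_self]
        linarith [h x hx]
      · rw [facetRefl_mul_facetRefl_mul]
        omega
    · omega
  · rcases hP.dichotomy hts with h0 | hle
    · rcases ih _ (by omega) w' s rfl with h | ⟨h, h'⟩
      · refine Or.inl fun x hx => ?_
        rw [hval, lorentz_facetRefl_of_orthogonal h0]
        exact h x hx
      · refine Or.inr ⟨fun x hx => ?_, ?_⟩
        · rw [hval, lorentz_facetRefl_of_orthogonal h0]
          exact h x hx
        -- Since `s` and `t` commute, shortening `w'` by `s` also shortens `t w'`.
        · rw [← mul_assoc, ← facetRefl_comm h0, mul_assoc]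
          have := wordLength_mul_le t (facetRefl s * w')
          omega
    -- Disjoint walls: `t w' P` lies beyond `t`, hence inside the half-space of `s`.
    · rcases ih _ (by omega) w' t rfl with h | ⟨-, h⟩
      · refine Or.inl fun x hx => ?_
        refine hP.halfSpace_of_le_neg_one (by rwa [lorentz_comm]) (t := t) ?_
        rw [hval, lorentz_facetRefl_self]
        linarith [h x hx]
      · omega

/-- The polytope is a strict fundamental domain, and stabilizers are generated by reflections. -/
lemma IsRightAngledPolytope.strict (hP : IsRightAngledPolytope P) (w : reflGroup P) {p q : Hyp n}
    (hp : p ∈ P) (hq : q ∈ P) (h : w.1 p = q) :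
    p = q ∧ w ∈ reflSubgroup {f : Facet P | lorentz p.val f.normal = 0} := by
  induction hm : wordLength w using Nat.strong_induction_on generalizing w with
  | _ m ih =>
  by_cases hw : w = 1
  · subst hw
    exact ⟨h, Subgroup.one_mem _⟩
  obtain ⟨s, w', rfl, hl⟩ := exists_eq_facetRefl_mul hw
  have hval : (facetRefl s).1 (w'.1 p) = q := h
  rcases hP.side w' s with hs | ⟨-, hs⟩
  -- `q` lies in `P` and is the mirror image in `s` of a point on the inner side, so it is on the
  -- wall of `s` and this letter can be removed.
  · have hqs : lorentz q.val s.normal = 0 := by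
      refine le_antisymm (hP.mem_iff.1 hq s) ?_
      rw [← hval, lorentz_facetRefl_self]
      linarith [hs p hp]
    have hw' : w'.1 p = q := by
      have h2 : w'.1 p = (facetRefl s).1 ((facetRefl s).1 (w'.1 p)) :=
        (congrArg (fun g : reflGroup P => g.1 p) (facetRefl_mul_facetRefl_mul s w')).symm
      rw [h2, hval, facetRefl_eq_self hqs]
    obtain ⟨rfl, hmem⟩ := ih _ (by omega) w' hw' rfl
    exact ⟨rfl, Subgroup.mul_mem _ (facetRefl_mem hqs) hmem⟩
  · omega

/-! ### Local structure and the tiling -/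

/-- The facets through a point. -/
def facetsAt (P : Set (Hyp n)) (p : Hyp n) : Set (Facet P) := {f | lorentz p.val f.normal = 0}

lemma mem_facetsAt {p : Hyp n} {f : Facet P} : f ∈ facetsAt P p ↔ lorentz p.val f.normal = 0 :=
  Iff.rfl

lemma apply_eq_self_of_mem {T : Set (Facet P)} {w : reflGroup P} (hw : w ∈ reflSubgroup T)
    {p : Hyp n} (hp : ∀ f ∈ T, lorentz p.val f.normal = 0) : w.1 p = p := by
  refine reflSubgroup_induction (T := T) (p := fun w => w.1 p = p) rfl (fun f hf w ih => ?_) hw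
  change (facetRefl f).1 (w.1 p) = p
  rw [ih, facetRefl_eq_self (hp f hf)]

lemma reflSubgroup_mono {S T : Set (Facet P)} (h : S ⊆ T) : reflSubgroup S ≤ reflSubgroup T :=
  Subgroup.closure_mono (Set.image_mono h)

/-- Facets through `p` are mutually orthogonal, so reflecting in one corrects its own inequality
without disturbing the others; each needs at most one reflection. -/
lemma IsRightAngledPolytope.exists_fold (hP : IsRightAngledPolytope P) (p y : Hyp n)
    (T : Finset (Facet P)) (hT : ∀ f ∈ T, f ∈ facetsAt P p) :
    ∃ v ∈ reflSubgroup (facetsAt P p), ∀ f ∈ T, lorentz (v.1 y).val f.normal ≤ 0 := by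
  classical
  induction T using Finset.induction_on with
  | empty => exact ⟨1, Subgroup.one_mem _, by simp⟩
  | insert g T hg ih =>
    obtain ⟨v, hv, hvT⟩ := ih fun f hf => hT f (Finset.mem_insert_of_mem hf)
    have hgp := hT g (Finset.mem_insert_self _ _)
    by_cases h : lorentz (v.1 y).val g.normal ≤ 0
    · refine ⟨v, hv, fun f hf => ?_⟩
      rcases Finset.mem_insert.1 hf with rfl | hf
      · exact h
      · exact hvT f hf
    · push Not at h
      refine ⟨facetRefl g * v, Subgroup.mul_mem _ (facetRefl_mem hgp) hv, fun f hf => ?_⟩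
      change lorentz ((facetRefl g).1 (v.1 y)).val f.normal ≤ 0
      by_cases hfg : f = g
      · subst hfg
        rw [lorentz_facetRefl_self]
        linarith
      · rw [lorentz_facetRefl_of_orthogonal (hP.orthogonal (Ne.symm hfg) hgp (hT f hf))]
        exact hvT f ((Finset.mem_insert.1 hf).resolve_left hfg)

/-- Near a point `p` of `P` only the facets through `p` matter. -/
lemma IsRightAngledPolytope.exists_local (hP : IsRightAngledPolytope P) {p : Hyp n} (hp : p ∈ P) :
    ∃ δ > 0, ∀ y, dist y p < δ → facetsAt P y ⊆ facetsAt P p ∧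
      ∃ v ∈ reflSubgroup (facetsAt P p), v.1 y ∈ P := by
  classical
  have := hP.finite
  have := Fintype.ofFinite (Facet P)
  have hev : ∀ᶠ y in nhds p, ∀ f ∈ Finset.univ.filter (fun f => f ∉ facetsAt P p),
      lorentz y.val f.normal < 0 := by
    rw [Filter.eventually_all_finset]
    intro f hf
    exact (continuous_lorentz_right f.normal).continuousAt.eventually_lt continuousAt_const
      (lt_of_le_of_ne (hP.mem_iff.1 hp f) (Finset.mem_filter.1 hf).2)
  obtain ⟨δ, hδ, h⟩ := Metric.eventually_nhds_iff.1 hev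
  refine ⟨δ, hδ, fun y hy => ⟨fun f hf => ?_, ?_⟩⟩
  · by_contra hfp
    have := h hy f (Finset.mem_filter.2 ⟨Finset.mem_univ _, hfp⟩)
    rw [mem_facetsAt.1 hf] at this
    exact lt_irrefl _ this
  · obtain ⟨v, hv, hvT⟩ := hP.exists_fold p y (Finset.univ.filter fun f => f ∈ facetsAt P p)
      (by simp)
    refine ⟨v, hv, hP.mem_iff.2 fun f => ?_⟩
    by_cases hf : f ∈ facetsAt P p
    · exact hvT f (Finset.mem_filter.2 ⟨Finset.mem_univ _, hf⟩)
    · have hd : dist (v.1 y) p < δ := by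
        have h1 := v.1.dist_eq y p
        rw [apply_eq_self_of_mem hv fun f hf => hf] at h1
        rwa [h1]
      exact (h hd f (Finset.mem_filter.2 ⟨Finset.mem_univ _, hf⟩)).le

/-- A translate of `P` that comes near `p ∈ P` is a translate by an element of the stabilizer. -/
lemma IsRightAngledPolytope.exists_local_stabilizer (hP : IsRightAngledPolytope P) {p : Hyp n}
    (hp : p ∈ P) : ∃ δ > 0, ∀ (w : reflGroup P), ∀ q ∈ P, dist (w.1 q) p < δ →
      w ∈ reflSubgroup (facetsAt P p) := by
  obtain ⟨δ, hδ, h⟩ := hP.exists_local hp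
  refine ⟨δ, hδ, fun w q hq hd => ?_⟩
  obtain ⟨-, v, hv, hvP⟩ := h _ hd
  -- Folding `w q` back into `P` returns `q` itself. As `v` fixes `p`, the point `q` is also near
  -- `p`, so its facets are among those of `p`.
  obtain ⟨heq, hmem⟩ := hP.strict (v * w) hq hvP rfl
  have hqp : dist q p < δ := by
    have h1 := v.1.dist_eq (w.1 q) p
    rw [apply_eq_self_of_mem hv fun f hf => hf, ← heq] at h1
    rwa [h1]
  have h2 : v * w ∈ reflSubgroup (facetsAt P p) := reflSubgroup_mono (h q hqp).1 hmem
  exact (Subgroup.mul_mem_cancel_left _ hv).1 h2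

/-- The translates of `P` cover `ℍⁿ`. -/
lemma IsRightAngledPolytope.exists_apply_mem (hP : IsRightAngledPolytope P) (x : Hyp n) :
    ∃ w : reflGroup P, w.1 x ∈ P := by
  have hclosed : IsClosed P := by
    have : P = ⋂ f : Facet P, {x | lorentz x.val f.normal ≤ 0} := by
      ext x
      rw [Set.mem_iInter]
      exact hP.mem_iff
    rw [this]
    exact isClosed_iInter fun f => isClosed_le (continuous_lorentz_right _) continuous_const
  have hcomp : IsCompact P := isCompact_of_isClosed_isBounded hclosed hP.1.2.1
  set U : Set (Hyp n) := {x | ∃ w : reflGroup P, w.1 x ∈ P} with hU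
  have hUinv : ∀ (w : reflGroup P) (x : Hyp n), w.1 x ∈ U → x ∈ U := by
    rintro w x ⟨v, hv⟩
    exact ⟨v * w, hv⟩
  have hnhds : ∀ p ∈ P, ∃ δ > 0, Metric.ball p δ ⊆ U := by
    intro p hp
    obtain ⟨δ, hδ, h⟩ := hP.exists_local hp
    refine ⟨δ, hδ, fun y hy => ?_⟩
    obtain ⟨-, v, -, hv⟩ := h y hy
    exact ⟨v, hv⟩
  have hopen : IsOpen U := by
    rw [Metric.isOpen_iff]
    rintro x ⟨w, hw⟩
    obtain ⟨δ, hδ, h⟩ := hnhds _ hw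
    refine ⟨δ, hδ, fun y hy => hUinv w y (h ?_)⟩
    rw [Metric.mem_ball, w.1.dist_eq]
    exact hy
  -- Compactness gives one radius for all of `P`, and invariance transports it to all of `U`; a
  -- uniform radius makes `U` closed as well as open.
  obtain ⟨ε, hε, hball⟩ := hcomp.exists_thickening_subset_open hopen
    (fun p hp => ⟨1, hp⟩)
  have hclosedU : IsClosed U := by
    rw [← isOpen_compl_iff, Metric.isOpen_iff]
    intro x hx
    refine ⟨ε, hε, fun y hy hyU => hx ?_⟩
    obtain ⟨w, hw⟩ := hyU
    refine hUinv w x (hball ?_)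
    rw [Metric.mem_thickening_iff]
    refine ⟨_, hw, ?_⟩
    rw [w.1.dist_eq, dist_comm]
    exact hy
  obtain ⟨o, ho⟩ := hP.exists_interior
  have hne : U.Nonempty := ⟨o, 1, hP.mem_iff.2 fun f => (ho f).le⟩
  have huniv : U = Set.univ := IsClopen.eq_univ ⟨hclosedU, hopen⟩ hne
  exact huniv.ge (Set.mem_univ x)

end group

/-! ### Vertices -/

section vertices

variable {n : ℕ} {P : Set (Hyp n)}

/-- The intersection of the linear hyperplanes of a set of facets. -/
def facetSpace (T : Set (Facet P)) : Submodule ℝ (LSpace n) := orthSpace fun f : T => f.1.normal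

lemma mem_facetSpace {T : Set (Facet P)} {v : LSpace n} :
    v ∈ facetSpace T ↔ ∀ f ∈ T, lorentz v f.normal = 0 := by
  simp [facetSpace, mem_orthSpace]

/-- The common point `z` makes the normals in `T` orthonormal, so each of them lowers the dimension
by one. -/
lemma IsRightAngledPolytope.finrank_facetSpace (hP : IsRightAngledPolytope P) {T : Set (Facet P)}
    {z : Hyp n} (hz : z.val ∈ facetSpace T) :
    Module.finrank ℝ (facetSpace T) + T.ncard = n + 1 := by
  have := hP.finite
  have := Fintype.ofFinite T
  rw [mem_facetSpace] at hz
  have := finrank_orthSpace_of_orthonormal (fun f : T => f.1.normal) (fun f => f.1.self)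
    fun f g hfg => hP.orthogonal (fun h => hfg (Subtype.ext h)) (hz f f.2) (hz g g.2)
  rwa [← Nat.card_eq_fintype_card] at this

lemma mem_facetSpace_facetsAt (p : Hyp n) : p.val ∈ facetSpace (facetsAt P p) :=
  mem_facetSpace.2 fun _ hf => hf

lemma IsRightAngledPolytope.ncard_facetsAt_le (hP : IsRightAngledPolytope P) (p : Hyp n) :
    (facetsAt P p).ncard ≤ n := by
  have h1 := hP.finrank_facetSpace (mem_facetSpace_facetsAt (P := P) p)
  have h2 := finrank_ne_zero_of_mem p (mem_facetSpace_facetsAt (P := P) p)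
  omega

/-- A face which is not a vertex has a proper subface. -/
lemma IsRightAngledPolytope.exists_ssubset_facetsAt (hP : IsRightAngledPolytope P) {v : Hyp n}
    (hv : v ∈ P) (hlt : (facetsAt P v).ncard < n) :
    ∃ z ∈ P, facetsAt P v ⊂ facetsAt P z := by
  classical
  have := hP.finite
  have := Fintype.ofFinite (Facet P)
  have hvV := mem_facetSpace_facetsAt (P := P) v
  have hr := hP.finrank_facetSpace hvV
  obtain ⟨w, hwV, hw⟩ : ∃ w ∈ facetSpace (facetsAt P v), w ∉ Submodule.span ℝ {v.val} := by
    by_contra hcon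
    push Not at hcon
    have h1 := Submodule.finrank_mono (show facetSpace (facetsAt P v) ≤ Submodule.span ℝ {v.val}
      from hcon)
    have h2 := finrank_span_le_card (R := ℝ) ({v.val} : Set (LSpace n))
    simp only [Set.toFinset_singleton, Finset.card_singleton] at h2
    omega
  set u' := w + lorentz w v.val • v.val with hu'
  have hu'V : u' ∈ facetSpace (facetsAt P v) :=
    Submodule.add_mem _ hwV (Submodule.smul_mem _ _ hvV)
  have hu'v : lorentz u' v.val = 0 := by
    rw [hu', lorentz_add_left, lorentz_smul_left, v.lorentz_self]; ring
  have hpos : 0 < lorentz u' u' := by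
    refine lt_of_le_of_ne (lorentz_nonneg_of_orthogonal v u' hu'v) fun h0 => hw ?_
    have h1 := eq_zero_of_orthogonal v u' hu'v h0.symm
    rw [Submodule.mem_span_singleton]
    exact ⟨-lorentz w v.val, by rw [neg_smul]; exact (eq_neg_of_add_eq_zero_left h1).symm⟩
  set u := (√(lorentz u' u'))⁻¹ • u' with hu
  have huu : lorentz u u = 1 := by
    rw [hu, lorentz_smul_left, lorentz_smul_right, ← mul_assoc, ← mul_inv,
      Real.mul_self_sqrt hpos.le, inv_mul_cancel₀ hpos.ne']
  have huv : lorentz v.val u = 0 := by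
    rw [lorentz_comm, hu, lorentz_smul_left, hu'v, mul_zero]
  have huV : u ∈ facetSpace (facetsAt P v) := Submodule.smul_mem _ _ hu'V
  -- The geodesic from `v` along `u` stays in the facets of `v` and has left the bounded set `P` by
  -- time `|r| + 1`.
  obtain ⟨r, hr⟩ := hP.1.2.1.subset_closedBall v
  set y := geodesic v u huu huv (|r| + 1) with hy
  have hyV : y.val ∈ facetSpace (facetsAt P v) :=
    Submodule.add_mem _ (Submodule.smul_mem _ _ hvV) (Submodule.smul_mem _ _ huV)
  have hyP : y ∉ P := by
    intro h
    have h1 := hr h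
    rw [Metric.mem_closedBall, dist_comm, dist_geodesic, abs_of_pos (by positivity)] at h1
    linarith [le_abs_self r]
  rw [hP.mem_iff] at hyP
  push Not at hyP
  obtain ⟨g₀, hg₀⟩ := hyP
  -- The vector `v + ρ y` meets the wall of `g` when `ρ` is this ratio; the minimal ratio belongs to
  -- the first wall met on leaving `P`.
  obtain ⟨g, hg, hmin⟩ := Finset.exists_min_image
    (Finset.univ.filter fun g : Facet P => 0 < lorentz y.val g.normal)
    (fun g => -lorentz v.val g.normal / lorentz y.val g.normal) ⟨g₀, by simpa using hg₀⟩
  simp only [Finset.mem_filter, Finset.mem_univ, true_and] at hg hmin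
  set ρ := -lorentz v.val g.normal / lorentz y.val g.normal with hρ
  have hρ0 : 0 ≤ ρ := div_nonneg (neg_nonneg.2 (hP.mem_iff.1 hv g)) hg.le
  obtain ⟨c, hc, z, hz⟩ := exists_smul_eq_add v y zero_le_one hρ0 (by linarith)
  have hzl : ∀ b, c * lorentz z.val b = lorentz v.val b + ρ * lorentz y.val b := fun b => by
    rw [← lorentz_smul_left, hz, lorentz_add_left, lorentz_smul_left, lorentz_smul_left, one_mul]
  have hzP : z ∈ P := hP.mem_iff.2 fun h => by
    refine nonpos_of_mul_nonpos_right ?_ hc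
    rw [hzl]
    by_cases hh : 0 < lorentz y.val h.normal
    · have h1 := mul_le_mul_of_nonneg_right (hmin h hh) hh.le
      rw [div_mul_cancel₀ _ hh.ne'] at h1
      linarith
    · push Not at hh
      linarith [hP.mem_iff.1 hv h, mul_nonpos_of_nonneg_of_nonpos hρ0 hh]
  refine ⟨z, hzP, Set.ssubset_iff_subset_ne.2 ⟨fun f hf => ?_, fun heq => ?_⟩⟩
  · have h1 := hzl f.normal
    rw [mem_facetSpace.1 hvV f hf, mem_facetSpace.1 hyV f hf, mul_zero, add_zero] at h1
    exact (mul_eq_zero.1 h1).resolve_left hc.ne'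
  · have hgz : g ∈ facetsAt P z := by
      have h1 := hzl g.normal
      rw [hρ, div_mul_cancel₀ _ hg.ne', add_neg_cancel] at h1
      exact (mul_eq_zero.1 h1).resolve_left hc.ne'
    rw [← heq] at hgz
    rw [mem_facetSpace.1 hyV g hgz] at hg
    exact lt_irrefl _ hg

/-- Each point of a right-angled polytope lies on a face which contains a vertex. -/
lemma IsRightAngledPolytope.exists_vertex (hP : IsRightAngledPolytope P) {p : Hyp n} (hp : p ∈ P) :
    ∃ v ∈ P, facetsAt P p ⊆ facetsAt P v ∧ (facetsAt P v).ncard = n := by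
  have := hP.finite
  obtain ⟨T, ⟨v, hv, hpv, rfl⟩, hmax⟩ := (Set.toFinite
    {T : Set (Facet P) | ∃ v ∈ P, facetsAt P p ⊆ facetsAt P v ∧ facetsAt P v = T}).exists_maximal
    ⟨_, p, hp, subset_rfl, rfl⟩
  refine ⟨v, hv, hpv, le_antisymm (hP.ncard_facetsAt_le v) ?_⟩
  by_contra hlt
  push Not at hlt
  obtain ⟨z, hz, hss⟩ := hP.exists_ssubset_facetsAt hv hlt
  exact hss.2 (hmax ⟨z, hz, hpv.trans hss.1, rfl⟩ hss.1)

/-- A point of `P` on `n` facets is a vertex. -/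
lemma IsRightAngledPolytope.isFace_singleton (hP : IsRightAngledPolytope P) {v : Hyp n}
    (hv : v ∈ P) (hcard : (facetsAt P v).ncard = n) : IsFace P {v} := by
  classical
  have := hP.finite
  have := Fintype.ofFinite (Facet P)
  have hvV := mem_facetSpace_facetsAt (P := P) v
  have huniq : ∀ x : Hyp n, (∀ f ∈ facetsAt P v, lorentz x.val f.normal = 0) → x = v := by
    intro x hx
    have hr := hP.finrank_facetSpace hvV
    have hne : v.val ≠ 0 := fun h0 => by
      have := v.lorentz_self
      rw [h0, lorentz_zero_left] at this
      norm_num at this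
    have hs : Submodule.span ℝ {v.val} = facetSpace (facetsAt P v) := by
      refine Submodule.eq_of_le_of_finrank_eq ?_ ?_
      · rw [Submodule.span_singleton_le_iff_mem]
        exact hvV
      · rw [finrank_span_singleton hne]
        omega
    have hxV : x.val ∈ Submodule.span ℝ {v.val} := by
      rw [hs]
      exact mem_facetSpace.2 hx
    obtain ⟨c, hc⟩ := Submodule.mem_span_singleton.1 hxV
    exact (Hyp.eq_of_smul_eq hc).symm
  refine ⟨⟨v, rfl⟩, ?_⟩
  rcases Nat.eq_zero_or_pos n with hn | hn
  -- For `n = 0` there are no facets to define a supporting hyperplane, and `P` itself is the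
  -- vertex.
  · left
    have hempty : facetsAt P v = ∅ := (Set.ncard_eq_zero (Set.toFinite _)).1 (hcard.trans hn)
    refine Set.Subset.antisymm (Set.singleton_subset_iff.2 hv) fun x hx => ?_
    exact huniq x (by simp [hempty])
  · right
    set T := Finset.univ.filter fun f : Facet P => f ∈ facetsAt P v with hT
    have hmemT : ∀ f, f ∈ T ↔ f ∈ facetsAt P v := fun f => by simp [hT]
    have hTcard : T.card = n := by
      refine Eq.trans ?_ hcard
      rw [← Set.ncard_coe_finset]
      congr 1
      ext f
      simp [hT]
    have hn0 : (0 : ℝ) < n := Nat.cast_pos.2 hn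
    have hx : ∀ x : Hyp n, lorentz x.val ((√n)⁻¹ • ∑ f ∈ T, f.normal) =
        (√n)⁻¹ * ∑ f ∈ T, lorentz x.val f.normal := fun x => by
      rw [lorentz_smul_right, lorentz_sum_right]
    have hs : 0 < (√(n : ℝ))⁻¹ := inv_pos.2 (Real.sqrt_pos.2 hn0)
    -- The `n` normals at `v` are orthonormal, so their sum has square `n`. On `P` every term of the
    -- sum is nonpositive, so it vanishes only where all do, which is at `v`.
    refine ⟨(√n)⁻¹ • ∑ f ∈ T, f.normal, ?_, fun x hxP => ?_, ?_⟩
    · have h1 : lorentz (∑ f ∈ T, f.normal) (∑ f ∈ T, f.normal) = n := by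
        rw [lorentz_sum_left, Finset.sum_congr rfl (g := fun _ => (1 : ℝ)) fun f hf => ?_]
        · rw [Finset.sum_const, hTcard, nsmul_one]
        rw [lorentz_sum_right, Finset.sum_eq_single f, f.self]
        · intro g hg hgf
          exact hP.orthogonal (Ne.symm hgf) ((hmemT f).1 hf) ((hmemT g).1 hg)
        · exact fun h => absurd hf h
      rw [lorentz_smul_left, lorentz_smul_right, h1, ← mul_assoc, ← mul_inv,
        Real.mul_self_sqrt hn0.le, inv_mul_cancel₀ hn0.ne']
    · change lorentz x.val _ ≤ 0
      rw [hx]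
      exact mul_nonpos_of_nonneg_of_nonpos hs.le (Finset.sum_nonpos fun f _ => hP.mem_iff.1 hxP f)
    · ext x
      constructor
      · rintro rfl
        refine ⟨hv, ?_⟩
        change lorentz _ _ = 0
        rw [hx, Finset.sum_eq_zero fun f hf => (hmemT f).1 hf, mul_zero]
      · rintro ⟨hxP, h0⟩
        change lorentz x.val _ = 0 at h0
        rw [hx] at h0
        have h1 := (mul_eq_zero.1 h0).resolve_left hs.ne'
        rw [Finset.sum_eq_zero_iff_of_nonpos fun f _ => hP.mem_iff.1 hxP f] at h1
        exact huniq x fun f hf => h1 f ((hmemT f).2 hf)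

end vertices

/-! ### Characteristic functions -/

section characteristic

variable {n : ℕ} {P : Set (Hyp n)} {A : Type*} [AddCommGroup A]

/-- The value of a homomorphism at the reflection across a facet. -/
noncomputable def facetValue (lam : reflGroup P →* Multiplicative A) (f : Facet P) : A :=
  Multiplicative.toAdd (lam (facetRefl f))

lemma mem_deckGroup {lam : reflGroup P →* Multiplicative A} {g : Hyp n ≃ᵢ Hyp n} :
    g ∈ deckGroup lam ↔ ∃ w : reflGroup P, lam w = 1 ∧ w.1 = g := by
  simp only [deckGroup, Subgroup.mem_map, MonoidHom.mem_ker]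
  rfl

variable [Module (ZMod 2) A] {lam : reflGroup P →* Multiplicative A}

lemma IsCharacteristic.basis_at_vertex (hlam : IsCharacteristic lam) (hP : IsRightAngledPolytope P)
    {v : Hyp n} (hv : v ∈ P) (hcard : (facetsAt P v).ncard = n) :
    LinearIndepOn (ZMod 2) (facetValue lam) (facetsAt P v) ∧
      Submodule.span (ZMod 2) (facetValue lam '' facetsAt P v) = ⊤ := by
  have := hP.finite
  let e : facetsAt P v ≃ Fin n := Finite.equivFinOfCardEq hcard
  obtain ⟨h1, h2⟩ := hlam.2 (fun i => (e.symm i).1)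
    (Subtype.val_injective.comp e.symm.injective)
    ⟨v, hP.isFace_singleton hv hcard, fun i => ⟨hv, (e.symm i).2⟩⟩
  constructor
  · exact (linearIndependent_equiv e.symm (f := fun f : facetsAt P v => facetValue lam f.1)).1 h1
  · rw [← h2]
    congr 1
    ext a
    constructor
    · rintro ⟨f, hf, rfl⟩
      exact ⟨e ⟨f, hf⟩, by simp [facetValue]⟩
    · rintro ⟨i, rfl⟩
      exact ⟨_, (e.symm i).2, rfl⟩

/-- The facets through `p` form a subset of those through some vertex, whose values are a basis. -/
lemma IsCharacteristic.linearIndepOn (hlam : IsCharacteristic lam) (hP : IsRightAngledPolytope P)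
    {p : Hyp n} (hp : p ∈ P) : LinearIndepOn (ZMod 2) (facetValue lam) (facetsAt P p) := by
  obtain ⟨v, hv, hpv, hcard⟩ := hP.exists_vertex hp
  exact (hlam.basis_at_vertex hP hv hcard).1.mono hpv

/-- The elements of the group generated by commuting reflections. -/
lemma IsRightAngledPolytope.exists_finset (hP : IsRightAngledPolytope P)
    (lam : reflGroup P →* Multiplicative A) (p : Hyp n) {w : reflGroup P}
    (hw : w ∈ reflSubgroup (facetsAt P p)) :
    ∃ S : Finset (Facet P), (∀ f ∈ S, f ∈ facetsAt P p) ∧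
      (∀ x : Hyp n, (w.1 x).val = x.val - ∑ f ∈ S, (2 * lorentz x.val f.normal) • f.normal) ∧
      Multiplicative.toAdd (lam w) = ∑ f ∈ S, facetValue lam f := by
  classical
  refine reflSubgroup_induction (T := facetsAt P p) (p := fun w => ∃ S : Finset (Facet P),
      (∀ f ∈ S, f ∈ facetsAt P p) ∧
      (∀ x : Hyp n, (w.1 x).val = x.val - ∑ f ∈ S, (2 * lorentz x.val f.normal) • f.normal) ∧
      Multiplicative.toAdd (lam w) = ∑ f ∈ S, facetValue lam f)
    ⟨∅, by simp, fun x => by simp, by simp⟩ (fun g hg w ih => ?_) hw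
  · obtain ⟨S, hS, hx, hl⟩ := ih
    have horth : ∀ f ∈ S, f ≠ g → lorentz f.normal g.normal = 0 := fun f hf hfg =>
      hP.orthogonal hfg (hS f hf) hg
    have hval : ∀ x, ((facetRefl g * w).1 x).val =
        (w.1 x).val - (2 * lorentz (w.1 x).val g.normal) • g.normal := fun x => rfl
    have hlam : Multiplicative.toAdd (lam (facetRefl g * w)) =
        facetValue lam g + ∑ f ∈ S, facetValue lam f := by
      rw [map_mul, toAdd_mul, hl]; rfl
    -- The reflections are commuting involutions: `S` records the facets used an odd number of
    -- times, and multiplying by `g` toggles the membership of `g`.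
    by_cases hgS : g ∈ S
    · refine ⟨S.erase g, fun f hf => hS f (Finset.mem_of_mem_erase hf), fun x => ?_, ?_⟩
      · have h1 : lorentz (w.1 x).val g.normal = -lorentz x.val g.normal := by
          rw [hx, lorentz_sub_left, lorentz_sum_left, Finset.sum_eq_single g,
            lorentz_smul_left, g.self]
          · ring
          · intro f hf hfg
            rw [lorentz_smul_left, horth f hf hfg, mul_zero]
          · exact fun h => absurd hgS h
        rw [hval, h1, hx, ← Finset.add_sum_erase S _ hgS]
        module
      · rw [hlam, ← Finset.add_sum_erase S _ hgS, ← add_assoc, ZModModule.add_self, zero_add]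
    · refine ⟨insert g S, fun f hf => ?_, fun x => ?_, ?_⟩
      · rcases Finset.mem_insert.1 hf with rfl | hf
        · exact hg
        · exact hS f hf
      · have h1 : lorentz (w.1 x).val g.normal = lorentz x.val g.normal := by
          rw [hx, lorentz_sub_left, lorentz_sum_left, Finset.sum_eq_zero, sub_zero]
          intro f hf
          rw [lorentz_smul_left, horth f hf fun h => hgS (h ▸ hf), mul_zero]
        rw [hval, h1, hx, Finset.sum_insert hgS]
        module
      · rw [hlam, Finset.sum_insert hgS]

/-- `λ` is injective on point stabilizers: a sum of distinct independent values vanishes only if it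
is empty. -/
lemma IsCharacteristic.eq_one (hlam : IsCharacteristic lam) (hP : IsRightAngledPolytope P)
    {p : Hyp n} (hp : p ∈ P) {w : reflGroup P} (hw : w ∈ reflSubgroup (facetsAt P p))
    (h : lam w = 1) : w = 1 := by
  obtain ⟨S, hS, hx, hl⟩ := hP.exists_finset lam p hw
  have hSe : S = ∅ := by
    rw [Finset.eq_empty_iff_forall_notMem]
    intro f hf
    have h1 := linearIndepOn_iff'.1 (hlam.linearIndepOn hP hp) S (fun _ => 1) hS
      (by simpa [h] using hl.symm) f hf
    exact one_ne_zero h1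
  subst hSe
  refine Subtype.ext (IsometryEquiv.ext fun x => Hyp.ext ?_)
  rw [hx]
  simp

/-- The deck group acts freely and discretely. -/
lemma IsCharacteristic.exists_le_dist (hlam : IsCharacteristic lam) (hP : IsRightAngledPolytope P)
    (x : Hyp n) : ∃ δ > 0, ∀ g ∈ deckGroup lam, g ≠ 1 → δ ≤ dist (g x) x := by
  obtain ⟨v, hv⟩ := hP.exists_apply_mem x
  obtain ⟨δ, hδ, h⟩ := hP.exists_local_stabilizer hv
  refine ⟨δ, hδ, fun g hg hg1 => ?_⟩
  by_contra hlt
  push Not at hlt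
  obtain ⟨w, hw, rfl⟩ := mem_deckGroup.1 hg
  -- Conjugation by `v` moves the question to the point `v x` of `P`, and the kernel is normal.
  have hmem := h (v * w * v⁻¹) _ hv (by
    have h1 : (v * w * v⁻¹).1 (v.1 x) = v.1 (w.1 x) := by
      change v.1 (w.1 (v.1.symm (v.1 x))) = _
      rw [v.1.symm_apply_apply]
    rw [h1, v.1.dist_eq]
    exact hlt)
  have h1 := hlam.eq_one hP hv hmem (by simp [hw])
  have h2 : w = 1 := by
    rw [mul_inv_eq_one] at h1
    exact mul_eq_left.1 h1
  exact hg1 (by rw [h2]; rfl)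

end characteristic

/-! ### Quotients -/

section quotients

variable {n : ℕ} {Γ : Subgroup (Hyp n ≃ᵢ Hyp n)}

lemma proj_eq_iff {x y : Hyp n} : proj Γ x = proj Γ y ↔ ∃ g ∈ Γ, g x = y :=
  ⟨fun h => Quotient.exact h, fun h => Quotient.sound h⟩

lemma exists_proj_eq (q : HypQuotient Γ) : ∃ x, proj Γ x = q := Quotient.exists_rep q

lemma dist_proj_le (x y : Hyp n) : dist (proj Γ x) (proj Γ y) ≤ dist x y :=
  csInf_le (repDists_bddBelow _ _) ⟨x, y, rfl, rfl, rfl⟩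

lemma exists_rep_of_dist_lt {x : Hyp n} {q : HypQuotient Γ} {r : ℝ} (h : dist q (proj Γ x) < r) :
    ∃ y, proj Γ y = q ∧ dist y x < r := by
  obtain ⟨-, ⟨y, x', hy, hx', rfl⟩, hlt⟩ := exists_lt_of_csInf_lt (repDists_nonempty _ _) h
  obtain ⟨g, hg, rfl⟩ := proj_eq_iff.1 hx'
  refine ⟨g y, ?_, by rwa [g.dist_eq]⟩
  rw [← hy]
  exact (proj_eq_iff.2 ⟨g, hg, rfl⟩).symm

/-- Where the group acts freely and discretely, the projection is isometric on small balls. -/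
lemma dist_proj_eq {x : Hyp n} {δ : ℝ} (h : ∀ g ∈ Γ, g ≠ 1 → δ ≤ dist (g x) x) {y z : Hyp n}
    (hy : dist y x < δ / 4) (hz : dist z x < δ / 4) : dist (proj Γ y) (proj Γ z) = dist y z := by
  refine le_antisymm (dist_proj_le y z) (le_csInf (repDists_nonempty _ _) ?_)
  rintro _ ⟨y', z', hy', hz', rfl⟩
  obtain ⟨g, hg, rfl⟩ := proj_eq_iff.1 hy'
  obtain ⟨k, hk, rfl⟩ := proj_eq_iff.1 hz'
  have hkg : k * g⁻¹ ∈ Γ := Γ.mul_mem hk (Γ.inv_mem hg)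
  by_cases h1 : k * g⁻¹ = 1
  · rw [mul_inv_eq_one] at h1
    rw [h1, g.dist_eq]
  -- If `k ≠ g`, then `k g⁻¹` moves `x` by at least `δ`. Two of the three legs from its image to `x`
  -- are shorter than `δ/4`, so `y'` and `z'` are more than `δ/2` apart, further than the two given
  -- points.
  · have h2 := h _ hkg h1
    have h3 : (k * g⁻¹) (g y') = k y' := by
      change k (g.symm (g y')) = _
      rw [g.symm_apply_apply]
    have h4 := (k * g⁻¹).dist_eq x (g y')
    rw [h3, dist_comm x] at h4
    have h5 := dist_triangle4 ((k * g⁻¹) x) (k y') (k z') x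
    have h6 := k.dist_eq y' z'
    have h7 := dist_triangle_right (g y') (k z') x
    linarith

end quotients

/-! ### Faces of right-angled polytopes -/

section faces

variable {n : ℕ} {P F : Set (Hyp n)}

/-- The facets containing `F`. -/
def facetsContaining (P F : Set (Hyp n)) : Set (Facet P) :=
  {f | ∀ x ∈ F, lorentz x.val f.normal = 0}

/-- The facets which meet `F` without containing it. -/
def facetsCrossing (P F : Set (Hyp n)) : Set (Facet P) :=
  {f | f ∉ facetsContaining P F ∧ ∃ x ∈ F, lorentz x.val f.normal = 0}

lemma IsFace.subset (hF : IsFace P F) : F ⊆ P := by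
  rcases hF.2 with rfl | ⟨e, -, -, rfl⟩
  · exact subset_rfl
  · exact Set.inter_subset_left

lemma facetsContaining_subset {p : Hyp n} (hp : p ∈ F) :
    facetsContaining P F ⊆ facetsAt P p := fun _ hf => hf p hp

/-- A point of the relative interior of a face lies on no facets but those containing the face. -/
lemma IsFace.exists_facetsAt_eq (hF : IsFace P F) (hP : IsRightAngledPolytope P) :
    ∃ p ∈ F, facetsAt P p = facetsContaining P F := by
  classical
  have := hP.finite
  have := Fintype.ofFinite (Facet P)
  have hle : ∀ x ∈ F, ∀ f : Facet P, lorentz x.val f.normal ≤ 0 := fun x hx =>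
    hP.mem_iff.1 (hF.subset hx)
  obtain ⟨p, hp, hpN⟩ := exists_relInt (Finset.univ.filter fun f => f ∉ facetsContaining P F)
    Facet.normal hF.1 (fun x hx y hy z c hc hz => by
      have hl : ∀ b, c * lorentz z.val b = lorentz x.val b + lorentz y.val b := fun b => by
        rw [← lorentz_smul_left, hz, lorentz_add_left]
      have hzP : z ∈ P := hP.mem_iff.2 fun f => by
        refine nonpos_of_mul_nonpos_right ?_ hc
        rw [hl]
        exact add_nonpos (hle x hx f) (hle y hy f)
      rcases hF.2 with rfl | ⟨e, -, -, rfl⟩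
      · exact hzP
      · refine ⟨hzP, ?_⟩
        have h1 := hl e
        have h2 : lorentz x.val e = 0 := hx.2
        have h3 : lorentz y.val e = 0 := hy.2
        rw [h2, h3, add_zero] at h1
        exact (mul_eq_zero.1 h1).resolve_left hc.ne')
    (fun x hx f _ => hle x hx f) (fun f hf => by
      by_contra hcon
      push Not at hcon
      exact (Finset.mem_filter.1 hf).2 fun x hx => le_antisymm (hle x hx f) (hcon x hx))
  refine ⟨p, hp, Set.Subset.antisymm (fun f hf => ?_) (facetsContaining_subset hp)⟩
  by_contra hfF
  have := hpN f (by simpa using hfF)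
  rw [mem_facetsAt.1 hf] at this
  exact lt_irrefl _ this

/-- The supporting functional vanishes at a relative interior point and is nonpositive nearby in
`P`, hence nonpositive on the linear space of the containing facets; a functional of one sign on a
linear space is zero there. -/
lemma IsFace.mem_iff (hF : IsFace P F) (hP : IsRightAngledPolytope P) {x : Hyp n} :
    x ∈ F ↔ x ∈ P ∧ ∀ f ∈ facetsContaining P F, lorentz x.val f.normal = 0 := by
  classical
  have := hP.finite
  have := Fintype.ofFinite (Facet P)
  refine ⟨fun hx => ⟨hF.subset hx, fun f hf => hf x hx⟩, fun ⟨hxP, hx⟩ => ?_⟩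
  obtain ⟨p, hp, hpF⟩ := hF.exists_facetsAt_eq hP
  rcases hF.2 with h | ⟨e, he, hPe, h⟩
  · rwa [h]
  rw [h]
  refine ⟨hxP, ?_⟩
  have hpe : lorentz p.val e = 0 := by rw [h] at hp; exact hp.2
  have key : ∀ v ∈ facetSpace (facetsContaining P F), lorentz v e ≤ 0 := by
    intro v hv
    obtain ⟨ε, hε, c, hc, y, hy, hyN⟩ := exists_hyp_near p v
      (Finset.univ.filter fun f => f ∉ facetsContaining P F) Facet.normal (fun f hf => by
        refine lt_of_le_of_ne (hP.mem_iff.1 (hF.subset hp) f) fun h0 => ?_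
        exact (Finset.mem_filter.1 hf).2 (hpF ▸ h0))
    have hl : ∀ b, c * lorentz y.val b = lorentz p.val b + ε * lorentz v b := fun b => by
      rw [← lorentz_smul_left, hy, lorentz_add_left, lorentz_smul_left]
    have hyP : y ∈ P := hP.mem_iff.2 fun f => by
      by_cases hf : f ∈ facetsContaining P F
      · have h1 := hl f.normal
        rw [hf p hp, mem_facetSpace.1 hv f hf, mul_zero, add_zero] at h1
        exact ((mul_eq_zero.1 h1).resolve_left hc.ne').le
      · exact (hyN f (by simpa using hf)).le
    have h1 := hl e
    have h2 : lorentz y.val e ≤ 0 := hPe hyP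
    rw [hpe, zero_add] at h1
    have h3 : ε * lorentz v e ≤ 0 := by
      rw [← h1]
      exact mul_nonpos_of_nonneg_of_nonpos hc.le h2
    exact nonpos_of_mul_nonpos_right h3 hε
  have h1 := key x.val (mem_facetSpace.2 hx)
  have h2 := key (-x.val) (Submodule.neg_mem _ (mem_facetSpace.2 hx))
  rw [lorentz_neg_left] at h2
  exact le_antisymm h1 (by linarith)

/-- Near a relative interior point, only the facets containing `F` impose conditions, so `F` fills a
neighbourhood in their common space. -/
lemma IsFace.linSpan_eq (hF : IsFace P F) (hP : IsRightAngledPolytope P) :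
    linSpan F = facetSpace (facetsContaining P F) := by
  classical
  have := hP.finite
  have := Fintype.ofFinite (Facet P)
  obtain ⟨p, hp, hpF⟩ := hF.exists_facetsAt_eq hP
  refine le_antisymm (linSpan_le fun x hx => mem_facetSpace.2 fun f hf => hf x hx) ?_
  refine le_linSpan p (mem_facetSpace.2 fun f (hf : f ∈ facetsContaining P F) => hf p hp)
    (Finset.univ.filter fun f => f ∉ facetsContaining P F) Facet.normal (fun f hf => ?_)
    fun x hxU hx => ?_
  · refine lt_of_le_of_ne (hP.mem_iff.1 (hF.subset hp) f) fun h0 => ?_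
    exact (Finset.mem_filter.1 hf).2 (hpF ▸ h0)
  · rw [mem_facetSpace] at hxU
    refine (hF.mem_iff hP).2 ⟨hP.mem_iff.2 fun f => ?_, hxU⟩
    by_cases hf : f ∈ facetsContaining P F
    · exact (hxU f hf).le
    · exact (hx f (by simpa using hf)).le

lemma IsFace.mem_hypSpan (hF : IsFace P F) (hP : IsRightAngledPolytope P) {x : Hyp n} :
    x ∈ hypSpan F ↔ ∀ f ∈ facetsContaining P F, lorentz x.val f.normal = 0 := by
  change x.val ∈ linSpan F ↔ _
  rw [hF.linSpan_eq hP, mem_facetSpace]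

lemma IsFace.ncard_add (hF : IsFace P F) (hP : IsRightAngledPolytope P) {k : ℕ}
    (hk : HasDim F k) : (facetsContaining P F).ncard + k = n := by
  obtain ⟨p, hp⟩ := hF.1
  have h1 := hP.finrank_facetSpace (T := facetsContaining P F) (z := p)
    (mem_facetSpace.2 fun f (hf : f ∈ facetsContaining P F) => hf p hp)
  rw [← hF.linSpan_eq hP, hk.2] at h1
  omega

/-- A facet which crosses a face meets it in a point that lies on no further facets. -/
lemma IsFace.exists_crossing_point (hF : IsFace P F) (hP : IsRightAngledPolytope P) {s : Facet P}
    (hs : s ∈ facetsCrossing P F) : ∃ z ∈ F, lorentz z.val s.normal = 0 ∧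
      ∀ f ∉ facetsContaining P F, f ≠ s → lorentz z.val f.normal < 0 := by
  classical
  have := hP.finite
  have := Fintype.ofFinite (Facet P)
  obtain ⟨hsF, q, hq, hqs⟩ := hs
  set R := Finset.univ.filter fun f : Facet P =>
    f ∈ facetsAt P q ∧ f ∉ facetsContaining P F ∧ f ≠ s with hR
  -- Pushing `q` inward along the normals in `R` affects, by orthogonality, no other facet through
  -- `q`; `s` and the facets containing `F` keep product zero.
  obtain ⟨ε, hε, c, hc, z, hz, hzN⟩ := exists_hyp_near q (-∑ f ∈ R, f.normal)
    (Finset.univ.filter fun f => f ∉ facetsAt P q) Facet.normal (fun f hf =>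
      lt_of_le_of_ne (hP.mem_iff.1 (hF.subset hq) f) (Finset.mem_filter.1 hf).2)
  have hl : ∀ f ∈ facetsAt P q, c * lorentz z.val f.normal = if f ∈ R then -ε else 0 := by
    intro f hf
    rw [← lorentz_smul_left, hz, lorentz_add_left, lorentz_smul_left, lorentz_neg_left,
      lorentz_sum_left, mem_facetsAt.1 hf, zero_add]
    split_ifs with hfR
    · rw [Finset.sum_eq_single f, f.self]
      · ring
      · intro g hg hgf
        exact hP.orthogonal hgf (Finset.mem_filter.1 hg).2.1 hf
      · exact fun h => absurd hfR h
    · rw [Finset.sum_eq_zero, neg_zero, mul_zero]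
      intro g hg
      exact hP.orthogonal (fun h => hfR (h ▸ hg)) (Finset.mem_filter.1 hg).2.1 hf
  have hlt : ∀ f ∉ facetsContaining P F, f ≠ s → lorentz z.val f.normal < 0 := by
    intro f hf hfs
    by_cases hfq : f ∈ facetsAt P q
    · have h1 := hl f hfq
      rw [if_pos (by simp [hR, hfq, hf, hfs])] at h1
      refine neg_of_mul_neg_right (b := lorentz z.val f.normal) (a := c) ?_ hc.le
      rw [h1]
      linarith
    · exact hzN f (by simpa using hfq)
  have hzero : ∀ f ∈ facetsAt P q, f ∉ R → lorentz z.val f.normal = 0 := by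
    intro f hf hfR
    have h1 := hl f hf
    rw [if_neg hfR] at h1
    exact (mul_eq_zero.1 h1).resolve_left hc.ne'
  have hzs : lorentz z.val s.normal = 0 := hzero s hqs (by simp [hR])
  have hzF : ∀ f ∈ facetsContaining P F, lorentz z.val f.normal = 0 := fun f hf =>
    hzero f (hf q hq) (by simp [hR, hf])
  refine ⟨z, (hF.mem_iff hP).2 ⟨hP.mem_iff.2 fun f => ?_, hzF⟩, hzs, hlt⟩
  by_cases hf : f ∈ facetsContaining P F
  · exact (hzF f hf).le
  · by_cases hfs : f = s
    · rw [hfs, hzs]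
    · exact (hlt f hf hfs).le

/-- The point `q` lies on `s` and on every facet containing `F`, so `s` is orthogonal to all of
these. Hence the reflection across `s` preserves `ℍ_F`. -/
lemma IsFace.normal_mem_linSpan (hF : IsFace P F) (hP : IsRightAngledPolytope P) {s : Facet P}
    (hs : s ∈ facetsCrossing P F) : s.normal ∈ linSpan F := by
  obtain ⟨hsF, q, hq, hqs⟩ := hs
  rw [hF.linSpan_eq hP, mem_facetSpace]
  intro f hf
  exact hP.orthogonal (fun h => hsF (h ▸ hf)) hqs (hf q hq)

/-- A face is cut out of its span by the facets crossing it. -/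
lemma IsFace.mem_of_crossing (hF : IsFace P F) (hP : IsRightAngledPolytope P) {x : Hyp n}
    (hx : x ∈ hypSpan F) (h : ∀ s ∈ facetsCrossing P F, lorentz x.val s.normal ≤ 0) : x ∈ F := by
  classical
  have := hP.finite
  have := Fintype.ofFinite (Facet P)
  obtain ⟨p, hp, hpF⟩ := hF.exists_facetsAt_eq hP
  obtain ⟨N', hN', hred, hirr⟩ := exists_irredundant (linSpan F)
    (Finset.univ.filter fun f => f ∉ facetsContaining P F) Facet.normal p (mem_linSpan hp)
    (fun f hf => by
      refine lt_of_le_of_ne (hP.mem_iff.1 (hF.subset hp) f) fun h0 => ?_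
      exact (Finset.mem_filter.1 hf).2 (hpF ▸ h0))
  have hmem : ∀ y : Hyp n, y ∈ hypSpan F → (∀ f ∈ N', lorentz y.val f.normal ≤ 0) → y ∈ F := by
    intro y hyU hy
    refine (hF.mem_iff hP).2 ⟨hP.mem_iff.2 fun f => ?_, (hF.mem_hypSpan hP).1 hyU⟩
    by_cases hf : f ∈ facetsContaining P F
    · exact ((hF.mem_hypSpan hP).1 hyU f hf).le
    · exact hred y hyU hy f (by simpa using hf)
  -- An irredundant inequality has a witness that lies in `F` and on its wall, so the facet crosses
  -- `F`.
  refine hmem x hx fun s hs => h s ⟨(Finset.mem_filter.1 (hN' hs)).2, ?_⟩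
  obtain ⟨z, hzU, hzs, hz⟩ := hirr s hs
  refine ⟨z, hmem z hzU fun f hf => ?_, hzs⟩
  by_cases hfs : f = s
  · rw [hfs, hzs]
  · exact (hz f hf hfs).le

end faces

/-! ### Parametrizations of hyperbolic subspaces -/

section embeddings

variable {n k : ℕ}

/-- A linear map `ℝ^{k,1} → ℝ^{n,1}` preserving the Lorentz form, and the map `ℍᵏ → ℍⁿ` that it
induces. -/
structure LorentzEmbedding (k n : ℕ) where
  /-- The linear map. -/
  lin : LSpace k →ₗ[ℝ] LSpace n
  /-- The induced map of hyperbolic spaces. -/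
  map : Hyp k → Hyp n
  val_map : ∀ y, (map y).val = lin y.val
  lorentz_lin : ∀ u v, lorentz (lin u) (lin v) = lorentz u v

lemma LorentzEmbedding.lorentz_map (E : LorentzEmbedding k n) (y : Hyp k) (v : LSpace k) :
    lorentz (E.map y).val (E.lin v) = lorentz y.val v := by
  rw [E.val_map, E.lorentz_lin]

lemma LorentzEmbedding.isometry (E : LorentzEmbedding k n) : Isometry E.map :=
  Isometry.of_dist_eq fun x y => by
    rw [Hyp.dist_eq, Hyp.dist_eq, E.val_map y, E.lorentz_map]

lemma eq_zero_of_lorentz_eq_zero {u : LSpace n} (h : ∀ v, lorentz u v = 0) : u = 0 := by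
  have h1 := h (u.1, -u.2)
  unfold lorentz at h1
  simp only [real_inner_self_eq_norm_sq] at h1
  have h2 : ‖u.1‖ = 0 := by nlinarith [sq_nonneg ‖u.1‖, sq_nonneg u.2]
  have h3 : u.2 = 0 := by rw [h2] at h1; nlinarith [sq_nonneg u.2]
  exact Prod.ext (norm_eq_zero.1 h2) h3

lemma LorentzEmbedding.lin_injective (E : LorentzEmbedding k n) : Function.Injective E.lin := by
  rw [← LinearMap.ker_eq_bot, LinearMap.ker_eq_bot']
  intro u hu
  refine eq_zero_of_lorentz_eq_zero fun v => ?_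
  rw [← E.lorentz_lin, hu, lorentz_zero_left]

/-- Gram–Schmidt in the orthogonal complement of `x` within `U`, where the Lorentz form is positive
definite. -/
lemma exists_orthonormal (x : Hyp n) (U : Submodule ℝ (LSpace n)) (hx : x.val ∈ U)
    (hU : Module.finrank ℝ U = k + 1) (m : ℕ) (hm : m ≤ k) :
    ∃ e : Fin m → LSpace n, (∀ i, e i ∈ U) ∧ (∀ i, lorentz (e i) x.val = 0) ∧
      (∀ i, lorentz (e i) (e i) = 1) ∧ ∀ i j, i ≠ j → lorentz (e i) (e j) = 0 := by
  classical
  induction m with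
  | zero => exact ⟨Fin.elim0, fun i => i.elim0, fun i => i.elim0, fun i => i.elim0,
      fun i => i.elim0⟩
  | succ m ih =>
    obtain ⟨e, heU, hex, he1, he0⟩ := ih (by omega)
    set V := Submodule.span ℝ (Set.range fun o : Option (Fin m) => o.elim x.val e) with hV
    have hmemV : ∀ o : Option (Fin m), o.elim x.val e ∈ V := fun o => Submodule.subset_span ⟨o, rfl⟩
    obtain ⟨w, hwU, hwV⟩ : ∃ w ∈ U, w ∉ V := by
      by_contra hcon
      push Not at hcon
      have h1 := Submodule.finrank_mono (show U ≤ V from hcon)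
      have h2 := finrank_range_le_card (R := ℝ) fun o : Option (Fin m) => o.elim x.val e
      rw [Fintype.card_option, Fintype.card_fin] at h2
      have h3 : Module.finrank ℝ V ≤ m + 1 := h2
      omega
    set u' := w + lorentz w x.val • x.val - ∑ i, lorentz w (e i) • e i with hu'
    have hu'U : u' ∈ U := Submodule.sub_mem _ (Submodule.add_mem _ hwU (Submodule.smul_mem _ _ hx))
      (Submodule.sum_mem _ fun i _ => Submodule.smul_mem _ _ (heU i))
    have hu'x : lorentz u' x.val = 0 := by
      rw [hu', lorentz_sub_left, lorentz_add_left, lorentz_smul_left, x.lorentz_self,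
        lorentz_sum_left, Finset.sum_eq_zero fun i _ => by
          rw [lorentz_smul_left, hex, mul_zero]]
      ring
    have hu'e : ∀ j, lorentz u' (e j) = 0 := fun j => by
      rw [hu', lorentz_sub_left, lorentz_add_left, lorentz_smul_left, lorentz_comm x.val, hex,
        lorentz_sum_left, Finset.sum_eq_single j, lorentz_smul_left, he1]
      · ring
      · intro i _ hij
        rw [lorentz_smul_left, he0 i j hij, mul_zero]
      · simp
    have hpos : 0 < lorentz u' u' := by
      refine lt_of_le_of_ne (lorentz_nonneg_of_orthogonal x u' hu'x) fun h0 => hwV ?_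
      have h1 := eq_zero_of_orthogonal x u' hu'x h0.symm
      have h2 : w = (∑ i, lorentz w (e i) • e i) - lorentz w x.val • x.val := by
        rw [hu', sub_eq_zero] at h1
        rw [← h1, add_sub_cancel_right]
      rw [h2]
      exact Submodule.sub_mem _
        (Submodule.sum_mem _ fun i _ => Submodule.smul_mem _ _ (hmemV (some i)))
        (Submodule.smul_mem _ _ (hmemV none))
    refine ⟨Fin.snoc e ((√(lorentz u' u'))⁻¹ • u'), ?_, ?_, ?_, ?_⟩
    · intro i
      refine Fin.lastCases ?_ (fun i => ?_) i
      · simpa using Submodule.smul_mem _ _ hu'U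
      · simpa using heU i
    · intro i
      refine Fin.lastCases ?_ (fun i => ?_) i
      · simp [lorentz_smul_left, hu'x]
      · simpa using hex i
    · intro i
      refine Fin.lastCases ?_ (fun i => ?_) i
      · simp only [Fin.snoc_last]
        rw [lorentz_smul_left, lorentz_smul_right, ← mul_assoc, ← mul_inv,
          Real.mul_self_sqrt hpos.le, inv_mul_cancel₀ hpos.ne']
      · simpa using he1 i
    · intro i j
      refine Fin.lastCases ?_ (fun i => ?_) i <;> refine Fin.lastCases ?_ (fun j => ?_) j
      · exact fun h => absurd rfl h
      · intro _
        simp [lorentz_smul_left, hu'e]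
      · intro _
        simp only [Fin.snoc_last, Fin.snoc_castSucc]
        rw [lorentz_comm, lorentz_smul_left, hu'e, mul_zero]
      · intro h
        simpa using he0 i j fun h' => h (by rw [h'])

/-- Each hyperbolic subspace is parametrized by a hyperbolic space. -/
lemma exists_lorentzEmbedding {S : Set (Hyp n)} (hS : HasDim S k) :
    ∃ E : LorentzEmbedding k n, LinearMap.range E.lin = linSpan S ∧
      Set.range E.map = hypSpan S := by
  obtain ⟨⟨x, hxS⟩, hdim⟩ := hS
  have hx := mem_linSpan hxS
  obtain ⟨e, heU, hex, he1, he0⟩ := exists_orthonormal x (linSpan S) hx hdim k le_rfl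
  let L : LSpace k →ₗ[ℝ] LSpace n :=
    { toFun := fun y => ∑ i, y.1 i • e i + y.2 • x.val
      map_add' := fun y z => by
        simp only [Prod.fst_add, Prod.snd_add, PiLp.add_apply, add_smul, Finset.sum_add_distrib]
        abel
      map_smul' := fun c y => by
        simp only [Prod.smul_fst, Prod.smul_snd, PiLp.smul_apply, smul_eq_mul, mul_smul,
          ← Finset.smul_sum, smul_add, RingHom.id_apply] }
  have hL : ∀ y, L y = ∑ i, y.1 i • e i + y.2 • x.val := fun y => rfl
  have hLe : ∀ y i, lorentz (L y) (e i) = y.1 i := fun y i => by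
    rw [hL, lorentz_add_left, lorentz_smul_left, lorentz_comm x.val, hex, lorentz_sum_left,
      Finset.sum_eq_single i, lorentz_smul_left, he1]
    · ring
    · intro j _ hji
      rw [lorentz_smul_left, he0 j i hji, mul_zero]
    · simp
  have hLx : ∀ y, lorentz (L y) x.val = -y.2 := fun y => by
    rw [hL, lorentz_add_left, lorentz_smul_left, x.lorentz_self, lorentz_sum_left,
      Finset.sum_eq_zero fun i _ => by rw [lorentz_smul_left, hex, mul_zero]]
    ring
  have hpres : ∀ u v, lorentz (L u) (L v) = lorentz u v := fun u v => by
    rw [hL v, lorentz_add_right, lorentz_smul_right, hLx, lorentz_sum_right]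
    simp only [lorentz_smul_right, hLe]
    unfold lorentz
    rw [PiLp.inner_apply]
    simp only [RCLike.inner_apply, conj_trivial]
    ring
  have hmap : ∀ y : Hyp k, lorentz (L y.val) (L y.val) = -1 ∧ 0 < (L y.val).2 := fun y => by
    have h1 : lorentz (L y.val) (L y.val) = -1 := by rw [hpres, y.lorentz_self]
    refine ⟨h1, (isFuture_of_lorentz_neg x (by rw [h1]; norm_num) ?_).2⟩
    rw [hLx]
    linarith [y.time_pos]
  let E : LorentzEmbedding k n :=
    { lin := L
      map := fun y => ⟨L y.val, (hmap y).1, (hmap y).2⟩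
      val_map := fun y => rfl
      lorentz_lin := hpres }
  have hrange : LinearMap.range L = linSpan S := by
    refine Submodule.eq_of_le_of_finrank_eq ?_ ?_
    · rintro _ ⟨y, rfl⟩
      exact Submodule.add_mem _ (Submodule.sum_mem _ fun i _ => Submodule.smul_mem _ _ (heU i))
        (Submodule.smul_mem _ _ hx)
    · rw [LinearMap.finrank_range_of_inj E.lin_injective, finrank_lspace, hdim]
  refine ⟨E, hrange, Set.Subset.antisymm ?_ ?_⟩
  · rintro _ ⟨y, rfl⟩
    change L y.val ∈ linSpan S
    rw [← hrange]
    exact ⟨_, rfl⟩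
  · intro z hz
    have hz' : z.val ∈ LinearMap.range L := by rw [hrange]; exact hz
    obtain ⟨u, hu⟩ := hz'
    refine ⟨⟨u, ?_, ?_⟩, Hyp.ext hu⟩
    · rw [← hpres, hu, z.lorentz_self]
    · have h1 := hLx u
      rw [hu] at h1
      linarith [lorentz_le_neg_one z x]

end embeddings

/-! ### A face as a right-angled polytope -/

section faceModel

variable {n k : ℕ} {P F : Set (Hyp n)} {E : LorentzEmbedding k n}

lemma LorentzEmbedding.lorentz_eq (E : LorentzEmbedding k n) {a : LSpace k} {b : LSpace n}
    (h : E.lin a = b) (y : Hyp k) : lorentz y.val a = lorentz (E.map y).val b := by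
  rw [← h, E.lorentz_map]

/-- The map `E` parametrizes the span of the face `F` of the right-angled polytope `P`. -/
structure IsFaceModel (P F : Set (Hyp n)) (E : LorentzEmbedding k n) : Prop where
  rightAngled : IsRightAngledPolytope P
  isFace : IsFace P F
  range_lin : LinearMap.range E.lin = linSpan F
  range_map : Set.range E.map = hypSpan F

namespace IsFaceModel

lemma map_mem (hE : IsFaceModel P F E) (y : Hyp k) : E.map y ∈ hypSpan F := hE.range_map ▸ ⟨y, rfl⟩

lemma exists_map_eq (hE : IsFaceModel P F E) {x : Hyp n} (hx : x ∈ hypSpan F) : ∃ y, E.map y = x := by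
  rw [← hE.range_map] at hx
  exact hx

lemma exists_map_eq_of_mem (hE : IsFaceModel P F E) {x : Hyp n} (hx : x ∈ F) : ∃ y, E.map y = x :=
  hE.exists_map_eq (mem_linSpan hx)

lemma lorentz_containing (hE : IsFaceModel P F E) {s : Facet P} (hs : s ∈ facetsContaining P F) (y : Hyp k) :
    lorentz (E.map y).val s.normal = 0 :=
  (hE.isFace.mem_hypSpan hE.rightAngled).1 (hE.map_mem y) s hs

/-- Pulls the normals of the crossing facets back to `ℝ^{k,1}`; the values of `a` on other facets
are arbitrary. -/
lemma exists_lin_eq (hE : IsFaceModel P F E) :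
    ∃ a : Facet P → LSpace k, ∀ s ∈ facetsCrossing P F, E.lin (a s) = s.normal := by
  have h : ∀ s ∈ facetsCrossing P F, ∃ a, E.lin a = s.normal := fun s hs => by
    have := hE.isFace.normal_mem_linSpan hE.rightAngled hs
    rwa [← hE.range_lin] at this
  choose! a ha using h
  exact ⟨a, ha⟩

lemma mem_preimage_iff (hE : IsFaceModel P F E) {a : Facet P → LSpace k}
    (ha : ∀ s ∈ facetsCrossing P F, E.lin (a s) = s.normal) {y : Hyp k} :
    y ∈ E.map ⁻¹' F ↔ ∀ s ∈ facetsCrossing P F, lorentz y.val (a s) ≤ 0 := by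
  constructor
  · intro hy s hs
    rw [E.lorentz_eq (ha s hs)]
    exact hE.rightAngled.mem_iff.1 (hE.isFace.subset hy) s
  · intro h
    refine hE.isFace.mem_of_crossing hE.rightAngled (hE.map_mem y) fun s hs => ?_
    rw [← E.lorentz_eq (ha s hs)]
    exact h s hs

/-- The facets crossing `F` induce facets of `F`. -/
lemma exists_facet_of_crossing (hE : IsFaceModel P F E) {s : Facet P} (hs : s ∈ facetsCrossing P F) :
    ∃ G : Facet (E.map ⁻¹' F), E.lin G.normal = s.normal := by
  classical
  have := hE.rightAngled.finite
  have := Fintype.ofFinite (Facet P)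
  obtain ⟨a, ha⟩ := hE.exists_lin_eq
  obtain ⟨z, hzF, hzs, hz⟩ := hE.isFace.exists_crossing_point hE.rightAngled hs
  obtain ⟨y, rfl⟩ := hE.exists_map_eq_of_mem hzF
  refine ⟨⟨a s, isFacetNormal_of_mem ?_ (fun x hx => (hE.mem_preimage_iff ha).1 hx s hs)
    (Finset.univ.filter fun f => f ∈ facetsCrossing P F ∧ f ≠ s) a y ?_ (fun f hf => ?_)
    fun x hx h => (hE.mem_preimage_iff ha).2 fun f hf => ?_⟩, ha s hs⟩
  · rw [← E.lorentz_lin, ha s hs, s.self]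
  · rw [E.lorentz_eq (ha s hs), hzs]
  · obtain ⟨-, hf, hfs⟩ := Finset.mem_filter.1 hf
    rw [E.lorentz_eq (ha f hf)]
    exact hz f hf.1 hfs
  · by_cases hfs : f = s
    · rw [hfs, hx]
    · exact (h f (by simp [hf, hfs])).le

lemma exists_interior_point (hE : IsFaceModel P F E) : ∃ o : Hyp k, E.map o ∈ F ∧
    ∀ s ∉ facetsContaining P F, lorentz (E.map o).val s.normal < 0 := by
  obtain ⟨p, hp, hpF⟩ := hE.isFace.exists_facetsAt_eq hE.rightAngled
  obtain ⟨o, rfl⟩ := hE.exists_map_eq_of_mem hp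
  refine ⟨o, hp, fun s hs => lt_of_le_of_ne (hE.rightAngled.mem_iff.1 (hE.isFace.subset hp) s) ?_⟩
  intro h
  exact hs (hpF ▸ h)

/-- Each facet of `F` is induced by a facet crossing `F`. -/
lemma exists_crossing_of_facet (hE : IsFaceModel P F E) (G : Facet (E.map ⁻¹' F)) :
    ∃ s ∈ facetsCrossing P F, E.lin G.normal = s.normal := by
  classical
  have := hE.rightAngled.finite
  have := Fintype.ofFinite (Facet P)
  obtain ⟨a, ha⟩ := hE.exists_lin_eq
  obtain ⟨o, -, ho⟩ := hE.exists_interior_point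
  obtain ⟨s, hs, hGs⟩ := G.2.mem_of_eq (Finset.univ.filter fun f => f ∈ facetsCrossing P F) a
    (fun f hf => by
      rw [← E.lorentz_lin, ha f (Finset.mem_filter.1 hf).2, f.self])
    (fun x => by
      rw [hE.mem_preimage_iff ha]
      simp)
    o
    (fun f hf => by
      have hf' := (Finset.mem_filter.1 hf).2
      rw [E.lorentz_eq (ha f hf')]
      exact ho f hf'.1)
  have hs' := (Finset.mem_filter.1 hs).2
  refine ⟨s, hs', ?_⟩
  rw [← ha s hs', ← hGs]
  rfl

/-- Facets of `F` come from crossing facets of `P`, and `E` preserves the form. Facets of `P` with a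
common point are orthogonal, so one common point of the two facets of `F` is all that is used. -/
lemma isRightAngledPolytope (hE : IsFaceModel P F E) : IsRightAngledPolytope (E.map ⁻¹' F) := by
  classical
  have := hE.rightAngled.finite
  have := Fintype.ofFinite (Facet P)
  obtain ⟨a, ha⟩ := hE.exists_lin_eq
  refine ⟨⟨⟨(Finset.univ.filter fun f => f ∈ facetsCrossing P F).image a, ?_, ?_⟩, ?_, ?_⟩, ?_⟩
  · intro e he
    obtain ⟨f, hf, rfl⟩ := Finset.mem_image.1 he
    rw [← E.lorentz_lin, ha f (Finset.mem_filter.1 hf).2, f.self]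
  · ext y
    rw [hE.mem_preimage_iff ha]
    simp [halfSpace]
  · exact E.isometry.antilipschitz.isBounded_preimage
      (hE.rightAngled.1.2.1.subset hE.isFace.subset)
  · obtain ⟨o, -, ho⟩ := hE.exists_interior_point
    refine ⟨o, mem_interior.2 ⟨⋂ s ∈ facetsCrossing P F, {y | lorentz y.val (a s) < 0},
      fun y hy => (hE.mem_preimage_iff ha).2 fun s hs => ?_, ?_, ?_⟩⟩
    · exact le_of_lt (Set.mem_iInter₂.1 hy s hs)
    · exact (Set.toFinite _).isOpen_biInter fun s _ =>
        isOpen_lt (continuous_lorentz_right _) continuous_const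
    · refine Set.mem_iInter₂.2 fun s hs => ?_
      change lorentz o.val (a s) < 0
      rw [E.lorentz_eq (ha s hs)]
      exact ho s hs.1
  · rintro G G' hGG' ⟨-, -, ⟨y, hy, hy'⟩, -⟩
    obtain ⟨s, -, hGs⟩ := hE.exists_crossing_of_facet G
    obtain ⟨t, -, hGt⟩ := hE.exists_crossing_of_facet G'
    rw [← E.lorentz_lin, hGs, hGt]
    refine hE.rightAngled.orthogonal (z := E.map y) (fun h => hGG' (Facet.ext ?_)) ?_ ?_
    · exact E.lin_injective (by rw [hGs, hGt, h])
    · rw [← E.lorentz_eq hGs]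
      exact hy.2
    · rw [← E.lorentz_eq hGt]
      exact hy'.2

/-- The facet of `P` inducing a facet of `F` is determined by its intersection with `F`. -/
lemma toSet_inter_eq_iff (hE : IsFaceModel P F E) {G : Facet (E.map ⁻¹' F)} {s : Facet P} :
    s.toSet ∩ F = E.map '' G.toSet ↔ E.lin G.normal = s.normal := by
  have key : ∀ t : Facet P, E.lin G.normal = t.normal → t.toSet ∩ F = E.map '' G.toSet := by
    intro t ht
    ext x
    constructor
    · rintro ⟨⟨-, hx⟩, hxF⟩
      obtain ⟨y, rfl⟩ := hE.exists_map_eq_of_mem hxF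
      refine ⟨y, ⟨hxF, ?_⟩, rfl⟩
      change lorentz y.val G.normal = 0
      rw [E.lorentz_eq ht]
      exact hx
    · rintro ⟨y, ⟨hyF, hy⟩, rfl⟩
      refine ⟨⟨hE.isFace.subset hyF, ?_⟩, hyF⟩
      change lorentz (E.map y).val t.normal = 0
      rw [← E.lorentz_eq ht]
      exact hy
  refine ⟨fun h => ?_, key s⟩
  -- Let `t` be the facet inducing `G`. The witness `z` lies on no noncontaining facet but `t`, so
  -- `s = t` or `s` contains `F`; in the latter case `s ∩ F = F`, contradicted by an interior point
  -- of `F`.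
  obtain ⟨t, ht, hGt⟩ := hE.exists_crossing_of_facet G
  rw [← key t hGt] at h
  obtain ⟨z, hzF, hzt, hz⟩ := hE.isFace.exists_crossing_point hE.rightAngled ht
  have hzs : z ∈ s.toSet ∩ F := by
    rw [h]
    exact ⟨⟨hE.isFace.subset hzF, hzt⟩, hzF⟩
  by_cases hst : s = t
  · rw [hst, hGt]
  · have hsF : s ∈ facetsContaining P F := by
      by_contra hsF
      have h1 := hz s hsF hst
      have h2 : lorentz z.val s.normal = 0 := hzs.1.2
      linarith
    obtain ⟨o, hoF, ho⟩ := hE.exists_interior_point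
    have hot : E.map o ∈ t.toSet ∩ F := by
      rw [← h]
      exact ⟨⟨hE.isFace.subset hoF, hsF _ hoF⟩, hoF⟩
    have h1 := ho t ht.1
    have h2 : lorentz (E.map o).val t.normal = 0 := hot.1.2
    linarith

lemma existsUnique_facet (hE : IsFaceModel P F E) (G : Facet (E.map ⁻¹' F)) :
    ∃! s : Facet P, s.toSet ∩ F = E.map '' G.toSet := by
  obtain ⟨s, -, hs⟩ := hE.exists_crossing_of_facet G
  refine ⟨s, hE.toSet_inter_eq_iff.2 hs, fun t ht => Facet.ext ?_⟩
  rw [← hs, ← hE.toSet_inter_eq_iff.1 ht]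

/-! ### Restrictions and lifts of elements of the reflection groups -/

lemma facetRefl_map {G : Facet (E.map ⁻¹' F)} {s : Facet P} (h : E.lin G.normal = s.normal)
    (y : Hyp k) : (facetRefl s).1 (E.map y) = E.map ((facetRefl G).1 y) := by
  refine Hyp.ext ?_
  rw [E.val_map]
  change (E.map y).val - (2 * lorentz (E.map y).val s.normal) • s.normal =
    E.lin (y.val - (2 * lorentz y.val G.normal) • G.normal)
  rw [map_sub, map_smul, ← E.lorentz_eq h, h, E.val_map]

/-- Generator by generator. The lift is not unique in general: elements fixing `ℍ_F` pointwise may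
be multiplied in. -/
lemma exists_lift (hE : IsFaceModel P F E) (u : reflGroup (E.map ⁻¹' F)) :
    ∃ w : reflGroup P, ∀ y, w.1 (E.map y) = E.map (u.1 y) := by
  refine reflGroup_induction (p := fun u => ∃ w : reflGroup P, ∀ y, w.1 (E.map y) = E.map (u.1 y))
    ⟨1, fun y => rfl⟩ (fun G u ih => ?_) u
  obtain ⟨w, hw⟩ := ih
  obtain ⟨s, -, hs⟩ := hE.exists_crossing_of_facet G
  refine ⟨facetRefl s * w, fun y => ?_⟩
  change (facetRefl s).1 (w.1 (E.map y)) = E.map ((facetRefl G).1 (u.1 y))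
  rw [hw, facetRefl_map hs]

/-- A facet through `p` either contains `F`, and its reflection is trivial on `ℍ_F`, or crosses `F`,
and its reflection restricts to one across a facet of `F`. -/
lemma exists_restriction_of_mem (hE : IsFaceModel P F E) {p : Hyp n} (hp : p ∈ F) {w : reflGroup P}
    (hw : w ∈ reflSubgroup (facetsAt P p)) :
    ∃ u : reflGroup (E.map ⁻¹' F), ∀ y, w.1 (E.map y) = E.map (u.1 y) := by
  refine reflSubgroup_induction (T := facetsAt P p)
    (p := fun w => ∃ u : reflGroup (E.map ⁻¹' F), ∀ y, w.1 (E.map y) = E.map (u.1 y))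
    ⟨1, fun y => rfl⟩ (fun s hs w ih => ?_) hw
  obtain ⟨u, hu⟩ := ih
  by_cases hsF : s ∈ facetsContaining P F
  · refine ⟨u, fun y => ?_⟩
    change (facetRefl s).1 (w.1 (E.map y)) = _
    rw [hu, facetRefl_eq_self (hE.lorentz_containing hsF _)]
  · obtain ⟨G, hG⟩ := hE.exists_facet_of_crossing ⟨hsF, p, hp, hs⟩
    refine ⟨facetRefl G * u, fun y => ?_⟩
    change (facetRefl s).1 (w.1 (E.map y)) = E.map ((facetRefl G).1 (u.1 y))
    rw [hu, facetRefl_map hG]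

lemma inv_map {w : reflGroup P} {u : reflGroup (E.map ⁻¹' F)}
    (h : ∀ y, w.1 (E.map y) = E.map (u.1 y)) (y : Hyp k) :
    (w⁻¹).1 (E.map y) = E.map ((u⁻¹).1 y) := by
  change w.1.symm (E.map y) = E.map (u.1.symm y)
  rw [IsometryEquiv.symm_apply_eq, h, u.1.apply_symm_apply]

/-- An element of the reflection group of `P` mapping a point of the span of `F` into this span
restricts to an element of the reflection group of `F`. -/
lemma exists_restriction (hE : IsFaceModel P F E) (w : reflGroup P) {x : Hyp n} (hx : x ∈ hypSpan F)
    (hwx : w.1 x ∈ hypSpan F) :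
    ∃ u : reflGroup (E.map ⁻¹' F), ∀ y, w.1 (E.map y) = E.map (u.1 y) := by
  obtain ⟨y, rfl⟩ := hE.exists_map_eq hx
  obtain ⟨y', hy'⟩ := hE.exists_map_eq hwx
  -- Lifts of elements of `W_Q` move both points into `F`; there `strict` leaves an element
  -- generated by facets through a single point of `F`.
  obtain ⟨u₁, hu₁⟩ := hE.isRightAngledPolytope.exists_apply_mem y
  obtain ⟨u₂, hu₂⟩ := hE.isRightAngledPolytope.exists_apply_mem y'
  obtain ⟨w₁, hw₁⟩ := hE.exists_lift u₁
  obtain ⟨w₂, hw₂⟩ := hE.exists_lift u₂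
  have h1 : (w₂ * w * w₁⁻¹).1 (E.map (u₁.1 y)) = E.map (u₂.1 y') := by
    change w₂.1 (w.1 (w₁⁻¹.1 (E.map (u₁.1 y)))) = _
    rw [← hw₂, hy', ← hw₁]
    change w₂.1 (w.1 (w₁.1.symm (w₁.1 (E.map y)))) = _
    rw [w₁.1.symm_apply_apply]
  obtain ⟨-, hmem⟩ := hE.rightAngled.strict _ (hE.isFace.subset hu₁) (hE.isFace.subset hu₂) h1
  obtain ⟨u, hu⟩ := hE.exists_restriction_of_mem hu₁ hmem
  refine ⟨u₂⁻¹ * u * u₁, fun z => ?_⟩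
  have h2 : w = w₂⁻¹ * (w₂ * w * w₁⁻¹) * w₁ := by group
  rw [h2]
  change w₂⁻¹.1 ((w₂ * w * w₁⁻¹).1 (w₁.1 (E.map z))) = E.map (u₂⁻¹.1 (u.1 (u₁.1 z)))
  rw [hw₁, hu, inv_map hw₂]

lemma image_hypSpan (hE : IsFaceModel P F E) {g : Hyp n ≃ᵢ Hyp n} {u : Hyp k ≃ᵢ Hyp k}
    (h : ∀ y, g (E.map y) = E.map (u y)) : g '' hypSpan F = hypSpan F := by
  rw [← hE.range_map]
  ext x
  constructor
  · rintro ⟨_, ⟨y, rfl⟩, rfl⟩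
    exact ⟨_, (h y).symm⟩
  · rintro ⟨y, rfl⟩
    exact ⟨E.map (u.symm y), ⟨_, rfl⟩, by rw [h, u.apply_symm_apply]⟩

/-- Points of the span of a face which are identified in the small cover are identified by a deck
transformation preserving the span. -/
lemma proj_eq_iff_exists {A : Type*} [AddCommGroup A]
    {lam : reflGroup P →* Multiplicative A} (hE : IsFaceModel P F E) {x y : Hyp n} (hx : x ∈ hypSpan F)
    (hy : y ∈ hypSpan F) : proj (deckGroup lam) x = proj (deckGroup lam) y ↔
      ∃ g ∈ deckGroup lam, g '' hypSpan F = hypSpan F ∧ g x = y := by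
  rw [proj_eq_iff]
  constructor
  · rintro ⟨g, hg, rfl⟩
    obtain ⟨w, -, rfl⟩ := mem_deckGroup.1 hg
    obtain ⟨u, hu⟩ := hE.exists_restriction w hx hy
    exact ⟨w.1, hg, hE.image_hypSpan hu, rfl⟩
  · rintro ⟨g, hg, -, h⟩
    exact ⟨g, hg, h⟩

end IsFaceModel

end faceModel

/-! ### The induced characteristic function -/

section induced

variable {n k : ℕ} {P F : Set (Hyp n)} {E : LorentzEmbedding k n}
  {A : Type*} [AddCommGroup A] [Module (ZMod 2) A] {lam : reflGroup P →* Multiplicative A}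

lemma mem_faceSubspace {a : A} : a ∈ faceSubspace lam F ↔
    ∃ w : reflGroup P, w.1 '' F = F ∧ Multiplicative.toAdd (lam w) = a := Iff.rfl

lemma facetValue_mem_faceSubspace {s : Facet P} (hs : s ∈ facetsContaining P F) :
    facetValue lam s ∈ faceSubspace lam F := by
  refine mem_faceSubspace.2 ⟨facetRefl s, ?_, rfl⟩
  rw [Set.image_congr fun x hx => facetRefl_eq_self (hs x hx), Set.image_id']

/-- The elements of `V_F` are the values of the group generated by the reflections across the
facets containing `F`. -/
lemma IsFace.exists_of_mem_faceSubspace (hF : IsFace P F) (hP : IsRightAngledPolytope P) {a : A}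
    (ha : a ∈ faceSubspace lam F) :
    ∃ w ∈ reflSubgroup (facetsContaining P F), Multiplicative.toAdd (lam w) = a := by
  obtain ⟨w, hw, hwa⟩ := mem_faceSubspace.1 ha
  obtain ⟨p, hp, hpF⟩ := hF.exists_facetsAt_eq hP
  have hwp : w.1 p ∈ F := by
    rw [← hw]
    exact ⟨p, hp, rfl⟩
  refine ⟨w, ?_, hwa⟩
  rw [← hpF]
  exact (hP.strict w (hF.subset hp) (hF.subset hwp) rfl).2

lemma IsFace.faceSubspace_eq_span (hF : IsFace P F) (hP : IsRightAngledPolytope P) :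
    faceSubspace lam F = Submodule.span (ZMod 2) (facetValue lam '' facetsContaining P F) := by
  refine le_antisymm (fun a ha => ?_) (Submodule.span_le.2 ?_)
  · obtain ⟨w, hw, rfl⟩ := hF.exists_of_mem_faceSubspace hP ha
    obtain ⟨p, hp, hpF⟩ := hF.exists_facetsAt_eq hP
    rw [← hpF] at hw ⊢
    obtain ⟨S, hS, -, hl⟩ := hP.exists_finset lam p hw
    rw [hl]
    exact Submodule.sum_mem _ fun f hf => Submodule.subset_span ⟨f, hS f hf, rfl⟩
  · rintro _ ⟨s, hs, rfl⟩
    exact facetValue_mem_faceSubspace hs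

lemma IsFace.finrank_faceSubspace (hF : IsFace P F) (hP : IsRightAngledPolytope P)
    (hlam : IsCharacteristic lam) :
    Module.finrank (ZMod 2) (faceSubspace lam F) = (facetsContaining P F).ncard := by
  have := hP.finite
  have := Fintype.ofFinite (facetsContaining P F)
  obtain ⟨p, hp⟩ := hF.1
  have hli := (hlam.linearIndepOn hP (hF.subset hp)).mono (facetsContaining_subset hp)
  rw [hF.faceSubspace_eq_span hP, Set.image_eq_range]
  exact (finrank_span_eq_card hli).trans Fintype.card_eq_nat_card

namespace IsFaceModel

lemma mem_faceSubspace_of_restriction (hE : IsFaceModel P F E) {w : reflGroup P}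
    (h : ∀ y, w.1 (E.map y) = E.map y) :
    Multiplicative.toAdd (lam w) ∈ faceSubspace lam F := by
  refine mem_faceSubspace.2 ⟨w, ?_, rfl⟩
  have h1 : ∀ x ∈ F, w.1 x = x := fun x hx => by
    obtain ⟨y, rfl⟩ := hE.exists_map_eq_of_mem hx
    exact h y
  rw [Set.image_congr h1, Set.image_id']

lemma apply_map_eq (hE : IsFaceModel P F E) {w : reflGroup P}
    (hw : w ∈ reflSubgroup (facetsContaining P F)) (y : Hyp k) : w.1 (E.map y) = E.map y :=
  apply_eq_self_of_mem hw fun _ hf => hE.lorentz_containing hf y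

/-- Two lifts of `u` differ by an element fixing `F` pointwise, whose value lies in `V_F`. This
makes the induced homomorphism independent of the chosen lifts. -/
lemma mkQ_eq (hE : IsFaceModel P F E) {w w' : reflGroup P} {u : reflGroup (E.map ⁻¹' F)}
    (h : ∀ y, w.1 (E.map y) = E.map (u.1 y)) (h' : ∀ y, w'.1 (E.map y) = E.map (u.1 y)) :
    (faceSubspace lam F).mkQ (Multiplicative.toAdd (lam w)) =
      (faceSubspace lam F).mkQ (Multiplicative.toAdd (lam w')) := by
  rw [← sub_eq_zero, ← map_sub, Submodule.mkQ_apply, Submodule.Quotient.mk_eq_zero]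
  have h1 := hE.mem_faceSubspace_of_restriction (lam := lam) (w := w'⁻¹ * w) fun y => by
    change w'.1.symm (w.1 (E.map y)) = E.map y
    rw [h, ← h', w'.1.symm_apply_apply]
  rw [map_mul, map_inv, toAdd_mul, toAdd_inv] at h1
  rwa [sub_eq_neg_add]

/-- The homomorphism induced on the reflection group of a face. -/
lemma exists_induced (hE : IsFaceModel P F E) (lam : reflGroup P →* Multiplicative A) :
    ∃ lamBar : reflGroup (E.map ⁻¹' F) →* Multiplicative (A ⧸ faceSubspace lam F),
      ∀ (w : reflGroup P) (u : reflGroup (E.map ⁻¹' F)), (∀ y, w.1 (E.map y) = E.map (u.1 y)) →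
        Multiplicative.toAdd (lamBar u) =
          (faceSubspace lam F).mkQ (Multiplicative.toAdd (lam w)) := by
  choose lift hlift using hE.exists_lift
  refine ⟨MonoidHom.mk' (fun u => Multiplicative.ofAdd
    ((faceSubspace lam F).mkQ (Multiplicative.toAdd (lam (lift u))))) fun u v => ?_,
    fun w u h => hE.mkQ_eq (hlift u) h⟩
  have h1 := hE.mkQ_eq (lam := lam) (hlift (u * v)) (w' := lift u * lift v) fun y => by
    change (lift u).1 ((lift v).1 (E.map y)) = E.map (u.1 (v.1 y))
    rw [hlift, hlift]
  rw [h1, map_mul, toAdd_mul, map_add, ofAdd_add]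

variable {lamBar : reflGroup (E.map ⁻¹' F) →* Multiplicative (A ⧸ faceSubspace lam F)}

/-- The induced homomorphism of a characteristic function is a characteristic function. -/
lemma isCharacteristic [Module.Finite (ZMod 2) A] (hE : IsFaceModel P F E) (hlam : IsCharacteristic lam)
    (hA : Module.finrank (ZMod 2) (A ⧸ faceSubspace lam F) = k)
    (h : ∀ (w : reflGroup P) (u : reflGroup (E.map ⁻¹' F)),
      (∀ y, w.1 (E.map y) = E.map (u.1 y)) → Multiplicative.toAdd (lamBar u) =
        (faceSubspace lam F).mkQ (Multiplicative.toAdd (lam w))) :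
    IsCharacteristic lamBar := by
  have := hE.rightAngled.finite
  have hfacet : ∀ (G : Facet (E.map ⁻¹' F)) (s : Facet P), E.lin G.normal = s.normal →
      Multiplicative.toAdd (lamBar (facetRefl G)) =
        (faceSubspace lam F).mkQ (facetValue lam s) := fun G s hs =>
    h (facetRefl s) (facetRefl G) (facetRefl_map hs)
  constructor
  · -- the values at the facets through a vertex of the face span the quotient
    obtain ⟨p, hp, hpF⟩ := hE.isFace.exists_facetsAt_eq hE.rightAngled
    obtain ⟨v, hv, hpv, hcard⟩ := hE.rightAngled.exists_vertex (hE.isFace.subset hp)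
    have hvF : v ∈ F := (hE.isFace.mem_iff hE.rightAngled).2
      ⟨hv, fun f hf => hpv (hpF.ge hf)⟩
    have hspan := (hlam.basis_at_vertex hE.rightAngled hv hcard).2
    have key : ∀ a : A, ∃ u, Multiplicative.toAdd (lamBar u) = (faceSubspace lam F).mkQ a := by
      intro a
      have ha : a ∈ Submodule.span (ZMod 2) (facetValue lam '' facetsAt P v) := by
        rw [hspan]; trivial
      induction ha using Submodule.span_induction with
      | mem a ha =>
        obtain ⟨s, hs, rfl⟩ := ha
        by_cases hsF : s ∈ facetsContaining P F
        · refine ⟨1, ?_⟩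
          rw [map_one, toAdd_one, eq_comm, Submodule.mkQ_apply, Submodule.Quotient.mk_eq_zero]
          exact facetValue_mem_faceSubspace hsF
        · obtain ⟨G, hG⟩ := hE.exists_facet_of_crossing ⟨hsF, v, hvF, hs⟩
          exact ⟨facetRefl G, hfacet G s hG⟩
      | zero => exact ⟨1, by simp⟩
      | add a b _ _ iha ihb =>
        obtain ⟨u, hu⟩ := iha
        obtain ⟨u', hu'⟩ := ihb
        exact ⟨u * u', by rw [map_mul, toAdd_mul, hu, hu', map_add]⟩
      | smul c a _ iha =>
        obtain rfl | rfl := (by decide : ∀ c : ZMod 2, c = 0 ∨ c = 1) c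
        · exact ⟨1, by simp⟩
        · rwa [one_smul]
    intro b
    obtain ⟨a, ha⟩ := (faceSubspace lam F).mkQ_surjective (Multiplicative.toAdd b)
    obtain ⟨u, hu⟩ := key a
    exact ⟨u, Multiplicative.toAdd.injective (hu.trans ha)⟩
  · rintro G hG ⟨v, -, hv⟩
    choose s hs hGs using fun i => hE.exists_crossing_of_facet (G i)
    have hsinj : Function.Injective s := fun i j hij => hG (Facet.ext (E.lin_injective (by
      rw [hGs, hGs, hij])))
    have hsv : ∀ i, s i ∈ facetsAt P (E.map v) := fun i => by
      rw [mem_facetsAt, ← E.lorentz_eq (hGs i)]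
      exact (hv i).2
    have hli : LinearIndependent (ZMod 2)
        (fun i => Multiplicative.toAdd (lamBar (facetRefl (G i)))) := by
      have h0 : (fun i => Multiplicative.toAdd (lamBar (facetRefl (G i)))) =
          (faceSubspace lam F).mkQ ∘ fun i => facetValue lam (s i) :=
        funext fun i => hfacet (G i) (s i) (hGs i)
      -- For `k = 0` the hypothesis `hv` is vacuous and does not place `v` in the face, but then the
      -- family is empty.
      by_cases hvF : Nonempty (Fin k)
      · obtain ⟨i₀⟩ := hvF
        have hvF : E.map v ∈ F := (hv i₀).1
        have hli := hlam.linearIndepOn hE.rightAngled (hE.isFace.subset hvF)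
        rw [h0]
        refine LinearIndependent.map (hli.comp (fun i => ⟨s i, hsv i⟩)
          fun i j hij => hsinj (Subtype.mk.inj hij)) ?_
        rw [Submodule.ker_mkQ, hE.isFace.faceSubspace_eq_span hE.rightAngled]
        -- Independence modulo `V_F`: the facets `s i` and the facets containing `F` are disjoint
        -- parts of the family at `E.map v`, whose values are independent.
        have hdis := LinearIndependent.disjoint_span_image hli
          (s := {f | f.1 ∈ Set.range s}) (t := {f | f.1 ∈ facetsContaining P F}) (by
            rw [Set.disjoint_left]
            rintro f ⟨i, hi⟩ hf
            exact (hs i).1 (hi ▸ hf))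
        refine hdis.mono (Submodule.span_mono ?_) (Submodule.span_mono ?_)
        · rintro _ ⟨i, rfl⟩
          exact ⟨⟨s i, hsv i⟩, ⟨i, rfl⟩, rfl⟩
        · rintro _ ⟨f, hf, rfl⟩
          exact ⟨⟨f, hf _ hvF⟩, hf, rfl⟩
      · rw [not_nonempty_iff] at hvF
        exact linearIndependent_empty_type
    refine ⟨hli, ?_⟩
    exact hli.span_eq_top_of_card_eq_finrank' (by rw [Fintype.card_fin, hA])

/-- The kernel of the induced homomorphism consists of the restrictions of deck transformations. -/
lemma mem_deckGroup_iff (hE : IsFaceModel P F E)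
    (h : ∀ (w : reflGroup P) (u : reflGroup (E.map ⁻¹' F)),
      (∀ y, w.1 (E.map y) = E.map (u.1 y)) → Multiplicative.toAdd (lamBar u) =
        (faceSubspace lam F).mkQ (Multiplicative.toAdd (lam w))) (u : Hyp k ≃ᵢ Hyp k) :
    u ∈ deckGroup lamBar ↔ ∃ g ∈ deckGroup lam, ∀ y, g (E.map y) = E.map (u y) := by
  constructor
  · intro hu
    obtain ⟨u, hu₁, rfl⟩ := mem_deckGroup.1 hu
    obtain ⟨w, hw⟩ := hE.exists_lift u
    have h1 := h w u hw
    rw [hu₁, toAdd_one, eq_comm, Submodule.mkQ_apply, Submodule.Quotient.mk_eq_zero] at h1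
    -- The lift `w` has its value in `V_F`; dividing by an element with the same value that is
    -- trivial on `ℍ_F` puts it in `Γ_λ` without changing its restriction.
    obtain ⟨v, hv, hvw⟩ := hE.isFace.exists_of_mem_faceSubspace hE.rightAngled h1
    refine ⟨(w * v⁻¹).1, mem_deckGroup.2 ⟨w * v⁻¹, ?_, rfl⟩, fun y => ?_⟩
    · rw [map_mul, map_inv, Multiplicative.toAdd.injective hvw, mul_inv_cancel]
    · change w.1 (v⁻¹.1 (E.map y)) = _
      rw [hE.apply_map_eq (Subgroup.inv_mem _ hv), hw]
  · rintro ⟨g, hg, hgu⟩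
    obtain ⟨w, hw, rfl⟩ := mem_deckGroup.1 hg
    obtain ⟨o, -, -⟩ := hE.exists_interior_point
    obtain ⟨u', hu'⟩ := hE.exists_restriction w (hE.map_mem o) (by
      rw [hgu]
      exact hE.map_mem _)
    have huu' : u'.1 = u := IsometryEquiv.ext fun y => E.isometry.injective (by rw [← hu', hgu])
    refine mem_deckGroup.2 ⟨u', Multiplicative.toAdd.injective ?_, huu'⟩
    rw [h w u' hu', hw, toAdd_one, map_zero, toAdd_one]

/-- Near a point of the span of a face there are no points of other translates of the span. -/
lemma exists_forall_mem_hypSpan (hE : IsFaceModel P F E) {x : Hyp n} (hx : x ∈ hypSpan F) :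
    ∃ ε > 0, ∀ y, dist y x < ε → ∀ w : reflGroup P, w.1 y ∈ hypSpan F → y ∈ hypSpan F := by
  obtain ⟨a, rfl⟩ := hE.exists_map_eq hx
  obtain ⟨u₁, hu₁⟩ := hE.isRightAngledPolytope.exists_apply_mem a
  obtain ⟨w₁, hw₁⟩ := hE.exists_lift u₁
  obtain ⟨δ, hδ, h⟩ := hE.rightAngled.exists_local_stabilizer (hE.isFace.subset hu₁)
  refine ⟨δ, hδ, fun y hy w hwy => ?_⟩
  obtain ⟨b, hb⟩ := hE.exists_map_eq hwy
  obtain ⟨u₂, hu₂⟩ := hE.isRightAngledPolytope.exists_apply_mem b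
  obtain ⟨w₂, hw₂⟩ := hE.exists_lift u₂
  -- This element takes a point of `F` to `w₁ y`, close to `w₁` of the base point in `F`. So it lies
  -- in the stabilizer of that point and preserves `ℍ_F`.
  have h1 : (w₁ * (w₂ * w)⁻¹).1 (E.map (u₂.1 b)) = w₁.1 y := by
    rw [← hw₂, hb]
    change w₁.1 ((w₂ * w).1.symm ((w₂ * w).1 y)) = _
    rw [IsometryEquiv.symm_apply_apply]
  obtain ⟨u, hu⟩ := hE.exists_restriction_of_mem hu₁ (h (w₁ * (w₂ * w)⁻¹) _
    (hE.isFace.subset hu₂) (by rw [h1, ← hw₁, w₁.1.dist_eq]; exact hy))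
  have h2 : y = (w₁⁻¹).1 (E.map (u.1 (u₂.1 b))) := by
    rw [← hu, h1]
    exact (w₁.1.symm_apply_apply y).symm
  rw [h2, inv_map hw₁]
  exact hE.map_mem _

/-- The image of the span of a face is a totally geodesic submanifold of the small cover. -/
lemma isTotallyGeodesicSubmanifold (hE : IsFaceModel P F E) (hlam : IsCharacteristic lam)
    (hk : HasDim F k) : IsTotallyGeodesicSubmanifold n k (faceImage lam F) := by
  rintro _ ⟨x, hx, rfl⟩
  obtain ⟨δ, hδ, hfree⟩ := hlam.exists_le_dist hE.rightAngled x
  obtain ⟨ε, hε, hspan⟩ := hE.exists_forall_mem_hypSpan hx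
  -- The chart is the projection: radius `δ/4` makes it isometric, and radius `ε` keeps out other
  -- translates of `ℍ_F`.
  refine ⟨min ε (δ / 4), by positivity, x, proj _, hypSpan F,
    ⟨⟨x, hx⟩, linSpan F, hk.2, rfl⟩, rfl, Set.Subset.antisymm ?_ ?_, ?_, ?_⟩
  · rintro _ ⟨y, hy, rfl⟩
    exact (dist_proj_le y x).trans_lt hy
  · intro q hq
    obtain ⟨y, hy, hyx⟩ := exists_rep_of_dist_lt hq
    exact ⟨y, hyx, hy⟩
  · intro y hy z hz
    exact dist_proj_eq hfree (lt_of_lt_of_le hy (min_le_right _ _))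
      (lt_of_lt_of_le hz (min_le_right _ _))
  · intro y hy
    constructor
    · rintro ⟨z, hz, hzy⟩
      obtain ⟨g, hg, rfl⟩ := proj_eq_iff.1 hzy.symm
      obtain ⟨w, -, rfl⟩ := mem_deckGroup.1 hg
      exact hspan y (lt_of_lt_of_le hy (min_le_left _ _)) w hz
    · exact fun h => ⟨y, h, rfl⟩

/-- The map of small covers induced by the inclusion of the span of a face. -/
lemma exists_embedding (hE : IsFaceModel P F E) (hlam : IsCharacteristic lam)
    (hbar : IsCharacteristic lamBar)
    (hker : ∀ u : Hyp k ≃ᵢ Hyp k, u ∈ deckGroup lamBar ↔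
      ∃ g ∈ deckGroup lam, ∀ y, g (E.map y) = E.map (u y)) :
    ∃ ι : SmallCover lamBar → SmallCover lam,
      (∀ y, ι (proj (deckGroup lamBar) y) = proj (deckGroup lam) (E.map y)) ∧
      Topology.IsEmbedding ι ∧ Set.range ι = faceImage lam F ∧
      ∀ q, ∃ ε > 0, ∀ a ∈ Metric.ball q ε, ∀ b ∈ Metric.ball q ε, dist (ι a) (ι b) = dist a b := by
  let ι : SmallCover lamBar → SmallCover lam := Quotient.lift (s := orbitSetoid (deckGroup lamBar))
    (fun y => proj (deckGroup lam) (E.map y)) (by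
      rintro y _ ⟨u, hu, rfl⟩
      obtain ⟨g, hg, hgu⟩ := (hker u).1 hu
      exact proj_eq_iff.2 ⟨g, hg, hgu y⟩)
  have hι : ∀ y, ι (proj (deckGroup lamBar) y) = proj (deckGroup lam) (E.map y) := fun y => rfl
  have hinj : Function.Injective ι := by
    intro a b hab
    obtain ⟨y, rfl⟩ := exists_proj_eq a
    obtain ⟨z, rfl⟩ := exists_proj_eq b
    rw [hι, hι] at hab
    obtain ⟨g, hg, hgy⟩ := proj_eq_iff.1 hab
    obtain ⟨w, -, rfl⟩ := mem_deckGroup.1 hg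
    obtain ⟨u, hu⟩ := hE.exists_restriction w (hE.map_mem y) (by rw [hgy]; exact hE.map_mem z)
    refine proj_eq_iff.2 ⟨u.1, (hker u.1).2 ⟨w.1, hg, hu⟩, E.isometry.injective ?_⟩
    rw [← hu, hgy]
  have hle : ∀ a b, dist (ι a) (ι b) ≤ dist a b := by
    intro a b
    refine le_csInf (repDists_nonempty a b) ?_
    rintro _ ⟨y, z, rfl, rfl, rfl⟩
    rw [hι, hι, ← E.isometry.dist_eq]
    exact dist_proj_le _ _
  -- small balls around a point of the image come from small balls in the source
  have hloc : ∀ q, ∃ ε > 0, ∀ a, dist (ι a) (ι q) < ε → dist a q ≤ dist (ι a) (ι q) := by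
    intro q
    obtain ⟨y₀, rfl⟩ := exists_proj_eq q
    obtain ⟨δ, hδ, hfree⟩ := hlam.exists_le_dist hE.rightAngled (E.map y₀)
    obtain ⟨ε, hε, hspan⟩ := hE.exists_forall_mem_hypSpan (hE.map_mem y₀)
    refine ⟨min ε (δ / 4), by positivity, fun a ha => ?_⟩
    obtain ⟨x, hx, hxd⟩ := exists_rep_of_dist_lt ha
    obtain ⟨z, rfl⟩ := exists_proj_eq a
    rw [hι] at hx
    obtain ⟨g, hg, hgx⟩ := proj_eq_iff.1 hx
    obtain ⟨w, -, rfl⟩ := mem_deckGroup.1 hg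
    have hxF : x ∈ hypSpan F := hspan x (lt_of_lt_of_le hxd (min_le_left _ _)) w (by
      rw [hgx]; exact hE.map_mem z)
    obtain ⟨y, rfl⟩ := hE.exists_map_eq hxF
    have hzy : proj (deckGroup lamBar) z = proj (deckGroup lamBar) y :=
      hinj (by rw [hι, hι, hx])
    rw [hzy, hι, hι, dist_proj_eq hfree (lt_of_lt_of_le hxd (min_le_right _ _))
      (by rw [dist_self]; positivity), E.isometry.dist_eq]
    exact dist_proj_le y y₀
  refine ⟨ι, hι, ⟨?_, hinj⟩, ?_, ?_⟩
  -- Continuity comes from the Lipschitz bound `hle`, continuity of the inverse from `hloc`.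
  · rw [Topology.isInducing_iff_nhds]
    intro q
    refine le_antisymm ?_ ?_
    · rw [← Filter.tendsto_iff_comap, tendsto_iff_dist_tendsto_zero]
      exact squeeze_zero (fun _ => dist_nonneg) (fun a => hle a q)
        (tendsto_iff_dist_tendsto_zero.1 Filter.tendsto_id)
    · obtain ⟨ε, hε, h⟩ := hloc q
      intro s hs
      obtain ⟨r, hr, hrs⟩ := Metric.mem_nhds_iff.1 hs
      refine ⟨Metric.ball (ι q) (min ε r), Metric.ball_mem_nhds _ (lt_min hε hr), fun a ha => ?_⟩
      exact hrs ((h a (lt_of_lt_of_le ha (min_le_left _ _))).trans_lt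
        (lt_of_lt_of_le ha (min_le_right _ _)))
  · ext p
    constructor
    · rintro ⟨a, rfl⟩
      obtain ⟨y, rfl⟩ := exists_proj_eq a
      exact ⟨E.map y, hE.map_mem y, (hι y).symm⟩
    · rintro ⟨x, hx, rfl⟩
      obtain ⟨y, rfl⟩ := hE.exists_map_eq hx
      exact ⟨_, hι y⟩
  · intro q
    obtain ⟨y₀, rfl⟩ := exists_proj_eq q
    obtain ⟨δ, hδ, hfree⟩ := hlam.exists_le_dist hE.rightAngled (E.map y₀)
    obtain ⟨δ', hδ', hfree'⟩ := hbar.exists_le_dist hE.isRightAngledPolytope y₀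
    refine ⟨min (δ / 4) (δ' / 4), by positivity, fun a ha b hb => ?_⟩
    obtain ⟨y, rfl, hy⟩ := exists_rep_of_dist_lt ha
    obtain ⟨z, rfl, hz⟩ := exists_rep_of_dist_lt hb
    rw [hι, hι, dist_proj_eq hfree' (lt_of_lt_of_le hy (min_le_right _ _))
      (lt_of_lt_of_le hz (min_le_right _ _)), dist_proj_eq hfree
      (by rw [E.isometry.dist_eq]; exact lt_of_lt_of_le hy (min_le_left _ _))
      (by rw [E.isometry.dist_eq]; exact lt_of_lt_of_le hz (min_le_left _ _)),
      E.isometry.dist_eq]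

end IsFaceModel

end induced

end SmallCovers

/-! ### The main theorem -/

theorem proposition2p3 {n k : ℕ} (P : Set (Hyp n)) (hP : IsRightAngledPolytope P)
    (lam : reflGroup P →* Multiplicative (Fin n → ZMod 2)) (hlam : IsCharacteristic lam)
    (F : Set (Hyp n)) (hF : IsFace P F) (hk : HasDim F k) :
    -- the image `M_F` of `ℍ_F` is `ℍ_F / (Γ_λ ∩ Stab ℍ_F)`
    (∀ x ∈ hypSpan F, ∀ y ∈ hypSpan F,
      proj (deckGroup lam) x = proj (deckGroup lam) y ↔
        ∃ g ∈ deckGroup lam, g '' hypSpan F = hypSpan F ∧ g x = y) ∧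
    -- `M_F` is a totally geodesic submanifold of dimension `k = dim F`
    IsTotallyGeodesicSubmanifold n k (faceImage lam F) ∧
    -- `V_F` has codimension `k`
    Module.finrank (ZMod 2) ((Fin n → ZMod 2) ⧸ faceSubspace lam F) = k ∧
    -- an isometry `φ` of `ℍᵏ` with `ℍ_F` makes `F` a right-angled polytope in `ℍᵏ`
    ∃ φ : Hyp k → Hyp n, Isometry φ ∧ Set.range φ = hypSpan F ∧
      IsRightAngledPolytope (φ ⁻¹' F) ∧
      -- each facet `G` of `F` is `F' ∩ F` for a unique facet `F'` of `P`, and the reflection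
      -- across `F'` restricts to the reflection of `ℍ_F` across `G`
      (∀ G : Facet (φ ⁻¹' F), ∃! F' : Facet P, F'.toSet ∩ F = φ '' G.toSet) ∧
      (∀ (G : Facet (φ ⁻¹' F)) (F' : Facet P), F'.toSet ∩ F = φ '' G.toSet →
        ∀ y, (facetRefl F' : Hyp n ≃ᵢ Hyp n) (φ y) = φ ((facetRefl G : Hyp k ≃ᵢ Hyp k) y)) ∧
      -- the induced characteristic function of `F`
      ∃ lamBar : reflGroup (φ ⁻¹' F) →*
          Multiplicative ((Fin n → ZMod 2) ⧸ faceSubspace lam F),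
        IsCharacteristic lamBar ∧
        (∀ (w : reflGroup P) (u : reflGroup (φ ⁻¹' F)),
          (∀ y, (w : Hyp n ≃ᵢ Hyp n) (φ y) = φ ((u : Hyp k ≃ᵢ Hyp k) y)) →
          Multiplicative.toAdd (lamBar u) =
            (faceSubspace lam F).mkQ (Multiplicative.toAdd (lam w))) ∧
        -- its kernel is the group of isometries of `ℍ_F` induced by `Γ_λ ∩ Stab ℍ_F`
        (∀ u : Hyp k ≃ᵢ Hyp k, u ∈ deckGroup lamBar ↔
          ∃ g ∈ deckGroup lam, ∀ y, g (φ y) = φ (u y)) ∧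
        -- `φ` induces a locally isometric embedding of the small cover of `F` with image `M_F`
        ∃ ι : SmallCover lamBar → SmallCover lam,
          (∀ y, ι (proj (deckGroup lamBar) y) = proj (deckGroup lam) (φ y)) ∧
          Topology.IsEmbedding ι ∧ Set.range ι = faceImage lam F ∧
          ∀ q, ∃ ε > 0, ∀ a ∈ Metric.ball q ε, ∀ b ∈ Metric.ball q ε,
            dist (ι a) (ι b) = dist a b := by
  obtain ⟨E, hlin, hmap⟩ := exists_lorentzEmbedding hk
  have hE : IsFaceModel P F E := ⟨hP, hF, hlin, hmap⟩
  have hdim : Module.finrank (ZMod 2) ((Fin n → ZMod 2) ⧸ faceSubspace lam F) = k := by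
    have h1 := (faceSubspace lam F).finrank_quotient_add_finrank
    rw [hF.finrank_faceSubspace hP hlam, Module.finrank_fin_fun] at h1
    have h2 := hF.ncard_add hP hk
    omega
  obtain ⟨lamBar, hbar⟩ := hE.exists_induced lam
  have hchar := hE.isCharacteristic hlam hdim hbar
  have hker := hE.mem_deckGroup_iff hbar
  exact ⟨fun x hx y hy => hE.proj_eq_iff_exists hx hy, hE.isTotallyGeodesicSubmanifold hlam hk,
    hdim, E.map, E.isometry, hmap, hE.isRightAngledPolytope, hE.existsUnique_facet,
    fun G s h => IsFaceModel.facetRefl_map (hE.toSet_inter_eq_iff.1 h),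
    lamBar, hchar, hbar, hker, hE.exists_embedding hlam hchar hker⟩
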